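/- Let $\mathsf{RCA}_0^\omega$ be Kohlenbach's base theory of higher-order Reverse Mathematics, in the language of all finite types (equality at higher types is defined extensionally from equality of natural numbers): its axioms are those of an ordered semi-ring for $0,1,<,+,\times$ on type $0$, the defining axioms of the combinators $\Pi$ and $\Sigma$ and of the recursor $\mathbf R_0$, the axiom of extensionality at all finite types, induction for quantifier-free formulas, and $\mathsf{QF\text{-}AC}^{1,0}$. Let $\mathsf{ACA}_0^\omega=\mathsf{RCA}_0^\omega+(\exists^2)$, where $$(\exists^2)\qquad (\exists\varphi^2\le_2 1)(\forall f^1)\big[(\exists n^0)(f(n)=0)\leftrightarrow\varphi(f)=0\big].$$ Reals are coded by fast-converging sequences of (codes of) rationals, i.e. $|q_n-q_{n+i}|<2^{-n}$ for all $n,i$; functions $f:[0,1]\to\mathbb R$ are given by type $1\to1$ objects that respect equality of reals; subsets of $[0,1]$ are given by characteristic functions (of type $1\to 0$) on the reals, and a subset $O$ of $[0,1]$ is open if for every $x\in O$ there is $k\in\mathbb N$ with $B(x,2^{-k})\cap[0,1]\subseteq O$. A function $f:[0,1]\to\mathbb R$ is * cliquish if for all $x_0\in[0,1]$, $\varepsilon>0$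 and open $U\ni x_0$ there is a non-empty open $G\subseteq U$ with $|f(x)-f(y)|<\varepsilon$ for all $x,y\in G$; * upper (resp. lower) quasi-continuous at $x_0$ if for all $\varepsilon>0$ and open $U\ni x_0$ there is a non-empty open $G\subseteq U$ with $f(x)<f(x_0)+\varepsilon$ (resp. $f(x)>f(x_0)-\varepsilon$) for all $x\in G$; it is upper quasi-continuous (uqco) if it is so at every point of $[0,1]$; * totally discontinuous if it is not continuous at any point of $[0,1]$. A function $\mathrm{osc}_f:[0,1]\to\mathbb R$ is the oscillation function of $f$ if for all $x\in[0,1]$ $$\mathrm{osc}_f(x)=\lim_{k\to\infty}\Big(\sup_{B(x,2^{-k})\cap[0,1]}f-\inf_{B(x,2^{-k})\cap[0,1]}f\Big),$$ where the suprema and infima are read comparatively and need not exist as reals in the theory. **Theorem.** $\mathsf{ACA}_0^\omega$ proves that the following statements are equivalent (that is, it proves the equivalence of any two of them). (a) $\mathsf{BCT}_{[0,1]}$: if $(O_n)_{n\in\mathbb N}$ is a decreasing sequence of dense open subsets of $[0,1]$, then $\bigcap_{n}O_n$ is non-empty. (b) For every cliquish $f:[0,1]\to\mathbb R$ which has an oscillation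 function $\mathrm{osc}_f:[0,1]\to\mathbb R$, there is a point $x\in[0,1]$ where $f$ is continuous. (c) For every cliquish $f:[0,1]\to\mathbb R$ which has an oscillation function $\mathrm{osc}_f:[0,1]\to\mathbb R$, there is a point $x\in[0,1]$ where $f$ is lower quasi-continuous. (d) For every cliquish and upper quasi-continuous $f:[0,1]\to\mathbb R$ which has an oscillation function $\mathrm{osc}_f:[0,1]\to\mathbb R$, there is a point $x\in[0,1]$ where $f$ is continuous. (e) For every totally discontinuous $f:[0,1]\to\mathbb R$ with oscillation function $\mathrm{osc}_f:[0,1]\to\mathbb R$, there are $N\in\mathbb N$ and $c,d\in[0,1]$ with $c<d$ such that $\mathrm{osc}_f(x)\ge 2^{-N}$ for all $x\in(c,d)$. -/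

import Mathlib

/-! Higher-order arithmetic: finite types, the language of all finite types, a classical
natural deduction calculus for it, the theory `ACA₀^ω`, and the notions of real analysis
formalised in that language.

Everything here is syntax: a mathematical statement is a formula (`Fml`), and "provable in
`ACA₀^ω`" means that there is a derivation in the calculus `Deriv`. -/

namespace HOA

/-! ### Finite types, terms, formulas -/

/-- The finite types: `nat` is the type `0`, and `arr σ τ` is `σ → τ`. -/
inductive Ty : Type
  | nat : Ty
  | arr : Ty → Ty → Ty
  deriving DecidableEq

infixr:60 " ⇒ " => Ty.arr

/-- The type `1`, i.e. `0 → 0`. -/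
abbrev Ty.one : Ty := Ty.nat ⇒ Ty.nat

/-- The type `2`, i.e. `(0 → 0) → 0`. -/
abbrev Ty.two : Ty := Ty.one ⇒ Ty.nat

/-- The constants of the language. -/
inductive Con : Ty → Type
  | zero : Con Ty.nat
  | one : Con Ty.nat
  | add : Con (Ty.nat ⇒ Ty.nat ⇒ Ty.nat)
  | mul : Con (Ty.nat ⇒ Ty.nat ⇒ Ty.nat)
  /-- the combinator `Π` -/
  | K (σ τ : Ty) : Con (σ ⇒ τ ⇒ σ)
  /-- the combinator `Σ` -/
  | S (ρ σ τ : Ty) : Con ((ρ ⇒ σ ⇒ τ) ⇒ (ρ ⇒ σ) ⇒ ρ ⇒ τ)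
  /-- the recursor constant `R_σ` -/
  | R (σ : Ty) : Con ((Ty.nat ⇒ σ ⇒ σ) ⇒ σ ⇒ Ty.nat ⇒ σ)

/-- Terms.  For each type `σ` there are variables `var σ 0, var σ 1, …`; these are de Bruijn
indices, counted separately for each type. -/
inductive Tm : Ty → Type
  | var (σ : Ty) (n : ℕ) : Tm σ
  | con {σ : Ty} (c : Con σ) : Tm σ
  | app {σ τ : Ty} (f : Tm (σ ⇒ τ)) (x : Tm σ) : Tm τ

/-- Formulas.  The atomic formulas are equations and inequalities between terms of type `0`.
`all σ φ` binds the variable `var σ 0` of `φ`. -/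
inductive Fml : Type
  | eq (s t : Tm Ty.nat) : Fml
  | lt (s t : Tm Ty.nat) : Fml
  | bot : Fml
  | imp (φ ψ : Fml) : Fml
  | all (σ : Ty) (φ : Fml) : Fml

namespace Fml

def neg (φ : Fml) : Fml := imp φ bot
def conj (φ ψ : Fml) : Fml := neg (imp φ (neg ψ))
def disj (φ ψ : Fml) : Fml := imp (neg φ) ψ
def ex (σ : Ty) (φ : Fml) : Fml := neg (all σ (neg φ))

/-- Formulas without quantifiers (parameters of all types are allowed). -/
inductive QF : Fml → Prop
  | eq (s t : Tm Ty.nat) : QF (eq s t)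
  | lt (s t : Tm Ty.nat) : QF (lt s t)
  | bot : QF bot
  | imp {φ ψ : Fml} : QF φ → QF ψ → QF (imp φ ψ)

end Fml

/-! ### Substitution -/

/-- A simultaneous substitution. -/
abbrev Sub : Type := (σ : Ty) → ℕ → Tm σ

def Tm.subst (s : Sub) : {σ : Ty} → Tm σ → Tm σ
  | _, .var σ n => s σ n
  | _, .con c => .con c
  | _, .app f x => .app (f.subst s) (x.subst s)

/-- Make room for a new bound variable `var σ 0`. -/
def Sub.shift (σ : Ty) : Sub := fun τ n => Tm.var τ (if τ = σ then n + 1 else n)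

/-- Carry a substitution under a quantifier over type `σ`. -/
def Sub.lift (σ : Ty) (s : Sub) : Sub := fun τ n =>
  if τ = σ then
    match n with
    | 0 => Tm.var τ 0
    | m + 1 => (s τ m).subst (Sub.shift σ)
  else (s τ n).subst (Sub.shift σ)

/-- Replace `var σ 0` by `t` and lower the other variables of type `σ`. -/
def Sub.single {σ : Ty} (t : Tm σ) : Sub := fun τ n =>
  if h : τ = σ then
    match n with
    | 0 => h.symm ▸ t
    | m + 1 => Tm.var τ m
  else Tm.var τ n

def Fml.subst : Sub → Fml → Fml
  | s, .eq t u => .eq (t.subst s) (u.subst s)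
  | s, .lt t u => .lt (t.subst s) (u.subst s)
  | _, .bot => .bot
  | s, .imp φ ψ => .imp (φ.subst s) (ψ.subst s)
  | s, .all σ φ => .all σ (φ.subst (Sub.lift σ s))

/-- The instance `φ(t)` of the body `φ` of a quantified formula. -/
def Fml.inst {σ : Ty} (φ : Fml) (t : Tm σ) : Fml := φ.subst (Sub.single t)

/-! ### Derivations -/

/-- Classical natural deduction, with equality at type `0`.  `Deriv Ax Γ φ`: from the axioms
`Ax` (free variables in axioms are read universally) and the hypotheses `Γ`, one can derive
`φ`. -/
inductive Deriv (Ax : Set Fml) : List Fml → Fml → Prop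
  | axm {Γ : List Fml} {φ : Fml} : φ ∈ Ax → Deriv Ax Γ φ
  | hyp {Γ : List Fml} {φ : Fml} : φ ∈ Γ → Deriv Ax Γ φ
  | impI {Γ : List Fml} {φ ψ : Fml} : Deriv Ax (φ :: Γ) ψ → Deriv Ax Γ (.imp φ ψ)
  | impE {Γ : List Fml} {φ ψ : Fml} : Deriv Ax Γ (.imp φ ψ) → Deriv Ax Γ φ → Deriv Ax Γ ψ
  | raa {Γ : List Fml} {φ : Fml} : Deriv Ax (φ.neg :: Γ) .bot → Deriv Ax Γ φ
  | allI {Γ : List Fml} {σ : Ty} {φ : Fml} :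
      Deriv Ax (Γ.map (Fml.subst (Sub.shift σ))) φ → Deriv Ax Γ (.all σ φ)
  | allE {Γ : List Fml} {σ : Ty} {φ : Fml} (t : Tm σ) :
      Deriv Ax Γ (.all σ φ) → Deriv Ax Γ (φ.inst t)
  | eqRefl {Γ : List Fml} (t : Tm Ty.nat) : Deriv Ax Γ (.eq t t)
  | eqSubst {Γ : List Fml} {s t : Tm Ty.nat} (φ : Fml) :
      Deriv Ax Γ (.eq s t) → Deriv Ax Γ (φ.inst s) → Deriv Ax Γ (φ.inst t)

/-- `Ax` proves `φ`. -/
def Proves (Ax : Set Fml) (φ : Fml) : Prop := Deriv Ax [] φ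

/-! ### Writing formulas with Lean binders

An *expression* is a term or formula that may be used under any number of quantifiers: it is
given as a function of the number of quantifiers (over each type) in whose scope it is placed.
`all σ fun x => …` then quantifies over `x` without any de Bruijn index being written. -/

abbrev Depth : Type := Ty → ℕ
abbrev TmX (σ : Ty) : Type := Depth → Tm σ
abbrev FmlX : Type := Depth → Fml

/-- The variable of type `σ` bound by the quantifier that sits at depth `d`. -/
def boundVar (σ : Ty) (d : Depth) : TmX σ := fun e => Tm.var σ (e σ - d σ - 1)

def under (σ : Ty) (d : Depth) : Depth := fun τ => if τ = σ then d τ + 1 else d τ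

def all (σ : Ty) (φ : TmX σ → FmlX) : FmlX := fun d =>
  Fml.all σ (φ (boundVar σ d) (under σ d))

def ex (σ : Ty) (φ : TmX σ → FmlX) : FmlX := fun d =>
  Fml.ex σ (φ (boundVar σ d) (under σ d))

/-- The closed formula given by an expression. -/
def FmlX.close (φ : FmlX) : Fml := φ fun _ => 0

def conX {σ : Ty} (c : Con σ) : TmX σ := fun _ => Tm.con c
def appX {σ τ : Ty} (f : TmX (σ ⇒ τ)) (x : TmX σ) : TmX τ := fun d => Tm.app (f d) (x d)
def eqX (s t : TmX Ty.nat) : FmlX := fun d => Fml.eq (s d) (t d)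
def ltX (s t : TmX Ty.nat) : FmlX := fun d => Fml.lt (s d) (t d)
def impX (φ ψ : FmlX) : FmlX := fun d => Fml.imp (φ d) (ψ d)
def negX (φ : FmlX) : FmlX := fun d => Fml.neg (φ d)
def andX (φ ψ : FmlX) : FmlX := fun d => Fml.conj (φ d) (ψ d)
def orX (φ ψ : FmlX) : FmlX := fun d => Fml.disj (φ d) (ψ d)
def zeroX : TmX Ty.nat := conX Con.zero
def oneX : TmX Ty.nat := conX Con.one

infixl:90 " ⬝ " => appX

def addX (s t : TmX Ty.nat) : TmX Ty.nat := conX Con.add ⬝ s ⬝ t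
def mulX (s t : TmX Ty.nat) : TmX Ty.nat := conX Con.mul ⬝ s ⬝ t

infixl:75 " ×ₙ " => mulX
infixl:70 " +ₙ " => addX
infix:55 " =ₙ " => eqX
infix:55 " <ₙ " => ltX
infixr:45 " ⋏ " => andX
infixr:40 " ⋎ " => orX
infixr:35 " ⇛ " => impX

def iffX (φ ψ : FmlX) : FmlX := (φ ⇛ ψ) ⋏ (ψ ⇛ φ)

infix:30 " ⇔ₓ " => iffX

/-- Equality at all finite types, defined extensionally from equality at type `0`. -/
def eqAt : (τ : Ty) → TmX τ → TmX τ → FmlX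
  | .nat, x, y => x =ₙ y
  | .arr σ τ, x, y => all σ fun z => eqAt τ (x ⬝ z) (y ⬝ z)

/-! ### The theories `RCA₀^ω` and `ACA₀^ω` -/

/-- `0, 1, <, +, ×` form a (discretely) ordered semi-ring. -/
inductive SemiringAxiom : FmlX → Prop
  | add_assoc : SemiringAxiom (all .nat fun x => all .nat fun y => all .nat fun z =>
      (x +ₙ y) +ₙ z =ₙ x +ₙ (y +ₙ z))
  | add_comm : SemiringAxiom (all .nat fun x => all .nat fun y => x +ₙ y =ₙ y +ₙ x)
  | add_zero : SemiringAxiom (all .nat fun x => x +ₙ zeroX =ₙ x)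
  | mul_assoc : SemiringAxiom (all .nat fun x => all .nat fun y => all .nat fun z =>
      (x ×ₙ y) ×ₙ z =ₙ x ×ₙ (y ×ₙ z))
  | mul_comm : SemiringAxiom (all .nat fun x => all .nat fun y => x ×ₙ y =ₙ y ×ₙ x)
  | mul_one : SemiringAxiom (all .nat fun x => x ×ₙ oneX =ₙ x)
  | mul_zero : SemiringAxiom (all .nat fun x => x ×ₙ zeroX =ₙ zeroX)
  | mul_add : SemiringAxiom (all .nat fun x => all .nat fun y => all .nat fun z =>
      x ×ₙ (y +ₙ z) =ₙ (x ×ₙ y) +ₙ (x ×ₙ z))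
  | lt_irrefl : SemiringAxiom (all .nat fun x => negX (x <ₙ x))
  | lt_trans : SemiringAxiom (all .nat fun x => all .nat fun y => all .nat fun z =>
      x <ₙ y ⇛ y <ₙ z ⇛ x <ₙ z)
  | lt_total : SemiringAxiom (all .nat fun x => all .nat fun y =>
      x <ₙ y ⋎ x =ₙ y ⋎ y <ₙ x)
  | add_lt : SemiringAxiom (all .nat fun x => all .nat fun y => all .nat fun z =>
      x <ₙ y ⇛ x +ₙ z <ₙ y +ₙ z)
  | mul_lt : SemiringAxiom (all .nat fun x => all .nat fun y => all .nat fun z =>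
      zeroX <ₙ z ⇛ x <ₙ y ⇛ x ×ₙ z <ₙ y ×ₙ z)
  | zero_lt_one : SemiringAxiom (zeroX <ₙ oneX)
  | not_lt_zero : SemiringAxiom (all .nat fun x => negX (x <ₙ zeroX))
  | lt_succ : SemiringAxiom (all .nat fun x => all .nat fun y =>
      x <ₙ y +ₙ oneX ⇔ₓ (x <ₙ y ⋎ x =ₙ y))

/-- `Π x y = x`. -/
def axiomK (σ τ : Ty) : FmlX :=
  all σ fun x => all τ fun y => eqAt σ (conX (.K σ τ) ⬝ x ⬝ y) x

/-- `Σ x y z = x z (y z)`. -/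
def axiomS (ρ σ τ : Ty) : FmlX :=
  all (ρ ⇒ σ ⇒ τ) fun x => all (ρ ⇒ σ) fun y => all ρ fun z =>
    eqAt τ (conX (.S ρ σ τ) ⬝ x ⬝ y ⬝ z) (x ⬝ z ⬝ (y ⬝ z))

/-- The recursor at type `0`: `R₀(f, m, 0) = m` and `R₀(f, m, n+1) = f(n, R₀(f, m, n))`. -/
def axiomR0 : FmlX :=
  all (.nat ⇒ .nat ⇒ .nat) fun f => all .nat fun m =>
    conX (.R .nat) ⬝ f ⬝ m ⬝ zeroX =ₙ m ⋏
    all .nat fun n =>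
      conX (.R .nat) ⬝ f ⬝ m ⬝ (n +ₙ oneX) =ₙ f ⬝ n ⬝ (conX (.R .nat) ⬝ f ⬝ m ⬝ n)

/-- The axiom of extensionality `E_{ρ,τ}`. -/
def axiomE (ρ τ : Ty) : FmlX :=
  all ρ fun x => all ρ fun y => all (ρ ⇒ τ) fun φ =>
    eqAt ρ x y ⇛ eqAt τ (φ ⬝ x) (φ ⬝ y)

/-- `n ↦ n + 1` for the innermost variable of type `0`. -/
def Sub.succ : Sub := fun τ n =>
  match τ, n with
  | .nat, 0 => .app (.app (.con .add) (.var .nat 0)) (.con .one)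
  | τ, n => .var τ n

/-- Induction for `A(n)`, where `n` is `var 0 0`:
`A(0) → ∀ n (A(n) → A(n+1)) → ∀ n A(n)`. -/
def axiomInd (A : Fml) : Fml :=
  .imp (A.inst (Tm.con Con.zero))
    (.imp (.all .nat (.imp A (A.subst Sub.succ))) (.all .nat A))

/-- Replace `y` (`var 0 0`) by `Y(x)`, where `x` is `var 1 0` before and after, and `Y` is the
new variable `var 2 0`; the parameters are renumbered accordingly. -/
def Sub.choose : Sub := fun τ n =>
  match τ, n with
  | .nat, 0 => .app (.var Ty.two 0) (.var Ty.one 0)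
  | .nat, n + 1 => .var .nat n
  | τ, n => .var τ (if τ = Ty.two then n + 1 else n)

/-- `QF-AC^{1,0}` for `A(x, y)`, where `x` is `var 1 0` and `y` is `var 0 0`:
`∀ x¹ ∃ y⁰ A(x, y) → ∃ Y² ∀ x¹ A(x, Y(x))`. -/
def axiomAC (A : Fml) : Fml :=
  .imp (.all Ty.one (.ex .nat A)) (.ex Ty.two (.all Ty.one (A.subst Sub.choose)))

/-- Kohlenbach's base theory `RCA₀^ω`. -/
inductive RCA0omega : Fml → Prop
  | semiring {φ : FmlX} : SemiringAxiom φ → RCA0omega φ.close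
  | K (σ τ : Ty) : RCA0omega (axiomK σ τ).close
  | S (ρ σ τ : Ty) : RCA0omega (axiomS ρ σ τ).close
  | R0 : RCA0omega axiomR0.close
  | E (ρ τ : Ty) : RCA0omega (axiomE ρ τ).close
  | ind {A : Fml} : A.QF → RCA0omega (axiomInd A)
  | ac {A : Fml} : A.QF → RCA0omega (axiomAC A)

/-- `(∃²)`: `(∃ φ² ≤ 1)(∀ f¹)[(∃ n⁰)(f(n) = 0) ↔ φ(f) = 0]`. -/
def existsTwo : FmlX :=
  ex Ty.two fun φ =>
    (all Ty.one fun f => φ ⬝ f <ₙ oneX ⋎ φ ⬝ f =ₙ oneX) ⋏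
    all Ty.one fun f => (ex .nat fun n => f ⬝ n =ₙ zeroX) ⇔ₓ φ ⬝ f =ₙ zeroX

/-- `ACA₀^ω = RCA₀^ω + (∃²)`. -/
def ACA0omega : Set Fml := {φ | RCA0omega φ ∨ φ = existsTwo.close}

/-! ### Rational numbers -/

/-- The term `2ⁿ`, i.e. `R₀(λ i y. y + y, 1, n)`. -/
def twoPow (n : TmX Ty.nat) : TmX Ty.nat :=
  let I : TmX (.nat ⇒ .nat) :=
    conX (.S .nat (.nat ⇒ .nat) .nat) ⬝ conX (.K .nat (.nat ⇒ .nat)) ⬝ conX (.K .nat .nat)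
  let double : TmX (.nat ⇒ .nat) := conX (.S .nat .nat .nat) ⬝ conX .add ⬝ I
  conX (.R .nat) ⬝ (conX (.K (.nat ⇒ .nat) .nat) ⬝ double) ⬝ oneX ⬝ n

/-- A fraction `(pos - neg) / den`, with natural numbers `pos`, `neg` and `den > 0` given by
terms. -/
structure Frac where
  pos : TmX Ty.nat
  neg : TmX Ty.nat
  den : TmX Ty.nat

namespace Frac

def ofNat (m : TmX Ty.nat) : Frac := ⟨m, zeroX, oneX⟩
/-- `m / 2ⁿ` -/
def dyadic (m n : TmX Ty.nat) : Frac := ⟨m, zeroX, twoPow n⟩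
def add (a b : Frac) : Frac :=
  ⟨a.pos ×ₙ b.den +ₙ b.pos ×ₙ a.den, a.neg ×ₙ b.den +ₙ b.neg ×ₙ a.den, a.den ×ₙ b.den⟩
def opp (a : Frac) : Frac := ⟨a.neg, a.pos, a.den⟩
def lt (a b : Frac) : FmlX :=
  a.pos ×ₙ b.den +ₙ b.neg ×ₙ a.den <ₙ b.pos ×ₙ a.den +ₙ a.neg ×ₙ b.den

end Frac

/-- `c` is the Cantor code `(a + b)(a + b + 1)/2 + b` of the pair `(a, b)`. -/
def isPair (c a b : TmX Ty.nat) : FmlX :=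
  c +ₙ c =ₙ (a +ₙ b) ×ₙ (a +ₙ b +ₙ oneX) +ₙ (b +ₙ b)

/-- Rational numbers are coded by natural numbers: the code of `((p, m), d)` stands for the
fraction `(p - m)/(d + 1)`.  `decode c φ` says that `φ` holds of the rational coded by `c`. -/
def decode (c : TmX Ty.nat) (φ : Frac → FmlX) : FmlX :=
  ex .nat fun p => ex .nat fun m => ex .nat fun d =>
    (ex .nat fun a => isPair c a d ⋏ isPair a p m) ⋏ φ ⟨p, m, d +ₙ oneX⟩

/-! ### Real numbers -/

/-- A real number presented by its approximations: `x n φ` says that `φ` holds of the `n`-th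
rational approximation of `x`. -/
abbrev RealX : Type := TmX Ty.nat → (Frac → FmlX) → FmlX

namespace RealX

/-- The real given by a sequence of (codes of) rationals. -/
def ofSeq (x : TmX Ty.one) : RealX := fun n φ => decode (x ⬝ n) φ
/-- A rational number as a real. -/
def ofFrac (q : Frac) : RealX := fun _ φ => φ q
def zero : RealX := ofFrac (.ofNat zeroX)
def one : RealX := ofFrac (.ofNat oneX)
/-- `2⁻ⁿ` -/
def twoInv (n : TmX Ty.nat) : RealX := ofFrac (.dyadic oneX n)
/-- `[x + y](n) = [x](n+1) + [y](n+1)` -/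
def add (x y : RealX) : RealX := fun n φ =>
  x (n +ₙ oneX) fun a => y (n +ₙ oneX) fun b => φ (a.add b)
def sub (x y : RealX) : RealX := fun n φ =>
  x (n +ₙ oneX) fun a => y (n +ₙ oneX) fun b => φ (a.add b.opp)
/-- `x < y` iff `[x](n) + 2⁻ⁿ⁺¹ < [y](n)` for some `n`. -/
def lt (x y : RealX) : FmlX := ex .nat fun n =>
  x n fun a => y n fun b => (a.add (.dyadic (oneX +ₙ oneX) n)).lt b
def le (x y : RealX) : FmlX := negX (lt y x)
/-- `x = y` iff `|[x](n) - [y](n)| ≤ 2⁻ⁿ⁺¹` for all `n`. -/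
def eq (x y : RealX) : FmlX := all .nat fun n =>
  x n fun a => y n fun b =>
    negX ((a.add (.dyadic (oneX +ₙ oneX) n)).lt b) ⋏
    negX ((b.add (.dyadic (oneX +ₙ oneX) n)).lt a)
/-- `|x - y| < r` -/
def distLt (x y r : RealX) : FmlX := lt (sub x y) r ⋏ lt (sub y x) r

end RealX

/-- The sequence `x` represents a real: `|[x](n) - [x](n+i)| < 2⁻ⁿ` for all `n`, `i`. -/
def isReal (x : TmX Ty.one) : FmlX := all .nat fun n => all .nat fun i =>
  decode (x ⬝ n) fun a => decode (x ⬝ (n +ₙ i)) fun b =>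
    (a.add b.opp).lt (.dyadic oneX n) ⋏ (b.add a.opp).lt (.dyadic oneX n)

open RealX in
/-- `x ∈ [0,1]` -/
def inUnit (x : TmX Ty.one) : FmlX :=
  isReal x ⋏ le zero (ofSeq x) ⋏ le (ofSeq x) one

/-- Quantifiers over the points of `[0,1]`. -/
def allUnit (φ : TmX Ty.one → FmlX) : FmlX := all Ty.one fun x => inUnit x ⇛ φ x
def exUnit (φ : TmX Ty.one → FmlX) : FmlX := ex Ty.one fun x => inUnit x ⋏ φ x

/-- Quantifiers over the real numbers `> 0`. -/
def allPos (φ : TmX Ty.one → FmlX) : FmlX := all Ty.one fun e =>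
  isReal e ⇛ RealX.lt .zero (.ofSeq e) ⇛ φ e
def exPos (φ : TmX Ty.one → FmlX) : FmlX := ex Ty.one fun e =>
  isReal e ⋏ RealX.lt .zero (.ofSeq e) ⋏ φ e

/-- `|x - y| < 2⁻ᵏ`, i.e. `y ∈ B(x, 2⁻ᵏ)` -/
def inBall (x : TmX Ty.one) (k : TmX Ty.nat) (y : TmX Ty.one) : FmlX :=
  RealX.distLt (.ofSeq x) (.ofSeq y) (.twoInv k)

/-! ### Sets of reals -/

/-- The type of characteristic functions of sets of reals. -/
abbrev Ty.set : Ty := Ty.one ⇒ Ty.nat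

/-- `x ∈ A` -/
def mem (x : TmX Ty.one) (A : TmX Ty.set) : FmlX := A ⬝ x =ₙ oneX

/-- `A` is (the characteristic function `ℝ → {0,1}` of) a subset of `[0,1]`. -/
def isSubset (A : TmX Ty.set) : FmlX :=
  (all Ty.one fun x => isReal x ⇛ A ⬝ x =ₙ zeroX ⋎ A ⬝ x =ₙ oneX) ⋏
  (all Ty.one fun x => all Ty.one fun y => isReal x ⇛ isReal y ⇛
    RealX.eq (.ofSeq x) (.ofSeq y) ⇛ A ⬝ x =ₙ A ⬝ y) ⋏
  (all Ty.one fun x => isReal x ⇛ mem x A ⇛ inUnit x)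

/-- `A` is an open subset of the space `[0,1]`. -/
def isOpen (A : TmX Ty.set) : FmlX :=
  isSubset A ⋏
  allUnit fun x => mem x A ⇛ ex .nat fun k => allUnit fun y => inBall x k y ⇛ mem y A

/-- `A` is dense in `[0,1]`. -/
def isDense (A : TmX Ty.set) : FmlX :=
  all .nat fun k => allUnit fun b => exUnit fun a => mem a A ⋏ inBall b k a

/-- The Baire category theorem for `[0,1]`: if `(Oₙ)` is a decreasing sequence of dense open
sets in `[0,1]`, then `⋂ₙ Oₙ` is non-empty. -/
def BCT : FmlX := all (.nat ⇒ Ty.set) fun O =>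
  (all .nat fun n => isOpen (O ⬝ n) ⋏ isDense (O ⬝ n)) ⇛
  (all .nat fun n => allUnit fun x => mem x (O ⬝ (n +ₙ oneX)) ⇛ mem x (O ⬝ n)) ⇛
  exUnit fun x => all .nat fun n => mem x (O ⬝ n)

/-! ### Functions on `[0,1]` -/

/-- The type of (representations of) functions from reals to reals. -/
abbrev Ty.fn : Ty := Ty.one ⇒ Ty.one

/-- The real `f(x)`. -/
def valX (f : TmX Ty.fn) (x : TmX Ty.one) : RealX := .ofSeq (f ⬝ x)

/-- `f` represents a function `[0,1] → ℝ`. -/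
def isFun (f : TmX Ty.fn) : FmlX :=
  (allUnit fun x => isReal (f ⬝ x)) ⋏
  allUnit fun x => allUnit fun y =>
    RealX.eq (.ofSeq x) (.ofSeq y) ⇛ RealX.eq (valX f x) (valX f y)

/-- `f` is continuous at `x ∈ [0,1]`. -/
def contAt (f : TmX Ty.fn) (x : TmX Ty.one) : FmlX :=
  allPos fun ε => exPos fun δ => allUnit fun y =>
    RealX.distLt (.ofSeq x) (.ofSeq y) (.ofSeq δ) ⇛
      RealX.distLt (valX f x) (valX f y) (.ofSeq ε)

def totallyDiscontinuous (f : TmX Ty.fn) : FmlX := allUnit fun x => negX (contAt f x)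

/-- For every `ε > 0` and every open neighbourhood `U` of `x₀` there is a non-empty open
`G ⊆ U` with `φ ε G`. -/
def nearOpen (x₀ : TmX Ty.one) (φ : TmX Ty.one → TmX Ty.set → FmlX) : FmlX :=
  allPos fun ε => all Ty.set fun U => isOpen U ⇛ mem x₀ U ⇛
    ex Ty.set fun G => isOpen G ⋏ (exUnit fun x => mem x G) ⋏
      (allUnit fun x => mem x G ⇛ mem x U) ⋏ φ ε G

/-- `f` is cliquish at `x₀`. -/
def cliquishAt (f : TmX Ty.fn) (x₀ : TmX Ty.one) : FmlX := nearOpen x₀ fun ε G =>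
  allUnit fun x => allUnit fun y => mem x G ⇛ mem y G ⇛
    RealX.distLt (valX f x) (valX f y) (.ofSeq ε)

/-- `f` is upper quasi-continuous at `x₀`. -/
def uqcoAt (f : TmX Ty.fn) (x₀ : TmX Ty.one) : FmlX := nearOpen x₀ fun ε G =>
  allUnit fun x => mem x G ⇛ RealX.lt (valX f x) (.add (valX f x₀) (.ofSeq ε))

/-- `f` is lower quasi-continuous at `x₀`. -/
def lqcoAt (f : TmX Ty.fn) (x₀ : TmX Ty.one) : FmlX := nearOpen x₀ fun ε G =>
  allUnit fun x => mem x G ⇛ RealX.lt (.sub (valX f x₀) (.ofSeq ε)) (valX f x)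

def cliquish (f : TmX Ty.fn) : FmlX := allUnit fun x => cliquishAt f x
def uqco (f : TmX Ty.fn) : FmlX := allUnit fun x => uqcoAt f x

/-- `sup f - inf f > c` on `B(x, 2⁻ᵏ) ∩ [0,1]`.  Neither the supremum nor the infimum is
required to exist as a real number. -/
def oscBallGt (f : TmX Ty.fn) (x : TmX Ty.one) (k : TmX Ty.nat) (c : RealX) : FmlX :=
  exUnit fun y => exUnit fun z => inBall x k y ⋏ inBall x k z ⋏
    RealX.lt c (.sub (valX f y) (valX f z))

/-- `g : [0,1] → ℝ` is the oscillation function of `f`: for all `x ∈ [0,1]`, `g(x)` is the limit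
for `k → ∞` of `sup f - inf f` on `B(x, 2⁻ᵏ)`. -/
def isOsc (f g : TmX Ty.fn) : FmlX :=
  isFun g ⋏ allUnit fun x => allPos fun ε => ex .nat fun K => all .nat fun k =>
    negX (k <ₙ K) ⇛
      oscBallGt f x k (.sub (valX g x) (.ofSeq ε)) ⋏
      negX (oscBallGt f x k (.add (valX g x) (.ofSeq ε)))

/-! ### The statements -/

/-- A cliquish function with an oscillation function has a point of continuity. -/
def cliquishCont : FmlX := all Ty.fn fun f =>
  isFun f ⇛ cliquish f ⇛ (ex Ty.fn fun g => isOsc f g) ⇛ exUnit fun x => contAt f x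

/-- A cliquish function with an oscillation function has a point of lower quasi-continuity. -/
def cliquishLqco : FmlX := all Ty.fn fun f =>
  isFun f ⇛ cliquish f ⇛ (ex Ty.fn fun g => isOsc f g) ⇛ exUnit fun x => lqcoAt f x

/-- A cliquish upper quasi-continuous function with an oscillation function has a point of
continuity. -/
def cliquishUqcoCont : FmlX := all Ty.fn fun f =>
  isFun f ⇛ cliquish f ⇛ uqco f ⇛ (ex Ty.fn fun g => isOsc f g) ⇛ exUnit fun x => contAt f x

/-- If `f` is totally discontinuous with oscillation function `g`, then there are `N` and
`c < d` in `[0,1]` with `g(x) ≥ 2⁻ᴺ` for `x ∈ (c, d)`. -/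
def totDiscOsc : FmlX := all Ty.fn fun f => all Ty.fn fun g =>
  isFun f ⇛ totallyDiscontinuous f ⇛ isOsc f g ⇛
    ex .nat fun N => exUnit fun c => exUnit fun d => RealX.lt (.ofSeq c) (.ofSeq d) ⋏
      allUnit fun x => RealX.lt (.ofSeq c) (.ofSeq x) ⇛ RealX.lt (.ofSeq x) (.ofSeq d) ⇛
        RealX.le (.twoInv N) (valX g x)

end HOA

/-! Provability is obtained from truth in models. By Henkin completeness (`completeness`), a formula
true in every structure satisfying the closed theorems of `ACA₀^ω` is derivable from these theorems,
hence from the axioms. The extensionality axioms make extensional equality a congruence, so a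
structure may be divided by it, and only extensional models in which equality of numbers is genuine
need be considered (`proves_of_isModel`). The relations `DenT` and `Den` then read each formula,
inside such a model `M`, as an ordinary statement about `M`, and each of the five formulas turns out
to be equivalent to `BaireU M`.

The numbers of `M` may be nonstandard, so its reals do not live in `ℝ`. They receive values in an
ordered field `M.Re`, built from an ultrapower of the fraction field of the numbers of `M` by
dividing the finite elements by the infinitesimals. This field is external and serves only for
calculation: every set, function and induction used must still be available in `M`. Combinatory
completeness (`Poly.lam`), quantifier-free choice and `(∃²)` provide them for all arithmetical
predicates with parameters (`DefP`), and `DefQ` brings comparisons of rationals into this class.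

The analysis is as follows. Let `g` be the oscillation function of `f`, and let `O n` be the set of
points where `g < 2⁻ⁿ`. It is open because oscillation is upper semicontinuous, and it is dense if
`f` is cliquish, or if `g` is not bounded below by any `2⁻ᴺ` on any interval. A point in all the `O
n`, supplied by Baire, is a point of continuity, hence of lower quasi-continuity.

Conversely, let `O n` be decreasing dense open sets with empty intersection, and put `f(x) = 2⁻ⁿ`
for the least `n` with `x ∉ O n`. This `f` is positive, upper semicontinuous, and small on dense
open sets. So it is cliquish and upper quasi-continuous, it is its own oscillation function, it is
nowhere lower quasi-continuous, and its oscillation has no positive lower bound `2⁻ᴺ` on any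
interval (`exists_pathological`). It refutes all four other statements at once. -/

namespace HOA

/-! ### Substitution -/

/-- Put `x` in front of the entries of sort `σ` of a sorted family of sequences. -/
def push {D : Ty → Type} {σ : Ty} (x : D σ) (s : (τ : Ty) → ℕ → D τ) : (τ : Ty) → ℕ → D τ :=
  fun τ n => if h : τ = σ then
    match n with
    | 0 => h.symm ▸ x
    | m + 1 => s τ m
  else s τ n

section push
variable {D : Ty → Type} {σ τ : Ty} (x : D σ) (s : (τ : Ty) → ℕ → D τ)

@[simp] theorem push_zero : push x s σ 0 = x := by simp [push]
@[simp] theorem push_succ (n : ℕ) : push x s σ (n + 1) = s σ n := by simp [push]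
theorem push_ne (h : τ ≠ σ) (n : ℕ) : push x s τ n = s τ n := by simp [push, h]

end push

def Sub.comp (s t : Sub) : Sub := fun τ n => (s τ n).subst t

theorem Tm.subst_subst (s t : Sub) : ∀ {σ : Ty} (u : Tm σ),
    (u.subst s).subst t = u.subst (s.comp t)
  | _, .var _ _ => rfl
  | _, .con _ => rfl
  | _, .app f x => by simp [Tm.subst, Tm.subst_subst s t f, Tm.subst_subst s t x]

theorem Tm.subst_var : ∀ {σ : Ty} (u : Tm σ), u.subst Tm.var = u
  | _, .var _ _ => rfl
  | _, .con _ => rfl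
  | _, .app f x => by simp [Tm.subst, Tm.subst_var f, Tm.subst_var x]

theorem Sub.shift_self (σ : Ty) (n : ℕ) : Sub.shift σ σ n = Tm.var σ (n + 1) := by
  simp [Sub.shift]

theorem Sub.shift_ne {σ τ : Ty} (h : τ ≠ σ) (n : ℕ) : Sub.shift σ τ n = Tm.var τ n := by
  simp [Sub.shift, h]

theorem Sub.lift_eq (σ : Ty) (s : Sub) :
    Sub.lift σ s = push (Tm.var σ 0) (s.comp (Sub.shift σ)) := by
  funext τ n
  by_cases h : τ = σ
  · subst h
    cases n <;> simp [Sub.lift, Sub.comp]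
  · simp [Sub.lift, push_ne, h, Sub.comp]

theorem Sub.single_eq {σ : Ty} (t : Tm σ) : Sub.single t = push t Tm.var := by
  funext τ n
  by_cases h : τ = σ
  · subst h
    cases n <;> simp [Sub.single]
  · simp [Sub.single, push_ne, h]

theorem Sub.push_comp {σ : Ty} (t : Tm σ) (s u : Sub) :
    Sub.comp (push t s) u = push (t.subst u) (s.comp u) := by
  funext τ n
  by_cases h : τ = σ
  · subst h
    cases n <;> simp [Sub.comp]
  · simp [push_ne, h, Sub.comp]

theorem Sub.shift_comp_push {σ : Ty} (t : Tm σ) (s : Sub) :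
    Sub.comp (Sub.shift σ) (push t s) = s := by
  funext τ n
  by_cases h : τ = σ
  · subst h
    simp [Sub.comp, Sub.shift_self, Tm.subst]
  · simp [push_ne, h, Sub.comp, Sub.shift_ne, Tm.subst]

theorem Sub.comp_assoc (s t u : Sub) : (s.comp t).comp u = s.comp (t.comp u) := by
  funext τ n
  simp [Sub.comp, Tm.subst_subst]

theorem Sub.comp_var (s : Sub) : s.comp Tm.var = s := by
  funext τ n
  simp [Sub.comp, Tm.subst_var]

theorem Sub.lift_comp (σ : Ty) (s t : Sub) :
    (Sub.lift σ s).comp (Sub.lift σ t) = Sub.lift σ (s.comp t) := by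
  rw [Sub.lift_eq σ s, Sub.push_comp, Sub.comp_assoc, Sub.lift_eq σ t, Sub.shift_comp_push,
    Sub.lift_eq, Sub.comp_assoc]
  simp [Tm.subst]

theorem Sub.lift_comp_single {σ : Ty} (s : Sub) (t : Tm σ) :
    (Sub.lift σ s).comp (Sub.single t) = push t s := by
  rw [Sub.lift_eq, Sub.push_comp, Sub.comp_assoc, Sub.single_eq, Sub.shift_comp_push,
    Sub.comp_var]
  simp [Tm.subst]

theorem Fml.subst_subst (φ : Fml) : ∀ s t : Sub, (φ.subst s).subst t = φ.subst (s.comp t) := by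
  induction φ with
  | eq a b => intro s t; simp [Fml.subst, Tm.subst_subst]
  | lt a b => intro s t; simp [Fml.subst, Tm.subst_subst]
  | bot => intro s t; rfl
  | imp φ ψ h₁ h₂ => intro s t; simp [Fml.subst, h₁, h₂]
  | all σ φ h => intro s t; simp [Fml.subst, h, Sub.lift_comp]

theorem Sub.lift_var (σ : Ty) : Sub.lift σ Tm.var = Tm.var := by
  rw [Sub.lift_eq]
  funext τ n
  by_cases h : τ = σ
  · subst h
    cases n <;> simp [Sub.comp, Tm.subst, Sub.shift_self]
  · simp [push_ne, h, Sub.comp, Tm.subst, Sub.shift_ne]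

theorem Fml.subst_var (φ : Fml) : φ.subst Tm.var = φ := by
  induction φ with
  | eq a b => simp [Fml.subst, Tm.subst_var]
  | lt a b => simp [Fml.subst, Tm.subst_var]
  | bot => rfl
  | imp φ ψ h₁ h₂ => simp [Fml.subst, h₁, h₂]
  | all σ φ h => simp [Fml.subst, h, Sub.lift_var]

theorem Fml.inst_subst {σ : Ty} (φ : Fml) (t : Tm σ) (s : Sub) :
    (φ.inst t).subst s = (φ.subst (Sub.lift σ s)).inst (t.subst s) := by
  simp only [Fml.inst, Fml.subst_subst, Sub.lift_comp_single]
  rw [Sub.single_eq, Sub.push_comp]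
  congr 2

theorem Fml.subst_lift_inst {σ : Ty} (φ : Fml) (t : Tm σ) (s : Sub) :
    (φ.subst (Sub.lift σ s)).inst t = φ.subst (push t s) := by
  simp only [Fml.inst, Fml.subst_subst, Sub.lift_comp_single]

/-- All free variables of a formula have index below some bound. -/
theorem Fml.exists_bound (φ : Fml) : ∃ N : ℕ, ∀ s s' : Sub,
    (∀ τ n, n < N → s τ n = s' τ n) → φ.subst s = φ.subst s' := by
  have tm : ∀ {σ : Ty} (t : Tm σ), ∃ N : ℕ, ∀ s s' : Sub,
      (∀ τ n, n < N → s τ n = s' τ n) → t.subst s = t.subst s' := by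
    intro σ t
    induction t with
    | var σ n => exact ⟨n + 1, fun s s' h => h _ _ n.lt_succ_self⟩
    | con c => exact ⟨0, fun s s' _ => rfl⟩
    | app f x h₁ h₂ =>
      obtain ⟨N₁, h₁⟩ := h₁
      obtain ⟨N₂, h₂⟩ := h₂
      refine ⟨max N₁ N₂, fun s s' h => ?_⟩
      simp only [Tm.subst]
      rw [h₁ s s' fun τ n hn => h τ n (lt_max_of_lt_left hn),
        h₂ s s' fun τ n hn => h τ n (lt_max_of_lt_right hn)]
  induction φ with
  | eq a b | lt a b =>
    obtain ⟨N₁, h₁⟩ := tm a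
    obtain ⟨N₂, h₂⟩ := tm b
    refine ⟨max N₁ N₂, fun s s' h => ?_⟩
    simp only [Fml.subst]
    rw [h₁ s s' fun τ n hn => h τ n (lt_max_of_lt_left hn),
      h₂ s s' fun τ n hn => h τ n (lt_max_of_lt_right hn)]
  | bot => exact ⟨0, fun s s' _ => rfl⟩
  | imp φ ψ h₁ h₂ =>
    obtain ⟨N₁, h₁⟩ := h₁
    obtain ⟨N₂, h₂⟩ := h₂
    refine ⟨max N₁ N₂, fun s s' h => ?_⟩
    simp only [Fml.subst]
    rw [h₁ s s' fun τ n hn => h τ n (lt_max_of_lt_left hn),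
      h₂ s s' fun τ n hn => h τ n (lt_max_of_lt_right hn)]
  | all σ φ h =>
    obtain ⟨N, hN⟩ := h
    refine ⟨N, fun s s' h => ?_⟩
    simp only [Fml.subst]
    rw [hN]
    intro τ n hn
    by_cases hτ : τ = σ
    · subst hτ
      cases n with
      | zero => simp [Sub.lift]
      | succ m => simp [Sub.lift, h _ m (by omega)]
    · simp [Sub.lift, hτ, h _ n hn]

/-! ### Structural properties of derivations -/

namespace Deriv

variable {Ax : Set Fml} {Γ Δ : List Fml} {φ ψ : Fml}

theorem weaken (h : Deriv Ax Γ φ) : ∀ {Δ : List Fml}, Γ ⊆ Δ → Deriv Ax Δ φ := by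
  induction h with
  | axm h => exact fun _ => axm h
  | hyp h => exact fun hs => hyp (hs h)
  | impI _ ih => exact fun hs => impI (ih (List.cons_subset_cons _ hs))
  | impE _ _ ih₁ ih₂ => exact fun hs => impE (ih₁ hs) (ih₂ hs)
  | raa _ ih => exact fun hs => raa (ih (List.cons_subset_cons _ hs))
  | allI _ ih => exact fun hs => allI (ih (List.map_subset _ hs))
  | allE t _ ih => exact fun hs => allE t (ih hs)
  | eqRefl t => exact fun _ => eqRefl t
  | eqSubst φ _ _ ih₁ ih₂ => exact fun hs => eqSubst φ (ih₁ hs) (ih₂ hs)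

/-- Each axiom of `T` is replaced by its own derivation. That derivation has no hypotheses, so it
can be weakened into any context in which the axiom is used. -/
theorem of_axioms {T : Set Fml} (h : Deriv T Γ φ) (hT : ∀ ψ ∈ T, Deriv Ax [] ψ) :
    Deriv Ax Γ φ := by
  induction h with
  | axm h => exact (hT _ h).weaken (List.nil_subset _)
  | hyp h => exact hyp h
  | impI _ ih => exact impI ih
  | impE _ _ ih₁ ih₂ => exact impE ih₁ ih₂
  | raa _ ih => exact raa ih
  | allI _ ih => exact allI ih
  | allE t _ ih => exact allE t ih
  | eqRefl t => exact eqRefl t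
  | eqSubst φ _ _ ih₁ ih₂ => exact eqSubst φ ih₁ ih₂

/-- An axiom enters a derivation only literally, so it must be invariant under substitution. Under a
quantifier, lifting commutes with shifting. -/
theorem subst (hAx : ∀ ψ ∈ Ax, ∀ s, ψ.subst s = ψ) (h : Deriv Ax Γ φ) :
    ∀ s : Sub, Deriv Ax (Γ.map (Fml.subst s)) (φ.subst s) := by
  induction h with
  | axm h => exact fun s => by rw [hAx _ h s]; exact axm h
  | hyp h => exact fun s => hyp (List.mem_map_of_mem h)
  | impI _ ih => exact fun s => impI (ih s)
  | impE _ _ ih₁ ih₂ => exact fun s => impE (ih₁ s) (ih₂ s)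
  | raa _ ih => exact fun s => raa (ih s)
  | @allI Γ σ φ _ ih =>
    intro s
    refine allI ?_
    have := ih (Sub.lift σ s)
    rw [List.map_map] at this ⊢
    have e : Fml.subst (Sub.lift σ s) ∘ Fml.subst (Sub.shift σ) =
        Fml.subst (Sub.shift σ) ∘ Fml.subst s := by
      funext ψ
      simp only [Function.comp, Fml.subst_subst, Sub.lift_eq, Sub.shift_comp_push]
    rwa [e] at this
  | allE t _ ih => exact fun s => by rw [Fml.inst_subst]; exact allE _ (ih s)
  | eqRefl t => exact fun s => eqRefl _
  | eqSubst φ _ _ ih₁ ih₂ =>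
    intro s
    have h₂ := ih₂ s
    rw [Fml.inst_subst] at h₂ ⊢
    exact eqSubst _ (ih₁ s) h₂

theorem exfalso (h : Deriv Ax Γ .bot) : Deriv Ax Γ φ :=
  raa (h.weaken (List.subset_cons_self _ _))

/-- Generalisation over a fresh variable. -/
theorem allI_fresh (hAx : ∀ ψ ∈ Ax, ∀ s, ψ.subst s = ψ) (Γ : List Fml) (σ : Ty) (ψ : Fml) :
    ∃ k, Deriv Ax Γ (ψ.inst (Tm.var σ k)) → Deriv Ax Γ (.all σ ψ) := by
  have hΓ : ∃ N : ℕ, ∀ φ ∈ Γ, ∀ s s' : Sub,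
      (∀ τ n, n < N → s τ n = s' τ n) → φ.subst s = φ.subst s' := by
    induction Γ with
    | nil => exact ⟨0, by simp⟩
    | cons φ Γ ih =>
      obtain ⟨N₁, h₁⟩ := ih
      obtain ⟨N₂, h₂⟩ := φ.exists_bound
      refine ⟨max N₁ N₂, fun χ hχ s s' h => ?_⟩
      rcases List.mem_cons.1 hχ with rfl | hχ
      · exact h₂ s s' fun τ n hn => h τ n (lt_max_of_lt_right hn)
      · exact h₁ χ hχ s s' fun τ n hn => h τ n (lt_max_of_lt_left hn)
  obtain ⟨N₁, h₁⟩ := hΓ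
  obtain ⟨N₂, h₂⟩ := ψ.exists_bound
  set k := max N₁ N₂ with hk
  -- `g` turns the fresh variable `k` into the variable to be bound and shifts all others. On `Γ` it
  -- agrees with the shift, and it takes the instance `ψ(k)` back to `ψ`.
  let g : Sub := fun τ n => if τ = σ ∧ n = k then Tm.var τ 0 else Sub.shift σ τ n
  have hg : ∀ τ n, n ≠ k → g τ n = Sub.shift σ τ n := fun τ n hn => by simp [g, hn]
  refine ⟨k, fun h => allI ?_⟩
  have h := h.subst hAx g
  have e₁ : Γ.map (Fml.subst g) = Γ.map (Fml.subst (Sub.shift σ)) :=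
    List.map_congr_left fun φ hφ => h₁ φ hφ _ _ fun τ n hn => hg τ n (by omega)
  have e₂ : (ψ.inst (Tm.var σ k)).subst g = ψ := by
    rw [Fml.inst_subst, Fml.subst_lift_inst]
    conv_rhs => rw [← ψ.subst_var]
    refine h₂ _ _ fun τ n hn => ?_
    by_cases hτ : τ = σ
    · subst hτ
      cases n with
      | zero => simp [Tm.subst, g]
      | succ m => rw [push_succ, hg _ _ (by omega), Sub.shift_self]
    · rw [push_ne _ _ hτ, hg _ _ (by omega), Sub.shift_ne hτ]
  rwa [e₁, e₂] at h

end Deriv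

/-! ### There are countably many formulas -/

def Ty.code : Ty → ℕ
  | .nat => 0
  | .arr σ τ => Nat.pair σ.code τ.code + 1

theorem Ty.code_injective : ∀ {σ τ : Ty}, σ.code = τ.code → σ = τ
  | .nat, .nat, _ => rfl
  | .nat, .arr _ _, h => by simp [Ty.code] at h
  | .arr _ _, .nat, h => by simp [Ty.code] at h
  | .arr σ τ, .arr σ' τ', h => by
    simp only [Ty.code, Nat.add_right_cancel_iff, Nat.pair_eq_pair] at h
    rw [Ty.code_injective h.1, Ty.code_injective h.2]

def Con.code : {σ : Ty} → Con σ → ℕ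
  | _, .zero => Nat.pair 0 0
  | _, .one => Nat.pair 1 0
  | _, .add => Nat.pair 2 0
  | _, .mul => Nat.pair 3 0
  | _, .K σ τ => Nat.pair 4 (Nat.pair σ.code τ.code)
  | _, .S ρ σ τ => Nat.pair 5 (Nat.pair ρ.code (Nat.pair σ.code τ.code))
  | _, .R σ => Nat.pair 6 σ.code

theorem Ty.code_inj {σ τ : Ty} : σ.code = τ.code ↔ σ = τ :=
  ⟨Ty.code_injective, fun h => h ▸ rfl⟩

theorem Con.code_injective {σ τ : Ty} (c : Con σ) (d : Con τ) (h : c.code = d.code) :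
    (⟨σ, c⟩ : Sigma Con) = ⟨τ, d⟩ := by
  cases c <;> cases d <;>
    simp only [Con.code, Nat.pair_eq_pair, Ty.code_inj] at h
  case K.K => obtain ⟨-, rfl, rfl⟩ := h; rfl
  case S.S => obtain ⟨-, rfl, rfl, rfl⟩ := h; rfl
  case R.R => obtain ⟨-, rfl⟩ := h; rfl
  all_goals first | rfl | (exfalso; omega)

def Tm.code : {σ : Ty} → Tm σ → ℕ
  | _, .var σ n => Nat.pair 0 (Nat.pair σ.code n)
  | _, .con c => Nat.pair 1 c.code
  | _, .app f x => Nat.pair 2 (Nat.pair f.code x.code)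

/-- The argument type of an application is not stored in its code but recovered from the code of the
function. Hence terms of possibly different types have to be compared. -/
theorem Tm.code_injective {σ : Ty} (t : Tm σ) : ∀ {τ : Ty} (u : Tm τ), t.code = u.code →
    (⟨σ, t⟩ : Sigma Tm) = ⟨τ, u⟩ := by
  induction t with
  | var σ n =>
    intro τ u h
    cases u <;> simp only [Tm.code, Nat.pair_eq_pair] at h
    · obtain ⟨-, h, rfl⟩ := h
      rw [Ty.code_injective h]
    all_goals omega
  | con c =>
    intro τ u h
    cases u <;> simp only [Tm.code, Nat.pair_eq_pair] at h
    case con d =>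
      have := Con.code_injective c d h.2
      cases this
      rfl
    all_goals omega
  | app f x hf hx =>
    intro τ u h
    cases u <;> simp only [Tm.code, Nat.pair_eq_pair] at h
    case app y g =>
      have h₁ := hf g h.2.1
      have h₂ := hx y h.2.2
      cases h₁
      cases h₂
      rfl
    all_goals omega

def Fml.code : Fml → ℕ
  | .eq s t => Nat.pair 0 (Nat.pair s.code t.code)
  | .lt s t => Nat.pair 1 (Nat.pair s.code t.code)
  | .bot => Nat.pair 2 0
  | .imp φ ψ => Nat.pair 3 (Nat.pair φ.code ψ.code)
  | .all σ φ => Nat.pair 4 (Nat.pair σ.code φ.code)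

theorem Tm.eq_of_code_eq {σ : Ty} {t u : Tm σ} (h : t.code = u.code) : t = u :=
  eq_of_heq (Sigma.mk.inj_iff.1 (t.code_injective u h)).2

theorem Fml.code_injective (φ : Fml) : ∀ {ψ : Fml}, φ.code = ψ.code → φ = ψ := by
  induction φ with
  | eq s t =>
    intro ψ h
    cases ψ <;> simp only [Fml.code, Nat.pair_eq_pair] at h
    · rw [Tm.eq_of_code_eq h.2.1, Tm.eq_of_code_eq h.2.2]
    all_goals omega
  | lt s t =>
    intro ψ h
    cases ψ <;> simp only [Fml.code, Nat.pair_eq_pair] at h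
    case lt => rw [Tm.eq_of_code_eq h.2.1, Tm.eq_of_code_eq h.2.2]
    all_goals omega
  | bot =>
    intro ψ h
    cases ψ <;> simp only [Fml.code, Nat.pair_eq_pair] at h
    case bot => rfl
    all_goals omega
  | imp φ χ h₁ h₂ =>
    intro ψ h
    cases ψ <;> simp only [Fml.code, Nat.pair_eq_pair] at h
    case imp => rw [h₁ h.2.1, h₂ h.2.2]
    all_goals omega
  | all σ φ h₁ =>
    intro ψ h
    cases ψ <;> simp only [Fml.code, Nat.pair_eq_pair] at h
    case all => rw [h₁ h.2.2, Ty.code_injective h.2.1]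
    all_goals omega

instance : Countable Fml := ⟨Fml.code, fun φ _ h => φ.code_injective h⟩
instance : Nonempty Fml := ⟨.bot⟩

/-! ### Structures and satisfaction -/

/-- A structure for the language of all finite types, not necessarily extensional. -/
structure Struct where
  D : Ty → Type
  con : {σ : Ty} → Con σ → D σ
  app : {σ τ : Ty} → D (σ ⇒ τ) → D σ → D τ
  Eq : D Ty.nat → D Ty.nat → Prop
  Lt : D Ty.nat → D Ty.nat → Prop
  eq_equiv : Equivalence Eq
  lt_congr : ∀ {a b c d}, Eq a b → Eq c d → Lt a c → Lt b d

namespace Struct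

abbrev Env (M : Struct) : Type := (σ : Ty) → ℕ → M.D σ

def eval (M : Struct) (v : M.Env) : {σ : Ty} → Tm σ → M.D σ
  | _, .var σ n => v σ n
  | _, .con c => M.con c
  | _, .app f x => M.app (M.eval v f) (M.eval v x)

def Sat (M : Struct) : M.Env → Fml → Prop
  | v, .eq s t => M.Eq (M.eval v s) (M.eval v t)
  | v, .lt s t => M.Lt (M.eval v s) (M.eval v t)
  | _, .bot => False
  | v, .imp φ ψ => M.Sat v φ → M.Sat v ψ
  | v, .all σ φ => ∀ x : M.D σ, M.Sat (push x v) φ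

end Struct

/-! ### Henkin completeness -/

section completeness

variable {T : Set Fml}

/-- One stage of the Henkin construction: `φ` is added if that is consistent, together with a
counterexample if `φ` negates a universal formula. Contexts are finite, so an unused variable can
serve as witness and no new constants are needed. -/
theorem exists_henkin_step (hT : ∀ ψ ∈ T, ∀ s, ψ.subst s = ψ) (φ : Fml) (Γ : List Fml)
    (hΓ : ¬ Deriv T Γ .bot) :
    ∃ Γ' : List Fml, ¬ Deriv T Γ' .bot ∧ Γ ⊆ Γ' ∧ (φ ∈ Γ' ∨ Deriv T (φ :: Γ) .bot) ∧
      ∀ σ ψ, φ = (Fml.all σ ψ).neg → φ ∈ Γ' → ∃ k, (ψ.inst (Tm.var σ k)).neg ∈ Γ' := by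
  by_cases h : Deriv T (φ :: Γ) .bot
  · refine ⟨Γ, hΓ, fun _ h => h, Or.inr h, fun σ ψ hφ hm => (hΓ ?_).elim⟩
    exact h.weaken (List.cons_subset.2 ⟨hm, fun _ h => h⟩)
  by_cases h' : ∃ σ ψ, φ = (Fml.all σ ψ).neg
  · obtain ⟨σ, ψ, rfl⟩ := h'
    obtain ⟨k, hk⟩ := Deriv.allI_fresh hT ((Fml.all σ ψ).neg :: Γ) σ ψ
    refine ⟨(ψ.inst (Tm.var σ k)).neg :: (Fml.all σ ψ).neg :: Γ, fun hb => ?_,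
      fun _ h => List.mem_cons_of_mem _ (List.mem_cons_of_mem _ h), Or.inl (by simp), ?_⟩
    -- If the witness made the context inconsistent, `ψ(k)` would be derivable, and by freshness of
    -- `k` so would the universal formula that has just been negated.
    · exact h (.impE (.hyp List.mem_cons_self) (hk (.raa hb)))
    · rintro σ' ψ' he -
      cases he
      exact ⟨k, List.mem_cons_self⟩
  · exact ⟨φ :: Γ, h, List.subset_cons_self _ _, Or.inl List.mem_cons_self,
      fun σ ψ he => (h' ⟨σ, ψ, he⟩).elim⟩

/-- A maximal consistent set of formulas with witnesses. -/
structure IsHenkin (T : Set Fml) (W : Set Fml) : Prop where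
  closed : ∀ (Γ : List Fml) (φ : Fml), (∀ ψ ∈ Γ, ψ ∈ W) → Deriv T Γ φ → φ ∈ W
  bot : Fml.bot ∉ W
  total : ∀ φ, φ ∈ W ∨ φ.neg ∈ W
  witness : ∀ σ ψ, (Fml.all σ ψ).neg ∈ W → ∃ k, (ψ.inst (Tm.var σ k)).neg ∈ W

/-- There are countably many formulas, so all of them can be treated in turn. In the union of the
stages, a derivation uses finitely many hypotheses and therefore already takes place at a single
stage. -/
theorem exists_isHenkin (hT : ∀ ψ ∈ T, ∀ s, ψ.subst s = ψ) (Γ : List Fml)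
    (hΓ : ¬ Deriv T Γ .bot) : ∃ W, IsHenkin T W ∧ ∀ ψ ∈ Γ, ψ ∈ W := by
  choose step hcon hsub hmem hwit using exists_henkin_step hT
  obtain ⟨e, he⟩ := exists_surjective_nat Fml
  let G : ℕ → {Γ : List Fml // ¬ Deriv T Γ .bot} := fun n =>
    Nat.rec ⟨Γ, hΓ⟩ (fun n g => ⟨step (e n) g.1 g.2, hcon _ _ _⟩) n
  have hG : ∀ n, (G (n + 1)).1 = step (e n) (G n).1 (G n).2 := fun n => rfl
  have mono : ∀ {m n}, m ≤ n → (G m).1 ⊆ (G n).1 := by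
    intro m n h
    induction h with
    | refl => exact fun _ h => h
    | step _ ih => exact fun _ h => by rw [Nat.succ_eq_add_one, hG]; exact hsub _ _ _ (ih h)
  have fin : ∀ Δ : List Fml, (∀ ψ ∈ Δ, ∃ n, ψ ∈ (G n).1) → ∃ n, Δ ⊆ (G n).1 := by
    intro Δ h
    induction Δ with
    | nil => exact ⟨0, List.nil_subset _⟩
    | cons φ Δ ih =>
      obtain ⟨n, hn⟩ := ih fun ψ hψ => h ψ (List.mem_cons_of_mem _ hψ)
      obtain ⟨m, hm⟩ := h φ List.mem_cons_self
      exact ⟨max m n, List.cons_subset.2 ⟨mono (le_max_left _ _) hm,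
        fun _ h => mono (le_max_right _ _) (hn h)⟩⟩
  have closed : ∀ (Δ : List Fml) (φ : Fml), (∀ ψ ∈ Δ, ∃ n, ψ ∈ (G n).1) → Deriv T Δ φ →
      ∃ n, φ ∈ (G n).1 := by
    intro Δ φ hΔ hd
    obtain ⟨m, hm⟩ := fin Δ hΔ
    obtain ⟨n, rfl⟩ := he φ
    rcases hmem (e n) (G n).1 (G n).2 with h | h
    · exact ⟨n + 1, by rw [hG]; exact h⟩
    · refine ((G (max m n)).2 ?_).elim
      have h₁ : Deriv T (G (max m n)).1 (e n) :=
        hd.weaken fun _ h => mono (le_max_left _ _) (hm h)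
      have h₂ : Deriv T (G (max m n)).1 (e n).neg :=
        (Deriv.impI h).weaken (mono (le_max_right _ _))
      exact .impE h₂ h₁
  refine ⟨{ψ | ∃ n, ψ ∈ (G n).1}, ⟨closed, ?_, ?_, ?_⟩, fun ψ h => ⟨0, h⟩⟩
  · rintro ⟨n, hn⟩
    exact (G n).2 (.hyp hn)
  · intro φ
    obtain ⟨n, rfl⟩ := he φ
    rcases hmem (e n) (G n).1 (G n).2 with h | h
    · exact Or.inl ⟨n + 1, by rw [hG]; exact h⟩
    · exact Or.inr (closed (G n).1 _ (fun ψ h => ⟨n, h⟩) (.impI h))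
  · rintro σ ψ ⟨m, hm⟩
    obtain ⟨n, hn⟩ := he (Fml.all σ ψ).neg
    have : e n ∈ step (e n) (G n).1 (G n).2 := by
      rcases hmem (e n) (G n).1 (G n).2 with h | h
      · exact h
      · refine ((G (max m n)).2 ?_).elim
        rw [hn] at h
        exact .impE ((Deriv.impI h).weaken (mono (le_max_right _ _)))
          (.hyp (mono (le_max_left _ _) hm))
    obtain ⟨k, hk⟩ := hwit (e n) (G n).1 (G n).2 σ ψ hn this
    exact ⟨k, n + 1, by rw [hG]; exact hk⟩

namespace IsHenkin

variable {W : Set Fml} (hW : IsHenkin T W)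
include hW

theorem mp {φ ψ : Fml} (h : Fml.imp φ ψ ∈ W) (h' : φ ∈ W) : ψ ∈ W :=
  hW.closed [Fml.imp φ ψ, φ] ψ (by simp [h, h'])
    (.impE (.hyp (by simp)) (.hyp (by simp) : Deriv T _ φ))

theorem imp_iff {φ ψ : Fml} : Fml.imp φ ψ ∈ W ↔ (φ ∈ W → ψ ∈ W) := by
  refine ⟨hW.mp, fun h => ?_⟩
  rcases hW.total φ with h' | h'
  · exact hW.closed [ψ] _ (by simpa using h h') (.impI (.hyp (by simp)))
  · refine hW.closed [φ.neg] _ (by simpa using h') (.impI (Deriv.exfalso ?_))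
    exact .impE (.hyp (by simp) : Deriv T _ φ.neg) (.hyp (by simp))

theorem all_iff {σ : Ty} {ψ : Fml} : Fml.all σ ψ ∈ W ↔ ∀ t : Tm σ, ψ.inst t ∈ W := by
  refine ⟨fun h t => hW.closed [Fml.all σ ψ] _ (by simpa using h) (.allE t (.hyp (by simp))),
    fun h => ?_⟩
  rcases hW.total (Fml.all σ ψ) with h' | h'
  · exact h'
  · obtain ⟨k, hk⟩ := hW.witness σ ψ h'
    exact (hW.bot (hW.mp hk (h _))).elim

theorem eq_subst {s t : Tm Ty.nat} (φ : Fml) (h : Fml.eq s t ∈ W) (h' : φ.inst s ∈ W) :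
    φ.inst t ∈ W :=
  hW.closed [Fml.eq s t, φ.inst s] _ (by simp [h, h'])
    (.eqSubst φ (.hyp (by simp) : Deriv T _ (Fml.eq s t)) (.hyp (by simp)))

end IsHenkin

theorem Tm.shift_single {σ τ : Ty} (t : Tm σ) (u : Tm τ) :
    (u.subst (Sub.shift σ)).subst (Sub.single t) = u := by
  rw [Tm.subst_subst, Sub.single_eq, Sub.shift_comp_push, Tm.subst_var]

/-- The term model of a Henkin set. -/
def termModel {W : Set Fml} (hW : IsHenkin T W) : Struct where
  D := Tm
  con := Tm.con
  app := Tm.app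
  Eq s t := Fml.eq s t ∈ W
  Lt s t := Fml.lt s t ∈ W
  eq_equiv := by
    have symm : ∀ {s t : Tm Ty.nat}, Fml.eq s t ∈ W → Fml.eq t s ∈ W := by
      intro s t h
      have := hW.eq_subst (.eq (Tm.var _ 0) (s.subst (Sub.shift Ty.nat))) h
      simp only [Fml.inst, Fml.subst, Tm.subst, Sub.single_eq, push_zero] at this
      rw [← Sub.single_eq, ← Sub.single_eq, Tm.shift_single, Tm.shift_single] at this
      exact this (hW.closed [] _ (by simp) (.eqRefl s))
    refine ⟨fun s => hW.closed [] _ (by simp) (.eqRefl s), symm, fun {s t u} h h' => ?_⟩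
    have := hW.eq_subst (.eq (Tm.var _ 0) (u.subst (Sub.shift Ty.nat))) (symm h)
    simp only [Fml.inst, Fml.subst, Tm.subst, Sub.single_eq, push_zero] at this
    rw [← Sub.single_eq, ← Sub.single_eq, Tm.shift_single, Tm.shift_single] at this
    exact this h'
  lt_congr := by
    intro a b c d h h' hl
    have h₁ := hW.eq_subst (.lt (Tm.var _ 0) (c.subst (Sub.shift Ty.nat))) h
    have h₂ := hW.eq_subst (.lt (b.subst (Sub.shift Ty.nat)) (Tm.var _ 0)) h'
    simp only [Fml.inst, Fml.subst, Tm.subst, Sub.single_eq, push_zero] at h₁ h₂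
    rw [← Sub.single_eq, ← Sub.single_eq, Tm.shift_single, Tm.shift_single] at h₁ h₂
    exact h₂ (h₁ hl)

theorem termModel_eval {W : Set Fml} (hW : IsHenkin T W) (v : Sub) :
    ∀ {σ : Ty} (t : Tm σ), (termModel hW).eval v t = t.subst v
  | _, .var _ _ => rfl
  | _, .con _ => rfl
  | _, .app f x => by
    simp only [Struct.eval, Tm.subst, termModel_eval hW v f, termModel_eval hW v x]; rfl

/-- The truth lemma. An assignment in the term model is itself a substitution, which lets the
induction pass through quantifiers; there the witnesses in `W` are used. -/
theorem termModel_sat {W : Set Fml} (hW : IsHenkin T W) (φ : Fml) :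
    ∀ v : Sub, (termModel hW).Sat v φ ↔ φ.subst v ∈ W := by
  induction φ with
  | eq s t => intro v; simp only [Struct.Sat, termModel_eval]; rfl
  | lt s t => intro v; simp only [Struct.Sat, termModel_eval]; rfl
  | bot => intro v; simpa [Struct.Sat, Fml.subst] using hW.bot
  | imp φ ψ h₁ h₂ => intro v; simp only [Struct.Sat, h₁, h₂, Fml.subst, hW.imp_iff]
  | all σ φ h =>
    intro v
    simp only [Struct.Sat, Fml.subst, hW.all_iff, Fml.subst_lift_inst]
    exact forall_congr' fun t => h _

/-- Gödel–Henkin completeness of the calculus. -/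
theorem completeness (hT : ∀ ψ ∈ T, ∀ s, ψ.subst s = ψ) (φ : Fml)
    (h : ∀ M : Struct, (∀ ψ ∈ T, ∀ v, M.Sat v ψ) → ∀ v, M.Sat v φ) : Deriv T [] φ := by
  by_contra hd
  obtain ⟨W, hW, hφ⟩ := exists_isHenkin hT [φ.neg] fun hb => hd (.raa hb)
  have hs := h (termModel hW) (fun ψ hψ v => by
    have hm : ψ ∈ W := hW.closed [] _ (by simp) (.axm hψ)
    exact (termModel_sat hW ψ v).2 ((hT ψ hψ v).symm ▸ hm)) Tm.var
  rw [termModel_sat, Fml.subst_var] at hs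
  exact hW.bot (hW.mp (hφ φ.neg List.mem_cons_self) hs)

end completeness

/-! ### Closed formulas -/

def Tm.Bd (d : Depth) : {σ : Ty} → Tm σ → Prop
  | σ, .var _ n => n < d σ
  | _, .con _ => True
  | _, .app f x => f.Bd d ∧ x.Bd d

/-- All free variables of type `σ` have index below `d σ`. -/
def Fml.Bd : Depth → Fml → Prop
  | d, .eq s t => s.Bd d ∧ t.Bd d
  | d, .lt s t => s.Bd d ∧ t.Bd d
  | _, .bot => True
  | d, .imp φ ψ => φ.Bd d ∧ ψ.Bd d
  | d, .all σ φ => φ.Bd (under σ d)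

theorem Tm.subst_of_bd {d : Depth} {s : Sub} (hs : ∀ σ n, n < d σ → s σ n = Tm.var σ n) :
    ∀ {σ : Ty} (t : Tm σ), t.Bd d → t.subst s = t
  | _, .var _ _, h => hs _ _ h
  | _, .con _, _ => rfl
  | _, .app f x, h => by
    simp only [Tm.subst, Tm.subst_of_bd hs f h.1, Tm.subst_of_bd hs x h.2]

theorem Fml.subst_of_bd (φ : Fml) : ∀ {d : Depth} {s : Sub},
    (∀ σ n, n < d σ → s σ n = Tm.var σ n) → φ.Bd d → φ.subst s = φ := by
  induction φ with
  | eq a b | lt a b =>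
    intro d s hs h
    simp only [Fml.subst, Tm.subst_of_bd hs _ h.1, Tm.subst_of_bd hs _ h.2]
  | bot => intros; rfl
  | imp φ ψ h₁ h₂ => intro d s hs h; simp only [Fml.subst, h₁ hs h.1, h₂ hs h.2]
  | all σ φ ih =>
    intro d s hs h
    rw [Fml.subst, ih (d := under σ d) _ h]
    intro τ n hn
    by_cases hτ : τ = σ
    · subst hτ
      cases n with
      | zero => simp [Sub.lift]
      | succ m =>
        simp only [under, if_true] at hn
        simp [Sub.lift, hs τ m (by omega), Tm.subst, Sub.shift_self]
    · simp only [under, hτ, if_false] at hn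
      simp [Sub.lift, hτ, hs _ n hn, Tm.subst, Sub.shift_ne]

/-- From depth `d` on, the expression `t` has no other free variables than those bound there. -/
def TmX.Bd {σ : Ty} (d : Depth) (t : TmX σ) : Prop := ∀ e, d ≤ e → (t e).Bd e

def FmlX.Bd (d : Depth) (φ : FmlX) : Prop := ∀ e, d ≤ e → (φ e).Bd e

section closed
variable {d d' : Depth}

theorem TmX.Bd.mono {σ : Ty} {t : TmX σ} (h : TmX.Bd d t) (hd : d ≤ d') : TmX.Bd d' t :=
  fun e he => h e (hd.trans he)

theorem TmX.Bd.con {σ : Ty} (c : Con σ) : TmX.Bd d (conX c) := fun _ _ => trivial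

theorem TmX.Bd.app {σ τ : Ty} {f : TmX (σ ⇒ τ)} {x : TmX σ} (hf : TmX.Bd d f)
    (hx : TmX.Bd d x) : TmX.Bd d (f ⬝ x) := fun e he => ⟨hf e he, hx e he⟩

theorem FmlX.Bd.imp {φ ψ : FmlX} (h : FmlX.Bd d φ) (h' : FmlX.Bd d ψ) : FmlX.Bd d (φ ⇛ ψ) :=
  fun e he => ⟨h e he, h' e he⟩

theorem FmlX.Bd.all {σ : Ty} {φ : TmX σ → FmlX}
    (h : ∀ d' t, d ≤ d' → TmX.Bd d' t → FmlX.Bd d' (φ t)) : FmlX.Bd d (all σ φ) := by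
  intro e he
  refine h (under σ e) (boundVar σ e) (fun τ => (he τ).trans ?_) (fun e' he' => ?_) _ le_rfl
  · simp only [under]
    split <;> omega
  · have := he' σ
    simp only [under, if_true] at this
    show e' σ - e σ - 1 < e' σ
    omega

theorem FmlX.Bd.eqAt {τ : Ty} : ∀ {d : Depth} {s t : TmX τ}, TmX.Bd d s → TmX.Bd d t →
    FmlX.Bd d (eqAt τ s t) := by
  induction τ with
  | nat => exact fun hs ht e he => ⟨hs e he, ht e he⟩
  | arr σ τ _ ih =>
    exact fun hs ht => .all fun _ _ hd hx => ih ((hs.mono hd).app hx) ((ht.mono hd).app hx)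

theorem FmlX.Bd.subst_close {φ : FmlX} (h : FmlX.Bd (fun _ => 0) φ) (s : Sub) :
    φ.close.subst s = φ.close :=
  Fml.subst_of_bd _ (d := fun _ => 0) (by simp) (h _ le_rfl)

/-- For a single axiom closedness holds by computation. The schemes over all types contain `eqAt`,
which recurses on a type variable, so they need the inductive criterion `FmlX.Bd`. -/
theorem axiomK_bd (σ τ : Ty) : FmlX.Bd d (axiomK σ τ) :=
  .all fun _ _ _ h₁ => .all fun _ _ hd h₂ =>
    .eqAt (((TmX.Bd.con _).app (h₁.mono hd)).app h₂) (h₁.mono hd)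

theorem axiomS_bd (ρ σ τ : Ty) : FmlX.Bd d (axiomS ρ σ τ) :=
  .all fun _ _ _ hx => .all fun _ _ h₂ hy => .all fun _ _ h₃ hz =>
    have hx := (hx.mono h₂).mono h₃
    have hy := hy.mono h₃
    .eqAt ((((TmX.Bd.con _).app hx).app hy).app hz) ((hx.app hz).app (hy.app hz))

theorem axiomE_bd (ρ τ : Ty) : FmlX.Bd d (axiomE ρ τ) :=
  .all fun _ _ _ hx => .all fun _ _ h₂ hy => .all fun _ _ h₃ hf =>
    have hx := (hx.mono h₂).mono h₃
    have hy := hy.mono h₃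
    .imp (.eqAt hx hy) (.eqAt (hf.app hx) (hf.app hy))

end closed

/-! ### Denotations of expressions -/

/-- An environment together with the number of quantifiers in whose scope one is. -/
structure World (M : Struct) where
  d : Depth
  v : M.Env

namespace World
variable {M : Struct}

def push {σ : Ty} (w : World M) (x : M.D σ) : World M := ⟨under σ w.d, HOA.push x w.v⟩

/-- A larger world lies under further quantifiers. The newest variables have the lowest indices, so
older ones have moved up by the difference of the depths. -/
instance : Preorder (World M) where
  le w w' := (∀ σ, w.d σ ≤ w'.d σ) ∧ ∀ σ n, w'.v σ (n + (w'.d σ - w.d σ)) = w.v σ n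
  le_refl w := ⟨fun _ => le_rfl, fun σ n => by simp⟩
  le_trans a b c h h' := ⟨fun σ => (h.1 σ).trans (h'.1 σ), fun σ n => by
    rw [← h.2, ← h'.2]
    congr 1
    have := h.1 σ
    have := h'.1 σ
    omega⟩

theorem le_push {σ : Ty} (w : World M) (x : M.D σ) : w ≤ w.push x := by
  refine ⟨fun τ => ?_, fun τ n => ?_⟩
  · simp only [push, under]
    split <;> omega
  · by_cases h : τ = σ
    · subst h
      simp [push, under]
    · simp [push, under, h, push_ne]

def base (v : M.Env) : World M := ⟨fun _ => 0, v⟩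

end World

section den
variable {M : Struct} {w w' : World M}

/-- In the world `w` and its extensions, the expression `t` denotes `a`. -/
def DenT {σ : Ty} (w : World M) (t : TmX σ) (a : M.D σ) : Prop :=
  ∀ w', w ≤ w' → M.eval w'.v (t w'.d) = a

/-- In the world `w` and its extensions, the expression `φ` says that `P`. -/
def Den (w : World M) (φ : FmlX) (P : Prop) : Prop :=
  ∀ w', w ≤ w' → (M.Sat w'.v (φ w'.d) ↔ P)

theorem DenT.mono {σ : Ty} {t : TmX σ} {a : M.D σ} (h : DenT w t a) (hw : w ≤ w') :
    DenT w' t a := fun _ h' => h _ (hw.trans h')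

theorem Den.congr {φ : FmlX} {P Q : Prop} (h : Den w φ P) (hPQ : P ↔ Q) : Den w φ Q :=
  fun w' hw => (h w' hw).trans hPQ

theorem DenT.con {σ : Ty} (c : Con σ) : DenT w (conX c) (M.con c) :=
  fun _ _ => rfl

theorem DenT.app {σ τ : Ty} {f : TmX (σ ⇒ τ)} {x : TmX σ} {a : M.D (σ ⇒ τ)} {b : M.D σ}
    (hf : DenT w f a) (hx : DenT w x b) : DenT w (f ⬝ x) (M.app a b) := fun w' hw =>
  by simp only [appX, Struct.eval, hf w' hw, hx w' hw]

theorem Den.eq {s t : TmX Ty.nat} {a b : M.D Ty.nat} (hs : DenT w s a) (ht : DenT w t b) :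
    Den w (s =ₙ t) (M.Eq a b) := fun w' hw =>
  by simp only [eqX, Struct.Sat, hs w' hw, ht w' hw]

theorem Den.lt {s t : TmX Ty.nat} {a b : M.D Ty.nat} (hs : DenT w s a) (ht : DenT w t b) :
    Den w (s <ₙ t) (M.Lt a b) := fun w' hw =>
  by simp only [ltX, Struct.Sat, hs w' hw, ht w' hw]

variable {φ ψ : FmlX} {P Q : Prop}

/-- The conclusion needs a meaning only when the premise holds: a sequence, for example, has a value
only once it is known to represent a real. -/
theorem Den.imp_of (h : Den w φ P) (h' : P → Den w ψ Q) : Den w (φ ⇛ ψ) (P → Q) := fun w' hw =>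
  imp_congr_ctx (h w' hw) fun hP => h' hP w' hw

theorem Den.imp (h : Den w φ P) (h' : Den w ψ Q) : Den w (φ ⇛ ψ) (P → Q) :=
  h.imp_of fun _ => h'

theorem Den.neg (h : Den w φ P) : Den w (negX φ) (¬ P) := fun w' hw =>
  not_congr (h w' hw)

theorem Den.and_of (h : Den w φ P) (h' : P → Den w ψ Q) : Den w (φ ⋏ ψ) (P ∧ Q) :=
  (Den.neg (h.imp_of fun hP => (h' hP).neg)).congr (by tauto)

theorem Den.and (h : Den w φ P) (h' : Den w ψ Q) : Den w (φ ⋏ ψ) (P ∧ Q) :=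
  h.and_of fun _ => h'

theorem Den.or (h : Den w φ P) (h' : Den w ψ Q) : Den w (φ ⋎ ψ) (P ∨ Q) :=
  (h.neg.imp h').congr (by tauto)

theorem Den.iff (h : Den w φ P) (h' : Den w ψ Q) : Den w (φ ⇔ₓ ψ) (P ↔ Q) :=
  ((h.imp h').and (h'.imp h)).congr (by tauto)

theorem DenT.boundVar {σ : Ty} (w : World M) (x : M.D σ) :
    DenT (w.push x) (HOA.boundVar σ w.d) x := fun w' hw => by
  have h₁ := hw.1 σ
  have h₂ := hw.2 σ 0
  simp only [World.push, under, if_true, push_zero] at h₁ h₂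
  rw [← h₂]
  show w'.v σ (w'.d σ - w.d σ - 1) = _
  congr 1
  omega

theorem Den.all {σ : Ty} {φ : TmX σ → FmlX} {P : M.D σ → Prop}
    (h : ∀ x w' t, w ≤ w' → DenT w' t x → Den w' (φ t) (P x)) :
    Den w (all σ φ) (∀ x, P x) := by
  intro w' hw
  have key := fun x => h x (w'.push x) (HOA.boundVar σ w'.d) (hw.trans (w'.le_push x))
    (DenT.boundVar w' x) (w'.push x) le_rfl
  exact forall_congr' key

theorem Den.ex {σ : Ty} {φ : TmX σ → FmlX} {P : M.D σ → Prop}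
    (h : ∀ x w' t, w ≤ w' → DenT w' t x → Den w' (φ t) (P x)) :
    Den w (ex σ φ) (∃ x, P x) :=
  (Den.neg (Den.all (φ := fun t => negX (φ t)) fun x w' t hw ht => (h x w' t hw ht).neg)).congr
    (by push Not; rfl)

theorem Den.sat_close {v : M.Env} (h : Den (World.base v) φ P) : M.Sat v φ.close ↔ P :=
  h _ le_rfl

theorem DenT.zero : DenT w zeroX (M.con .zero) := DenT.con _
theorem DenT.one : DenT w oneX (M.con .one) := DenT.con _

namespace Struct

def add (M : Struct) (a b : M.D Ty.nat) : M.D Ty.nat := M.app (M.app (M.con .add) a) b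
def mul (M : Struct) (a b : M.D Ty.nat) : M.D Ty.nat := M.app (M.app (M.con .mul) a) b

/-- Extensional equality. -/
def Sim (M : Struct) : {τ : Ty} → M.D τ → M.D τ → Prop
  | .nat, a, b => M.Eq a b
  | .arr _ _, f, g => ∀ z, M.Sim (M.app f z) (M.app g z)

end Struct

theorem DenT.add {s t : TmX Ty.nat} {a b : M.D Ty.nat} (hs : DenT w s a) (ht : DenT w t b) :
    DenT w (s +ₙ t) (M.add a b) := ((DenT.con _).app hs).app ht

theorem DenT.mul {s t : TmX Ty.nat} {a b : M.D Ty.nat} (hs : DenT w s a) (ht : DenT w t b) :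
    DenT w (s ×ₙ t) (M.mul a b) := ((DenT.con _).app hs).app ht

theorem Den.eqAt {τ : Ty} : ∀ {w : World M} {s t : TmX τ} {a b : M.D τ}, DenT w s a →
    DenT w t b → Den w (eqAt τ s t) (M.Sim a b) := by
  induction τ with
  | nat => exact fun hs ht => Den.eq hs ht
  | arr σ τ _ ih =>
    exact fun hs ht => Den.all fun x w' t hw hx => ih ((hs.mono hw).app hx) ((ht.mono hw).app hx)

end den

/-! ### The axioms of `ACA₀^ω` as statements about a structure -/

section axioms
variable {M : Struct} {w : World M}

theorem den_K (σ τ : Ty) : Den w (axiomK σ τ)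
    (∀ x y, M.Sim (M.app (M.app (M.con (.K σ τ)) x) y) x) :=
  Den.all fun _ _ _ _ h₁ => Den.all fun _ _ _ hw h₂ =>
    Den.eqAt (((DenT.con _).app (h₁.mono hw)).app h₂) (h₁.mono hw)

theorem den_S (ρ σ τ : Ty) : Den w (axiomS ρ σ τ) (∀ x y z,
    M.Sim (M.app (M.app (M.app (M.con (.S ρ σ τ)) x) y) z) (M.app (M.app x z) (M.app y z))) := by
  refine Den.all fun x w₁ t₁ h₁ hx => Den.all fun y w₂ t₂ h₂ hy => Den.all fun z w₃ t₃ h₃ hz => ?_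
  have hx := (hx.mono h₂).mono h₃
  have hy := hy.mono h₃
  exact Den.eqAt ((((DenT.con _).app hx).app hy).app hz) ((hx.app hz).app (hy.app hz))

theorem den_E (ρ τ : Ty) : Den w (axiomE ρ τ)
    (∀ x y (f : M.D (ρ ⇒ τ)), M.Sim x y → M.Sim (M.app f x) (M.app f y)) := by
  refine Den.all fun x w₁ t₁ h₁ hx => Den.all fun y w₂ t₂ h₂ hy => Den.all fun f w₃ t₃ h₃ hf => ?_
  have hx := (hx.mono h₂).mono h₃
  have hy := hy.mono h₃
  exact (Den.eqAt hx hy).imp (Den.eqAt (hf.app hx) (hf.app hy))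

/-- `∀ f¹ [f(0) = 0 → ∀ n (f(n) = 0 → f(n + 1) = 0) → ∀ n f(n) = 0]` -/
def indSentence : Fml :=
  .all Ty.one (axiomInd (.eq (.app (.var Ty.one 0) (.var .nat 0)) (.con .zero)))

/-- `∀ F [∀ x¹ ∃ y⁰ F(x, y) = 0 → ∃ Y² ∀ x¹ F(x, Y(x)) = 0]` -/
def choiceSentence : Fml :=
  .all (Ty.one ⇒ Ty.one) (axiomAC
    (.eq (.app (.app (.var (Ty.one ⇒ Ty.one) 0) (.var Ty.one 0)) (.var .nat 0)) (.con .zero)))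

/-- A single instance with a function parameter suffices, because the predicates treated later have
characteristic functions that can be put in place of `f`. The same applies to choice. -/
theorem sat_indSentence (v : M.Env) : M.Sat v indSentence ↔ ∀ f : M.D Ty.one,
    M.Eq (M.app f (M.con .zero)) (M.con .zero) →
    (∀ n, M.Eq (M.app f n) (M.con .zero) → M.Eq (M.app f (M.add n (M.con .one))) (M.con .zero)) →
    ∀ n, M.Eq (M.app f n) (M.con .zero) := Iff.rfl

theorem sat_choiceSentence (v : M.Env) :
    M.Sat v choiceSentence ↔ ∀ F : M.D (Ty.one ⇒ Ty.one),
      (∀ x, ∃ y, M.Eq (M.app (M.app F x) y) (M.con .zero)) →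
      ∃ Y : M.D Ty.two, ∀ x, M.Eq (M.app (M.app F x) (M.app Y x)) (M.con .zero) := by
  have : M.Sat v choiceSentence ↔ ∀ F : M.D (Ty.one ⇒ Ty.one),
      (∀ x, ¬ ∀ y, ¬ M.Eq (M.app (M.app F x) y) (M.con .zero)) →
      ¬ ∀ Y : M.D Ty.two, ¬ ∀ x, M.Eq (M.app (M.app F x) (M.app Y x)) (M.con .zero) := Iff.rfl
  rw [this]
  push Not
  rfl

theorem subst_indSentence (s : Sub) : indSentence.subst s = indSentence := rfl
theorem subst_choiceSentence (s : Sub) : choiceSentence.subst s = choiceSentence := rfl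

end axioms

theorem SemiringAxiom.subst_close {φ : FmlX} (h : SemiringAxiom φ) (s : Sub) :
    φ.close.subst s = φ.close := by
  cases h <;> rfl

/-- The closed theorems of `ACA₀^ω`. -/
def closedTheorems : Set Fml := {ψ | (∀ s, ψ.subst s = ψ) ∧ Proves ACA0omega ψ}

theorem mem_closedTheorems {φ : FmlX} (hφ : RCA0omega φ.close) (h : FmlX.Bd (fun _ => 0) φ) :
    φ.close ∈ closedTheorems := ⟨h.subst_close, .axm (Or.inl hφ)⟩

theorem SemiringAxiom.mem_closedTheorems {φ : FmlX} (h : SemiringAxiom φ) :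
    φ.close ∈ closedTheorems := ⟨h.subst_close, .axm (Or.inl (.semiring h))⟩

theorem axiomR0_mem : axiomR0.close ∈ closedTheorems :=
  ⟨fun _ => rfl, .axm (Or.inl .R0)⟩

theorem existsTwo_mem : existsTwo.close ∈ closedTheorems :=
  ⟨fun _ => rfl, .axm (Or.inr rfl)⟩

theorem indSentence_mem : indSentence ∈ closedTheorems :=
  ⟨subst_indSentence, .allI (.axm (Or.inl (.ind (.eq _ _))))⟩

theorem choiceSentence_mem : choiceSentence ∈ closedTheorems :=
  ⟨subst_choiceSentence, .allI (.axm (Or.inl (.ac (.eq _ _))))⟩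

/-! ### Extensional models -/

/-- An extensional model of `ACA₀^ω` in which equality of numbers is equality. -/
class IsModel (M : Struct) : Prop where
  eq_iff : ∀ {a b}, M.Eq a b ↔ a = b
  ext : ∀ {σ τ : Ty} {f g : M.D (σ ⇒ τ)}, (∀ z, M.app f z = M.app g z) → f = g
  sat : ∀ ψ ∈ closedTheorems, ∀ v, M.Sat v ψ

namespace Struct
variable (M : Struct)

theorem sim_equiv : ∀ τ : Ty, Equivalence (M.Sim (τ := τ))
  | .nat => M.eq_equiv
  | .arr _ τ => ⟨fun _ _ => (sim_equiv τ).refl _, fun h z => (sim_equiv τ).symm (h z),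
      fun h h' z => (sim_equiv τ).trans (h z) (h' z)⟩

def simSetoid (τ : Ty) : Setoid (M.D τ) := ⟨M.Sim, M.sim_equiv τ⟩

variable {M} (hM : ∀ (ρ τ : Ty) x y (f : M.D (ρ ⇒ τ)), M.Sim x y → M.Sim (M.app f x) (M.app f y))

/-- The quotient of a structure by extensional equality. -/
def extQuotient : Struct where
  D τ := Quotient (M.simSetoid τ)
  con c := Quotient.mk _ (M.con c)
  app {σ τ} := Quotient.map₂ M.app fun _ g hf _ y hx => (M.sim_equiv τ).trans (hf _) (hM _ _ _ y g hx)
  Eq := _root_.Eq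
  Lt := Quotient.lift₂ M.Lt fun _ _ _ _ h h' => propext
    ⟨M.lt_congr h h', M.lt_congr (M.eq_equiv.symm h) (M.eq_equiv.symm h')⟩
  eq_equiv := eq_equivalence
  lt_congr := by rintro a b c d rfl rfl; exact id

def toQuotient {σ : Ty} (x : M.D σ) : (extQuotient hM).D σ := Quotient.mk (M.simSetoid σ) x

def quotientEnv (v : M.Env) : (extQuotient hM).Env := fun τ n => toQuotient hM (v τ n)

theorem toQuotient_surjective {σ : Ty} : Function.Surjective (toQuotient hM (σ := σ)) :=
  Quotient.exists_rep

theorem extQuotient_eval (v : M.Env) : ∀ {σ : Ty} (t : Tm σ),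
    (extQuotient hM).eval (quotientEnv hM v) t = toQuotient hM (M.eval v t)
  | _, .var _ _ => rfl
  | _, .con _ => rfl
  | _, .app f x => by
    rw [eval, extQuotient_eval v f, extQuotient_eval v x]
    rfl

theorem push_quotientEnv {σ : Ty} (x : M.D σ) (v : M.Env) :
    push (toQuotient hM x) (quotientEnv hM v) = quotientEnv hM (push x v) := by
  funext τ n
  by_cases h : τ = σ
  · subst h
    cases n <;> simp [quotientEnv]
  · simp [push_ne, h, quotientEnv]

/-- Atomic formulas respect the quotient, and every element of the quotient has a representative, so
quantifiers range over the same things. -/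
theorem extQuotient_sat (φ : Fml) : ∀ v : M.Env,
    (extQuotient hM).Sat (quotientEnv hM v) φ ↔ M.Sat v φ := by
  induction φ with
  | eq s t =>
    intro v
    simp only [Sat, extQuotient_eval]
    exact ⟨fun h => Quotient.exact h, fun h => Quotient.sound h⟩
  | lt s t => intro v; simp only [Sat, extQuotient_eval]; rfl
  | bot => intro v; rfl
  | imp φ ψ h₁ h₂ => intro v; simp only [Sat, h₁, h₂]
  | all σ φ ih =>
    intro v
    simp only [Sat, (toQuotient_surjective hM).forall, push_quotientEnv, ih]

end Struct

/-- What holds in all extensional models is provable. -/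
theorem proves_of_isModel (φ : Fml) (h : ∀ M : Struct, IsModel M → ∀ v, M.Sat v φ) :
    Proves ACA0omega φ := by
  refine (completeness (T := closedTheorems) (fun ψ h => h.1) φ fun M hM v => ?_).of_axioms
    fun ψ h => h.2
  have hE : ∀ (ρ τ : Ty) x y (f : M.D (ρ ⇒ τ)), M.Sim x y → M.Sim (M.app f x) (M.app f y) :=
    fun ρ τ => (den_E ρ τ).sat_close.1
      (hM _ (mem_closedTheorems (.E ρ τ) (axiomE_bd ρ τ)) v)
  refine (Struct.extQuotient_sat hE φ v).1 (h _ ⟨Iff.rfl, ?_, ?_⟩ _)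
  · intro σ τ f g
    refine Quotient.inductionOn₂ f g fun f g hfg => Quotient.sound fun z => ?_
    exact Quotient.exact (hfg (Quotient.mk _ z))
  · intro ψ hψ v
    -- Choosing representatives shows that every assignment in the quotient comes from one in `M`.
    have : v = Struct.quotientEnv hE fun τ n => (v τ n).out := by
      funext τ n
      exact (Quotient.out_eq _).symm
    rw [this, Struct.extQuotient_sat]
    exact hM ψ hψ _

namespace Struct

/-- An element of each type, so that environments exist. -/
def default (M : Struct) : (σ : Ty) → M.D σ
  | .nat => M.con .zero
  | .arr σ τ => M.app (M.con (.K τ σ)) (default M τ)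

def defaultEnv (M : Struct) : M.Env := fun σ _ => M.default σ

instance (M : Struct) (σ τ : Ty) : CoeFun (M.D (σ ⇒ τ)) fun _ => M.D σ → M.D τ := ⟨M.app⟩

end Struct

/-! ### The ordered semiring of numbers of a model -/

section arithmetic
variable {M : Struct} [hM : IsModel M]

theorem IsModel.sim_iff {τ : Ty} : ∀ {a b : M.D τ}, M.Sim a b ↔ a = b := by
  induction τ with
  | nat => exact hM.eq_iff
  | arr σ τ _ ih =>
    intro a b
    refine ⟨fun h => hM.ext fun z => ih.1 (h z), ?_⟩
    rintro rfl
    exact (M.sim_equiv _).refl _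

theorem IsModel.sat_semiring {φ : FmlX} (h : SemiringAxiom φ) : M.Sat M.defaultEnv φ.close :=
  hM.sat _ h.mem_closedTheorems _

namespace Numbers

open IsModel

theorem lt_succ' (x y : M.D .nat) : M.Lt x (M.add y (M.con .one)) ↔ M.Lt x y ∨ x = y := by
  -- The axiom with its defined connectives unfolded to implication and falsity; the same unfolding
  -- explains the similar formulas below.
  have h : ¬ ((M.Lt x (M.add y (M.con .one)) → ¬ M.Lt x y → M.Eq x y) →
      ¬ ((¬ M.Lt x y → M.Eq x y) → M.Lt x (M.add y (M.con .one)))) :=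
    sat_semiring .lt_succ x y
  rw [hM.eq_iff] at h
  tauto

theorem lt_total' (x y : M.D .nat) : M.Lt x y ∨ x = y ∨ M.Lt y x := by
  have h : ¬ M.Lt x y → ¬ M.Eq x y → M.Lt y x := sat_semiring .lt_total x y
  rw [hM.eq_iff] at h
  tauto

instance : Zero (M.D .nat) := ⟨M.con .zero⟩
instance : One (M.D .nat) := ⟨M.con .one⟩
instance : Add (M.D .nat) := ⟨M.add⟩
instance : Mul (M.D .nat) := ⟨M.mul⟩

instance : CommSemiring (M.D .nat) where
  nsmul := nsmulRec
  add_assoc x y z := hM.eq_iff.1 (sat_semiring .add_assoc x y z)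
  add_comm x y := hM.eq_iff.1 (sat_semiring .add_comm x y)
  add_zero x := hM.eq_iff.1 (sat_semiring .add_zero x)
  zero_add x := (hM.eq_iff.1 (sat_semiring .add_comm _ x)).trans
    (hM.eq_iff.1 (sat_semiring .add_zero x))
  mul_assoc x y z := hM.eq_iff.1 (sat_semiring .mul_assoc x y z)
  mul_comm x y := hM.eq_iff.1 (sat_semiring .mul_comm x y)
  mul_one x := hM.eq_iff.1 (sat_semiring .mul_one x)
  one_mul x := (hM.eq_iff.1 (sat_semiring .mul_comm _ x)).trans
    (hM.eq_iff.1 (sat_semiring .mul_one x))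
  mul_zero x := hM.eq_iff.1 (sat_semiring .mul_zero x)
  zero_mul x := (hM.eq_iff.1 (sat_semiring .mul_comm _ x)).trans
    (hM.eq_iff.1 (sat_semiring .mul_zero x))
  left_distrib x y z := hM.eq_iff.1 (sat_semiring .mul_add x y z)
  right_distrib x y z := by
    have := hM.eq_iff.1 (sat_semiring .mul_add z x y)
    exact (hM.eq_iff.1 (sat_semiring .mul_comm _ z)).trans (this.trans
      (congrArg₂ M.add (hM.eq_iff.1 (sat_semiring .mul_comm z x))
        (hM.eq_iff.1 (sat_semiring .mul_comm z y))))

noncomputable instance : LinearOrder (M.D .nat) where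
  lt := M.Lt
  le x y := M.Lt x y ∨ x = y
  le_refl x := Or.inr rfl
  le_trans x y z := by
    rintro (h | rfl) (h' | rfl)
    · exact Or.inl (sat_semiring .lt_trans x y z h h')
    · exact Or.inl h
    · exact Or.inl h'
    · exact Or.inr rfl
  lt_iff_le_not_ge x y := by
    constructor
    · rintro h
      refine ⟨Or.inl h, ?_⟩
      rintro (h' | rfl)
      · exact sat_semiring .lt_irrefl x (sat_semiring .lt_trans x y x h h')
      · exact sat_semiring .lt_irrefl _ h
    · rintro ⟨h | rfl, h'⟩
      · exact h
      · exact (h' (Or.inr rfl)).elim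
  le_antisymm x y := by
    rintro (h | rfl) (h' | h')
    · exact (sat_semiring .lt_irrefl x (sat_semiring .lt_trans x y x h h')).elim
    · exact h'.symm
    · rfl
    · rfl
  le_total x y := by
    rcases lt_total' x y with h | h | h
    · exact Or.inl (Or.inl h)
    · exact Or.inl (Or.inr h)
    · exact Or.inr (Or.inl h)
  toDecidableLE := Classical.decRel _

theorem add_lt' (x y z : M.D .nat) (h : x < y) : x + z < y + z := sat_semiring .add_lt x y z h

theorem mul_lt' (x y z : M.D .nat) (hz : 0 < z) (h : x < y) : x * z < y * z :=
  sat_semiring .mul_lt x y z hz h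

instance : IsStrictOrderedRing (M.D .nat) where
  add_le_add_left x y h z := by
    rcases h.lt_or_eq with h | rfl
    · exact (add_lt' x y z h).le
    · exact le_rfl
  le_of_add_le_add_left x y z h := by
    by_contra! h'
    have := add_lt' z y x h'
    rw [add_comm z, add_comm y] at this
    exact this.not_ge h
  zero_le_one := le_of_lt (sat_semiring .zero_lt_one)
  exists_pair_ne := ⟨0, 1, ne_of_lt (sat_semiring .zero_lt_one)⟩
  mul_lt_mul_of_pos_left z hz x y h := by
    have := mul_lt' x y z hz h
    rwa [mul_comm x, mul_comm y] at this
  mul_lt_mul_of_pos_right z hz x y h := mul_lt' x y z hz h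

theorem lt_add_one_iff (x y : M.D .nat) : x < y + 1 ↔ x ≤ y := lt_succ' x y

theorem zero_le (x : M.D .nat) : 0 ≤ x := not_lt.1 (sat_semiring .not_lt_zero x)

end Numbers

open Numbers

/-! ### Combinatory completeness -/

theorem app_K {σ τ : Ty} (x : M.D σ) (y : M.D τ) :
    M.app (M.app (M.con (.K σ τ)) x) y = x :=
  IsModel.sim_iff.1 ((den_K σ τ).sat_close.1 (hM.sat _ (mem_closedTheorems
    (.K σ τ) (axiomK_bd σ τ)) M.defaultEnv) x y)

theorem app_S {ρ σ τ : Ty} (x : M.D (ρ ⇒ σ ⇒ τ)) (y : M.D (ρ ⇒ σ)) (z : M.D ρ) :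
    M.app (M.app (M.app (M.con (.S ρ σ τ)) x) y) z = M.app (M.app x z) (M.app y z) :=
  IsModel.sim_iff.1 ((den_S ρ σ τ).sat_close.1 (hM.sat _ (mem_closedTheorems
    (.S ρ σ τ) (axiomS_bd ρ σ τ)) M.defaultEnv) x y z)

theorem app_R_zero (f : M.D (.nat ⇒ .nat ⇒ .nat)) (m : M.D .nat) :
    M.app (M.app (M.app (M.con (.R .nat)) f) m) 0 = m := by
  have h := hM.sat _ axiomR0_mem M.defaultEnv f m
  by_contra h'
  exact h fun h₁ => (h' (hM.eq_iff.1 h₁)).elim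

theorem app_R_succ (f : M.D (.nat ⇒ .nat ⇒ .nat)) (m n : M.D .nat) :
    M.app (M.app (M.app (M.con (.R .nat)) f) m) (n + 1) =
      M.app (M.app f n) (M.app (M.app (M.app (M.con (.R .nat)) f) m) n) := by
  have h := hM.sat _ axiomR0_mem M.defaultEnv f m
  by_contra h'
  exact h fun _ h₂ => (h' (hM.eq_iff.1 (h₂ n))).elim

/-- Tuples of elements of the given types. -/
@[reducible] def Args (M : Struct) : List Ty → Type
  | [] => Unit
  | σ :: Γ => M.D σ × Args M Γ

/-- The functions given by applicative expressions with parameters. -/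
inductive Poly (M : Struct) : (Γ : List Ty) → (τ : Ty) → (Args M Γ → M.D τ) → Prop
  | const {Γ : List Ty} {τ : Ty} (a : M.D τ) : Poly M Γ τ fun _ => a
  | fst {Γ : List Ty} {τ : Ty} : Poly M (τ :: Γ) τ fun e => e.1
  | weak {Γ : List Ty} {σ τ : Ty} {F : Args M Γ → M.D τ} :
      Poly M Γ τ F → Poly M (σ :: Γ) τ fun e => F e.2
  | app {Γ : List Ty} {σ τ : Ty} {F : Args M Γ → M.D (σ ⇒ τ)} {G : Args M Γ → M.D σ} :
      Poly M Γ (σ ⇒ τ) F → Poly M Γ σ G → Poly M Γ τ fun e => M.app (F e) (G e)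

/-- Combinatory completeness by bracket abstraction: `Π` handles constants and other variables, `Σ Π
Π` the abstracted variable, and `Σ` applications. -/
theorem Poly.lam {Γ : List Ty} {σ τ : Ty} {F : Args M (σ :: Γ) → M.D τ}
    (h : Poly M (σ :: Γ) τ F) :
    ∃ G : Args M Γ → M.D (σ ⇒ τ), Poly M Γ (σ ⇒ τ) G ∧ ∀ e x, M.app (G e) x = F (x, e) := by
  -- The induction needs an arbitrary context as index. The claim is therefore made trivial for the
  -- empty context.
  let C : (Δ : List Ty) → (τ : Ty) → (Args M Δ → M.D τ) → Prop := fun Δ τ =>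
    match Δ with
    | [] => fun _ => True
    | σ :: Γ => fun F => ∃ G : Args M Γ → M.D (σ ⇒ τ),
        Poly M Γ (σ ⇒ τ) G ∧ ∀ e x, M.app (G e) x = F (x, e)
  suffices H : ∀ {Δ τ F}, Poly M Δ τ F → C Δ τ F from H h
  intro Δ τ F h
  induction h with
  | @const Δ τ a =>
    cases Δ with
    | nil => trivial
    | cons σ Γ => exact ⟨_, .const (M.app (M.con (.K τ σ)) a), fun _ _ => app_K _ _⟩
  | @fst Γ σ =>
    exact ⟨_, .const (M.app (M.app (M.con (.S σ (σ ⇒ σ) σ)) (M.con (.K σ (σ ⇒ σ))))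
      (M.con (.K σ σ))), fun _ _ => by rw [app_S, app_K]⟩
  | @weak Γ σ τ F h => exact ⟨_, .app (.const (M.con (.K τ σ))) h, fun _ _ => app_K _ _⟩
  | @app Δ ρ τ F G _ _ ih₁ ih₂ =>
    cases Δ with
    | nil => trivial
    | cons σ Γ =>
      obtain ⟨G₁, hG₁, e₁⟩ := ih₁
      obtain ⟨G₂, hG₂, e₂⟩ := ih₂
      exact ⟨_, .app (.app (.const (M.con (.S σ ρ τ))) hG₁) hG₂, fun e x => by
        rw [app_S, e₁, e₂]⟩

theorem Poly.exists_fun {σ τ : Ty} {F : M.D σ → M.D τ} (h : Poly M [σ] τ fun e => F e.1) :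
    ∃ f : M.D (σ ⇒ τ), ∀ x, f x = F x := by
  obtain ⟨G, -, hG⟩ := h.lam
  exact ⟨G (), fun x => hG () x⟩

theorem Poly.exists_fun₂ {ρ σ τ : Ty} {F : M.D ρ → M.D σ → M.D τ}
    (h : Poly M [σ, ρ] τ fun e => F e.2.1 e.1) :
    ∃ f : M.D (ρ ⇒ σ ⇒ τ), ∀ x y, f x y = F x y := by
  obtain ⟨G, hG, e⟩ := h.lam
  obtain ⟨G', -, e'⟩ := hG.lam
  exact ⟨G' (), fun x y => by rw [e', e]⟩

omit hM in
theorem Poly.snd {Γ : List Ty} {σ τ : Ty} : Poly M (σ :: τ :: Γ) τ fun e => e.2.1 := .weak .fst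
omit hM in
theorem Poly.third {Γ : List Ty} {ρ σ τ : Ty} : Poly M (ρ :: σ :: τ :: Γ) τ fun e => e.2.2.1 :=
  .weak .snd
omit hM in
theorem Poly.fourth {Γ : List Ty} {ν ρ σ τ : Ty} :
    Poly M (ν :: ρ :: σ :: τ :: Γ) τ fun e => e.2.2.2.1 := .weak .third

omit hM in
theorem Poly.add {Γ : List Ty} {F G : Args M Γ → M.D .nat} (hF : Poly M Γ .nat F)
    (hG : Poly M Γ .nat G) : Poly M Γ .nat fun e => F e + G e :=
  .app (.app (.const (M.con .add)) hF) hG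

omit hM in
theorem Poly.mul {Γ : List Ty} {F G : Args M Γ → M.D .nat} (hF : Poly M Γ .nat F)
    (hG : Poly M Γ .nat G) : Poly M Γ .nat fun e => F e * G e :=
  .app (.app (.const (M.con .mul)) hF) hG

/-! ### Definable predicates -/

/-- `∀ x¹ ∃ y⁰ (y = 0 ↔ x(0) < x(1))` yields a functional. -/
theorem exists_ltFun : ∃ Y : M.D Ty.two, ∀ x : M.D Ty.one,
    (x 0 < x 1 → Y x = 0) ∧ (¬ x 0 < x 1 → Y x = 1) := by
  -- In the language `<` is only a relation symbol. Quantifier-free choice of a truth value `y`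
  -- turns it into a functional.
  let lt : Fml := .lt (.app (.var Ty.one 0) (.con .zero)) (.app (.var Ty.one 0) (.con .one))
  let A : Fml := .conj (.imp lt (.eq (.var .nat 0) (.con .zero)))
    (.imp lt.neg (.eq (.var .nat 0) (.con .one)))
  have hA : axiomAC A ∈ closedTheorems :=
    ⟨fun _ => rfl, .axm (Or.inl (.ac (by repeat' constructor)))⟩
  have h : (∀ x : M.D Ty.one, ¬ ∀ y : M.D .nat, ¬ ¬ (((x 0 < x 1 → M.Eq y 0) →
      ¬ (¬ x 0 < x 1 → M.Eq y 1)))) → ¬ ∀ Y : M.D Ty.two, ¬ ∀ x : M.D Ty.one,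
      ¬ (((x 0 < x 1 → M.Eq (Y x) 0) → ¬ (¬ x 0 < x 1 → M.Eq (Y x) 1))) :=
    hM.sat _ hA M.defaultEnv
  simp only [hM.eq_iff] at h
  by_contra! hc
  refine h (fun x hx => ?_) fun Y hY => ?_
  · by_cases hx' : x 0 < x 1
    · exact hx 0 fun h => h (fun _ => rfl) fun h => (h hx').elim
    · exact hx 1 fun h => h (fun h => (hx' h).elim) fun _ => rfl
  · obtain ⟨x, hx⟩ := hc Y
    refine hY x fun h₁ h₂ => ?_
    exact (hx h₁).2 (h₂ (hx h₁).1.not_gt)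

theorem exists_ltChar : ∃ L : M.D (.nat ⇒ .nat ⇒ .nat), ∀ s t,
    (s < t → L s t = 0) ∧ (¬ s < t → L s t = 1) := by
  obtain ⟨Y, hY⟩ := exists_ltFun (M := M)
  -- The recursor codes the pair of arguments as the sequence `s, t, t, …`, to which `Y` can be
  -- applied.
  obtain ⟨L, hL⟩ := Poly.exists_fun₂ (M := M) (ρ := .nat) (σ := .nat) (τ := .nat)
    (F := fun s t => Y (M.app (M.app (M.con (.R .nat))
      (M.app (M.con (.K (.nat ⇒ .nat) .nat)) (M.app (M.con (.K .nat .nat)) t))) s))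
    (.app (.const _) (.app (.app (.const _) (.app (.const _) (.app (.const _) .fst))) .snd))
  refine ⟨L, fun s t => ?_⟩
  have := hY (M.app (M.app (M.con (.R .nat))
      (M.app (M.con (.K (.nat ⇒ .nat) .nat)) (M.app (M.con (.K .nat .nat)) t))) s)
  rw [hL]
  rwa [app_R_zero, show (1 : M.D .nat) = 0 + 1 from (zero_add 1).symm, app_R_succ, app_K,
    app_K, zero_add] at this

/-- The predicates with a characteristic function. -/
def DefP (M : Struct) [IsModel M] (Γ : List Ty) (P : Args M Γ → Prop) : Prop :=
  ∃ F, Poly M Γ .nat F ∧ ∀ e, F e = 0 ↔ P e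

namespace DefP
variable {Γ : List Ty} {P Q : Args M Γ → Prop}

theorem lt {F G : Args M Γ → M.D .nat} (hF : Poly M Γ .nat F) (hG : Poly M Γ .nat G) :
    DefP M Γ fun e => F e < G e := by
  obtain ⟨L, hL⟩ := exists_ltChar (M := M)
  refine ⟨_, .app (.app (.const L) hF) hG, fun e => ?_⟩
  by_cases h : F e < G e
  · simp [h, (hL _ _).1 h]
  · simp [h, (hL _ _).2 h]

theorem not (h : DefP M Γ P) : DefP M Γ fun e => ¬ P e := by
  obtain ⟨F, hF, hP⟩ := h
  obtain ⟨G, hG, h⟩ := lt (.const 0) hF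
  refine ⟨G, hG, fun e => ?_⟩
  exact (h e).trans ((zero_le _).lt_iff_ne'.trans (not_congr (hP e)))

theorem or (h : DefP M Γ P) (h' : DefP M Γ Q) : DefP M Γ fun e => P e ∨ Q e := by
  obtain ⟨F, hF, hP⟩ := h
  obtain ⟨G, hG, hQ⟩ := h'
  refine ⟨_, hF.mul hG, fun e => ?_⟩
  refine Iff.trans ?_ (or_congr (hP e) (hQ e))
  constructor
  · intro h
    by_contra! h'
    have h₁ := (zero_le (F e)).lt_of_ne' h'.1
    have h₂ := (zero_le (G e)).lt_of_ne' h'.2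
    exact (mul_pos h₁ h₂).ne' h
  · rintro (h | h) <;> simp [h]

theorem congr (h : DefP M Γ P) (h' : ∀ e, P e ↔ Q e) : DefP M Γ Q := by
  rwa [funext fun e => propext (h' e)] at h

theorem imp (h : DefP M Γ P) (h' : DefP M Γ Q) : DefP M Γ fun e => P e → Q e :=
  (h.not.or h').congr fun _ => imp_iff_not_or.symm

theorem and (h : DefP M Γ P) (h' : DefP M Γ Q) : DefP M Γ fun e => P e ∧ Q e :=
  ((h.imp h'.not).not).congr fun _ => by tauto

theorem eq {F G : Args M Γ → M.D .nat} (hF : Poly M Γ .nat F) (hG : Poly M Γ .nat G) :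
    DefP M Γ fun e => F e = G e :=
  ((lt hF hG).not.and (lt hG hF).not).congr fun _ => by
    rw [not_lt, not_lt]; exact antisymm_iff.trans eq_comm

/-- This is where `(∃²)` enters: applied to the characteristic function in the variable `n`, it
decides the numerical quantifier. So `DefP` contains all arithmetical predicates with parameters. -/
theorem ex {Q : M.D .nat → Args M Γ → Prop} (h : DefP M (.nat :: Γ) fun e => Q e.1 e.2) :
    DefP M Γ fun e => ∃ n, Q n e := by
  obtain ⟨F, hF, hQ⟩ := h
  obtain ⟨G, hG, hFG⟩ := hF.lam
  have h := hM.sat _ existsTwo_mem M.defaultEnv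
  obtain ⟨E, hE⟩ : ∃ E : M.D Ty.two, ∀ f : M.D Ty.one, (∃ n, f n = 0) ↔ E f = 0 := by
    by_contra! h'
    refine h fun E hE => ?_
    obtain ⟨f, hf⟩ := h' E
    refine hE fun _ h₂ => ?_
    have h₃ : ¬ (((¬ ∀ n, ¬ M.Eq (f n) 0) → M.Eq (E f) 0) →
      ¬ (M.Eq (E f) 0 → ¬ ∀ n, ¬ M.Eq (f n) 0)) := h₂ f
    simp only [hM.eq_iff] at h₃
    push Not at h₃
    rcases hf with hf | hf
    · exact hf.2 (h₃.1 hf.1)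
    · obtain ⟨n, hn⟩ := h₃.2 hf.2
      exact hf.1 n hn
  refine ⟨_, .app (.const E) hG, fun e => ?_⟩
  rw [← hE]
  exact exists_congr fun n => by rw [hFG]; exact hQ (n, e)

theorem all {Q : M.D .nat → Args M Γ → Prop} (h : DefP M (.nat :: Γ) fun e => Q e.1 e.2) :
    DefP M Γ fun e => ∀ n, Q n e :=
  (ex (Q := fun n e => ¬ Q n e) h.not).not.congr fun _ => by push Not; rfl

end DefP

/-! ### Induction, comprehension and choice for definable predicates -/

theorem DefP.induction {P : M.D .nat → Prop} (hP : DefP M [.nat] fun e => P e.1) (h0 : P 0)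
    (hs : ∀ n, P n → P (n + 1)) (n : M.D .nat) : P n := by
  obtain ⟨F, hF, h⟩ := hP
  obtain ⟨f, hf⟩ := Poly.exists_fun (F := fun x => F (x, ())) hF
  have key := (sat_indSentence _).1 (hM.sat _ indSentence_mem M.defaultEnv) f
  have e : ∀ n, M.Eq (f n) (M.con .zero) ↔ P n := fun n => by
    rw [hM.eq_iff, hf]
    exact h _
  exact (e n).1 (key ((e 0).2 h0) (fun n hn => (e (n + 1)).2 (hs n ((e n).1 hn))) n)

theorem DefP.strong_induction {P : M.D .nat → Prop} (hP : DefP M [.nat] fun e => P e.1)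
    (h : ∀ n, (∀ m, m < n → P m) → P n) (n : M.D .nat) : P n := by
  refine h n (DefP.induction (P := fun n => ∀ m, m < n → P m)
    (DefP.all (Γ := [.nat]) (Q := fun m e => m < e.1 → P m) ?_) ?_ ?_ n)
  · refine (DefP.lt .fst .snd).imp ?_
    obtain ⟨F, hF, h⟩ := hP
    obtain ⟨f, hf⟩ := Poly.exists_fun (F := fun x => F (x, ())) hF
    exact ⟨_, .app (.const f) .fst, fun e => by rw [hf]; exact h _⟩
  · exact fun m hm => ((zero_le m).not_gt hm).elim
  · intro n ih m hm
    rcases ((lt_add_one_iff m n).1 hm).lt_or_eq with h' | rfl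
    · exact ih m h'
    · exact h m ih

theorem DefP.exists_least {P : M.D .nat → Prop} (hP : DefP M [.nat] fun e => P e.1)
    (h : ∃ n, P n) : ∃ n, P n ∧ ∀ m, m < n → ¬ P m := by
  by_contra! h'
  obtain ⟨n, hn⟩ := h
  refine DefP.strong_induction (P := fun n => ¬ P n) hP.not (fun n ih hn => ?_) n hn
  obtain ⟨m, hm, hPm⟩ := h' n hn
  exact ih m hm hPm

/-- Truth is the value `0` in `DefP`, whereas membership in a set is the value `1`. Comparing `0 <
F` exchanges the two conventions and yields values in `{0, 1}`. -/
theorem DefP.exists_char {σ : Ty} {P : M.D σ → Prop} (hP : DefP M [σ] fun e => P e.1) :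
    ∃ A : M.D (σ ⇒ .nat), ∀ x, (P x → A x = 1) ∧ (¬ P x → A x = 0) := by
  obtain ⟨F, hF, h⟩ := hP
  obtain ⟨L, hL⟩ := exists_ltChar (M := M)
  obtain ⟨A, hA⟩ := Poly.exists_fun (F := fun x => L 0 (F (x, ())))
    (.app (.app (.const L) (.const 0)) hF)
  refine ⟨A, fun x => ?_⟩
  rw [hA, ← show _ ↔ P x from h (x, ())]
  exact ⟨fun h => (hL _ _).2 h.not_gt, fun h => (hL _ _).1 ((zero_le _).lt_of_ne' h)⟩

theorem DefP.exists_char₂ {σ τ : Ty} {P : M.D σ → M.D τ → Prop}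
    (hP : DefP M [τ, σ] fun e => P e.2.1 e.1) :
    ∃ A : M.D (σ ⇒ τ ⇒ .nat), ∀ x y, (P x y → A x y = 1) ∧ (¬ P x y → A x y = 0) := by
  obtain ⟨F, hF, h⟩ := hP
  obtain ⟨L, hL⟩ := exists_ltChar (M := M)
  obtain ⟨A, hA⟩ := Poly.exists_fun₂ (F := fun x y => L 0 (F (y, x, ())))
    (.app (.app (.const L) (.const 0)) hF)
  refine ⟨A, fun x y => ?_⟩
  rw [hA, ← show _ ↔ P x y from h (y, x, ())]
  exact ⟨fun h => (hL _ _).2 h.not_gt, fun h => (hL _ _).1 ((zero_le _).lt_of_ne' h)⟩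

theorem DefP.choice {P : M.D Ty.one → M.D .nat → Prop} (hP : DefP M [.nat, Ty.one] fun e => P e.2.1 e.1)
    (h : ∀ x, ∃ y, P x y) : ∃ Y : M.D Ty.two, ∀ x, P x (Y x) := by
  obtain ⟨F, hF, h'⟩ := hP
  obtain ⟨f, hf⟩ := Poly.exists_fun₂ (F := fun x y => F (y, x, ())) hF
  have e : ∀ x y, M.Eq (f x y) (M.con .zero) ↔ P x y := fun x y => by
    rw [hM.eq_iff, hf]
    exact h' _
  obtain ⟨Y, hY⟩ := (sat_choiceSentence _).1 (hM.sat _ choiceSentence_mem M.defaultEnv) f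
    fun x => (h x).imp fun y hy => (e x y).2 hy
  exact ⟨Y, fun x => (e _ _).1 (hY x)⟩

end arithmetic

/-! ### The ordered field of fractions of an ordered semiring -/

section differences
variable (N : Type) [CommSemiring N] [LinearOrder N] [IsStrictOrderedRing N]

/-- Pairs `(a, b)` up to equality of the differences `a - b`. -/
def diffSetoid : Setoid (N × N) where
  r x y := x.1 + y.2 = y.1 + x.2
  iseqv := ⟨fun _ => rfl, fun h => h.symm, fun {x y z} h h' => by
    apply add_right_cancel (b := y.2)
    calc x.1 + z.2 + y.2 = x.1 + y.2 + z.2 := by ring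
      _ = y.1 + z.2 + x.2 := by rw [h]; ring
      _ = z.1 + x.2 + y.2 := by rw [h']; ring⟩

/-- The ring of differences of an ordered semiring. -/
def Diff : Type := Quotient (diffSetoid N)

variable {N}

namespace Diff

def mk (a b : N) : Diff N := Quotient.mk (diffSetoid N) (a, b)

theorem mk_eq {a b c d : N} : mk a b = mk c d ↔ a + d = c + b :=
  ⟨fun h => Quotient.exact h, fun h => Quotient.sound h⟩

theorem ind {P : Diff N → Prop} (h : ∀ a b, P (mk a b)) (x : Diff N) : P x :=
  Quotient.inductionOn x fun p => h p.1 p.2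

instance : Zero (Diff N) := ⟨mk 0 0⟩
instance : One (Diff N) := ⟨mk 1 0⟩
instance : Neg (Diff N) := ⟨Quotient.lift (fun p => mk p.2 p.1) fun p q h => by
  have h : p.1 + q.2 = q.1 + p.2 := h
  rw [mk_eq, add_comm, ← h, add_comm]⟩
instance : Add (Diff N) := ⟨Quotient.lift₂ (fun p q => mk (p.1 + q.1) (p.2 + q.2)) fun p q p' q' h h' => by
  have h : p.1 + p'.2 = p'.1 + p.2 := h
  have h' : q.1 + q'.2 = q'.1 + q.2 := h'
  rw [mk_eq, add_add_add_comm, h, h', add_add_add_comm]⟩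
instance : Mul (Diff N) := ⟨Quotient.lift₂
  (fun p q => mk (p.1 * q.1 + p.2 * q.2) (p.1 * q.2 + p.2 * q.1)) fun p q p' q' h h' => by
  have h : p.1 + p'.2 = p'.1 + p.2 := h
  have h' : q.1 + q'.2 = q'.1 + q.2 := h'
  rw [mk_eq]
  apply add_right_cancel (b := p'.2 * q.1 + p'.1 * q.2)
  calc p.1 * q.1 + p.2 * q.2 + (p'.1 * q'.2 + p'.2 * q'.1) + (p'.2 * q.1 + p'.1 * q.2)
      = (p.1 + p'.2) * q.1 + (p'.1 + p.2) * q.2 + (p'.1 * q'.2 + p'.2 * q'.1) := by ring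
    _ = (p'.1 + p.2) * q.1 + (p.1 + p'.2) * q.2 + (p'.1 * q'.2 + p'.2 * q'.1) := by rw [h]
    _ = p'.1 * (q.1 + q'.2) + p'.2 * (q'.1 + q.2) + (p.2 * q.1 + p.1 * q.2) := by ring
    _ = p'.1 * (q'.1 + q.2) + p'.2 * (q.1 + q'.2) + (p.2 * q.1 + p.1 * q.2) := by rw [h']
    _ = p'.1 * q'.1 + p'.2 * q'.2 + (p.1 * q.2 + p.2 * q.1) + (p'.2 * q.1 + p'.1 * q.2) := by
      ring⟩

theorem add_mk (a b c d : N) : mk a b + mk c d = mk (a + c) (b + d) := rfl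
theorem mul_mk (a b c d : N) : mk a b * mk c d = mk (a * c + b * d) (a * d + b * c) := rfl
theorem neg_mk (a b : N) : -mk a b = mk b a := rfl
theorem zero_def : (0 : Diff N) = mk 0 0 := rfl
theorem one_def : (1 : Diff N) = mk 1 0 := rfl

instance : CommRing (Diff N) where
  nsmul := nsmulRec
  zsmul := zsmulRec
  add_assoc := ind fun a b => ind fun c d => ind fun e f => by
    simp only [add_mk, mk_eq]; ring
  add_comm := ind fun a b => ind fun c d => by simp only [add_mk, mk_eq]; ring
  zero_add := ind fun a b => by simp only [zero_def, add_mk, mk_eq]; ring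
  add_zero := ind fun a b => by simp only [zero_def, add_mk, mk_eq]; ring
  neg_add_cancel := ind fun a b => by simp only [zero_def, neg_mk, add_mk, mk_eq]; ring
  mul_assoc := ind fun a b => ind fun c d => ind fun e f => by
    simp only [mul_mk, mk_eq]; ring
  mul_comm := ind fun a b => ind fun c d => by simp only [mul_mk, mk_eq]; ring
  one_mul := ind fun a b => by simp only [one_def, mul_mk, mk_eq]; ring
  mul_one := ind fun a b => by simp only [one_def, mul_mk, mk_eq]; ring
  zero_mul := ind fun a b => by simp only [zero_def, mul_mk, mk_eq]; ring
  mul_zero := ind fun a b => by simp only [zero_def, mul_mk, mk_eq]; ring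
  left_distrib := ind fun a b => ind fun c d => ind fun e f => by
    simp only [add_mk, mul_mk, mk_eq]; ring
  right_distrib := ind fun a b => ind fun c d => ind fun e f => by
    simp only [add_mk, mul_mk, mk_eq]; ring

/-- The embedding of the semiring. -/
def of : N →+* Diff N where
  toFun a := mk a 0
  map_zero' := rfl
  map_one' := rfl
  map_add' a b := by simp only [add_mk, mk_eq]; ring
  map_mul' a b := by simp only [mul_mk, mk_eq]; ring

theorem mk_eq_sub (a b : N) : mk a b = of a - of b := by
  simp only [of, RingHom.coe_mk, MonoidHom.coe_mk, OneHom.coe_mk, sub_eq_add_neg, neg_mk, add_mk,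
    mk_eq]
  ring

theorem of_injective : Function.Injective (of (N := N)) := fun a b h => by
  have := mk_eq.1 h
  simpa using this

variable [ExistsAddOfLE N]

/-- Each element is `± of c`. -/
theorem exists_eq_of_or (x : Diff N) : ∃ c, x = of c ∨ x = -of c := by
  induction x using ind with
  | h a b =>
    rcases le_total a b with h | h
    · obtain ⟨c, rfl⟩ := exists_add_of_le h
      exact ⟨c, Or.inr (by rw [mk_eq_sub, map_add]; ring)⟩
    · obtain ⟨c, rfl⟩ := exists_add_of_le h
      exact ⟨c, Or.inl (by rw [mk_eq_sub, map_add]; ring)⟩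

instance : Nontrivial (Diff N) := ⟨of 0, of 1, fun h => zero_ne_one (of_injective h)⟩

instance : NoZeroDivisors (Diff N) where
  eq_zero_or_eq_zero_of_mul_eq_zero {x y} h := by
    obtain ⟨a, ha⟩ := exists_eq_of_or x
    obtain ⟨b, hb⟩ := exists_eq_of_or y
    have : of (a * b) = 0 := by
      rcases ha with rfl | rfl <;> rcases hb with rfl | rfl <;> simpa using h
    rw [← map_zero of] at this
    rcases mul_eq_zero.1 (of_injective this) with rfl | rfl
    · left; rcases ha with rfl | rfl <;> simp
    · right; rcases hb with rfl | rfl <;> simp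

instance : IsDomain (Diff N) := NoZeroDivisors.to_isDomain _

end Diff

variable (N) in
/-- An ordered semiring with differences embeds into an ordered field in which every element is a
fraction. -/
theorem exists_orderedField [ExistsAddOfLE N] (h0 : ∀ a : N, 0 ≤ a) :
    ∃ (Q : Type) (_ : Field Q) (_ : LinearOrder Q) (_ : IsStrictOrderedRing Q) (ι : N →+* Q),
      StrictMono ι ∧ ∀ q : Q, ∃ p m d : N, 0 < d ∧ q = (ι p - ι m) / ι d := by
  let Q := FractionRing (Diff N)
  let ι : N →+* Q := (algebraMap (Diff N) Q).comp Diff.of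
  have hι : Function.Injective ι :=
    (IsFractionRing.injective (Diff N) Q).comp Diff.of_injective
  have hι0 : ∀ {a : N}, 0 < a → ι a ≠ 0 := fun {a} ha h =>
    ha.ne' (hι (h.trans (map_zero ι).symm))
  have frac : ∀ q : Q, ∃ c d : N, 0 < d ∧ (q = ι c / ι d ∨ -q = ι c / ι d) := by
    intro q
    obtain ⟨x, y, hy, rfl⟩ := IsFractionRing.div_surjective (A := Diff N) q
    obtain ⟨c, hc⟩ := x.exists_eq_of_or
    obtain ⟨d, hd⟩ := y.exists_eq_of_or
    have hd0 : 0 < d := by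
      refine (h0 d).lt_of_ne' ?_
      rintro rfl
      exact nonZeroDivisors.ne_zero hy (by simpa using hd)
    refine ⟨c, d, hd0, ?_⟩
    have e : ∀ a, algebraMap (Diff N) Q (Diff.of a) = ι a := fun _ => rfl
    rcases hc with rfl | rfl <;> rcases hd with rfl | rfl <;>
      simp [e, neg_div, div_neg]
  -- The nonnegative elements are the fractions of semiring elements. Since all of these are `≥ 0`,
  -- a sum of two numerators vanishes only if both do.
  let C : RingCone Q :=
    { carrier := {q | ∃ c d : N, 0 < d ∧ q = ι c / ι d}
      mul_mem' := by
        rintro _ _ ⟨c, d, hd, rfl⟩ ⟨c', d', hd', rfl⟩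
        exact ⟨c * c', d * d', mul_pos hd hd', by rw [map_mul, map_mul, div_mul_div_comm]⟩
      one_mem' := ⟨1, 1, one_pos, by simp⟩
      add_mem' := by
        rintro _ _ ⟨c, d, hd, rfl⟩ ⟨c', d', hd', rfl⟩
        exact ⟨c * d' + d * c', d * d', mul_pos hd hd', by
          rw [div_add_div _ _ (hι0 hd) (hι0 hd')]; simp⟩
      zero_mem' := ⟨0, 1, one_pos, by simp⟩
      eq_zero_of_mem_of_neg_mem' := by
        rintro q ⟨c, d, hd, rfl⟩ ⟨c', d', hd', h⟩
        rw [neg_eq_iff_add_eq_zero, div_add_div _ _ (hι0 hd) (hι0 hd'),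
          div_eq_zero_iff, or_iff_left (mul_ne_zero (hι0 hd) (hι0 hd'))] at h
        have h' : c * d' + d * c' = 0 := hι (by simpa using h)
        have h₁ : c * d' = 0 := le_antisymm (h' ▸ le_add_of_nonneg_right (h0 _)) (h0 _)
        rcases mul_eq_zero.1 h₁ with rfl | rfl
        · simp
        · exact (lt_irrefl _ hd').elim }
  have : HasMemOrNegMem C := ⟨fun q => by
    obtain ⟨c, d, hd, h | h⟩ := frac q
    · exact Or.inl ⟨c, d, hd, h⟩
    · exact Or.inr ⟨c, d, hd, h⟩⟩
  classical
  let _ : DecidablePred (· ∈ C) := Classical.decPred _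
  let _ : LinearOrder Q := .mkOfAddGroupCone C
  have : IsOrderedRing Q := .mkOfCone C
  have : IsStrictOrderedRing Q := IsOrderedRing.toIsStrictOrderedRing Q
  refine ⟨Q, inferInstance, inferInstance, inferInstance, ι, ?_, ?_⟩
  · refine Monotone.strictMono_of_injective (fun a b h => ?_) hι
    obtain ⟨c, rfl⟩ := exists_add_of_le h
    show ι (a + c) - ι a ∈ C
    exact ⟨c, 1, one_pos, by simp⟩
  · intro q
    obtain ⟨c, d, hd, h | h⟩ := frac q
    · exact ⟨c, 0, d, hd, by simpa using h⟩
    · exact ⟨0, c, d, hd, by rw [map_zero, zero_sub, neg_div, ← h, neg_neg]⟩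

end differences

/-! ### Residue fields of ultrapowers and limits of sequences of fractions -/

section completion
open Filter

variable {N : Type} [CommSemiring N] [LinearOrder N] [IsStrictOrderedRing N] [ExistsAddOfLE N]

/-- The elements of an ordered field `K` over `N` bounded by an element of `N`. -/
def finiteSubring {K : Type} [Field K] [LinearOrder K] [IsStrictOrderedRing K] (ι : N →+* K) :
    Subring K where
  carrier := {x | ∃ n, |x| ≤ ι n}
  mul_mem' := by
    rintro x y ⟨m, hm⟩ ⟨n, hn⟩
    refine ⟨m * n, ?_⟩
    rw [abs_mul, map_mul]
    exact mul_le_mul hm hn (abs_nonneg _) ((abs_nonneg _).trans hm)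
  one_mem' := ⟨1, by simp⟩
  add_mem' := by
    rintro x y ⟨m, hm⟩ ⟨n, hn⟩
    exact ⟨m + n, (abs_add_le x y).trans (by rw [map_add]; exact add_le_add hm hn)⟩
  zero_mem' := ⟨0, by simp⟩
  neg_mem' := by
    rintro x ⟨m, hm⟩
    exact ⟨m, by rwa [abs_neg]⟩

/-- The elements infinitesimal with respect to `N`. -/
def infinitesimals {K : Type} [Field K] [LinearOrder K] [IsStrictOrderedRing K] (ι : N →+* K)
    (hι : Monotone ι) (h0 : ∀ a : N, 0 ≤ a) : Ideal (finiteSubring ι) where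
  carrier := {x | ∀ n, ι n * |(x : K)| ≤ 1}
  add_mem' := by
    intro x y hx hy n
    have h₁ := hx (n + n)
    have h₂ := hy (n + n)
    have h₃ := mul_le_mul_of_nonneg_left (abs_add_le (x : K) y)
      ((map_zero ι).symm.le.trans (hι (h0 n)))
    rw [map_add] at h₁ h₂
    push_cast
    linarith
  zero_mem' := by intro n; simp
  smul_mem' := by
    rintro ⟨c, k, hk⟩ x hx n
    have hn := (map_zero ι).symm.le.trans (hι (h0 n))
    calc ι n * |c * (x : K)| = |c| * (ι n * |(x : K)|) := by rw [abs_mul]; ring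
      _ ≤ ι k * (ι n * |(x : K)|) :=
        mul_le_mul_of_nonneg_right hk (mul_nonneg hn (abs_nonneg _))
      _ = ι (k * n) * |(x : K)| := by rw [map_mul]; ring
      _ ≤ 1 := hx _

omit [IsStrictOrderedRing N] [ExistsAddOfLE N] in
-- The inverse of an element that is not infinitesimal is bounded by some `ι n`, hence finite. So
-- every element outside the ideal is a unit.
theorem infinitesimals_isMaximal {K : Type} [Field K] [LinearOrder K] [IsStrictOrderedRing K]
    (ι : N →+* K) (hι : Monotone ι) (h0 : ∀ a : N, 0 ≤ a) :
    (infinitesimals ι hι h0).IsMaximal := by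
  rw [Ideal.isMaximal_iff]
  constructor
  · intro h
    have := h (1 + 1)
    simp only [map_add, map_one, OneMemClass.coe_one, abs_one, mul_one] at this
    norm_num at this
  · rintro J x hJ hx hxJ
    obtain ⟨n, hn⟩ : ∃ n, 1 < ι n * |(x : K)| := by
      by_contra! h
      exact hx h
    have hx0 : (x : K) ≠ 0 := by
      intro h
      rw [h] at hn
      norm_num at hn
    have hxp : 0 < |(x : K)| := abs_pos.2 hx0
    have : |(x : K)⁻¹| ≤ ι n := by
      rw [abs_inv, inv_le_iff_one_le_mul₀ hxp]
      exact hn.le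
    have h := J.mul_mem_left ⟨(x : K)⁻¹, n, this⟩ hxJ
    rwa [show (⟨(x : K)⁻¹, n, this⟩ : finiteSubring ι) * x = 1 from
      Subtype.ext (inv_mul_cancel₀ hx0)] at h

omit [IsStrictOrderedRing N] [ExistsAddOfLE N] in
/-- The residue field of `K` is an ordered field without infinitesimals. -/
theorem exists_residueField {K : Type} [Field K] [LinearOrder K] [IsStrictOrderedRing K]
    (ι : N →+* K) (hι : Monotone ι) (h0 : ∀ a : N, 0 ≤ a) :
    ∃ (R : Type) (_ : Field R) (_ : LinearOrder R) (_ : IsStrictOrderedRing R)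
      (π : finiteSubring ι →+* R), Monotone π ∧
      ∀ r, 0 < r → ∃ (n : N) (s : finiteSubring ι), 0 < s ∧ π s = r ∧ 1 ≤ ι n * s := by
  classical
  let I := infinitesimals ι hι h0
  let R := finiteSubring ι ⧸ I
  have := infinitesimals_isMaximal ι hι h0
  let _ : Field R := Ideal.Quotient.field I
  let π : finiteSubring ι →+* R := Ideal.Quotient.mk I
  let C : RingCone R :=
    { carrier := {q | ∃ x : finiteSubring ι, 0 ≤ (x : K) ∧ π x = q}
      mul_mem' := by
        rintro _ _ ⟨x, hx, rfl⟩ ⟨y, hy, rfl⟩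
        exact ⟨x * y, mul_nonneg hx hy, map_mul _ _ _⟩
      one_mem' := ⟨1, zero_le_one, map_one _⟩
      add_mem' := by
        rintro _ _ ⟨x, hx, rfl⟩ ⟨y, hy, rfl⟩
        exact ⟨x + y, add_nonneg hx hy, map_add _ _ _⟩
      zero_mem' := ⟨0, le_rfl, map_zero _⟩
      eq_zero_of_mem_of_neg_mem' := by
        rintro q ⟨x, hx, rfl⟩ ⟨y, hy, h⟩
        rw [eq_neg_iff_add_eq_zero, ← map_add] at h
        have h : y + x ∈ I := Ideal.Quotient.eq_zero_iff_mem.1 h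
        -- If `x, y ≥ 0` and `y + x` is infinitesimal, then so is `x`, being between `0` and `y +
        -- x`.
        refine Ideal.Quotient.eq_zero_iff_mem.2 fun n => (mul_le_mul_of_nonneg_left ?_
          ((map_zero ι).symm.le.trans (hι (h0 n)))).trans (h n)
        push_cast
        rw [abs_of_nonneg hx, abs_of_nonneg (add_nonneg hy hx)]
        exact le_add_of_nonneg_left hy }
  have : HasMemOrNegMem C := ⟨fun q => by
    obtain ⟨x, rfl⟩ := Ideal.Quotient.mk_surjective q
    rcases le_total 0 (x : K) with h | h
    · exact Or.inl ⟨x, h, rfl⟩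
    · exact Or.inr ⟨-x, neg_nonneg.2 h, map_neg _ _⟩⟩
  let _ : DecidablePred (· ∈ C) := Classical.decPred _
  let _ : LinearOrder R := .mkOfAddGroupCone C
  have : IsOrderedRing R := .mkOfCone C
  have : IsStrictOrderedRing R := IsOrderedRing.toIsStrictOrderedRing R
  refine ⟨R, inferInstance, inferInstance, inferInstance, π, fun x y h => ?_, fun r hr => ?_⟩
  · exact ⟨y - x, sub_nonneg.2 h, map_sub _ _ _⟩
  · obtain ⟨x, hx, hxr⟩ : r - 0 ∈ C := hr.le
    rw [sub_zero] at hxr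
    have : x ∉ I := fun h => hr.ne' (hxr.symm.trans (Ideal.Quotient.eq_zero_iff_mem.2 h))
    obtain ⟨n, hn⟩ : ∃ n, 1 < ι n * |(x : K)| := by
      by_contra! h
      exact this h
    rw [abs_of_nonneg hx] at hn
    refine ⟨n, x, ?_, hxr, hn.le⟩
    refine lt_of_le_of_ne hx fun h => ?_
    rw [← h] at hn
    norm_num at hn

/-- An ordered field over `N` without infinitesimals, in which sequences of fractions that
converge at the rate `1 / E` have limits. -/
theorem exists_completeField (h0 : ∀ a : N, 0 ≤ a) (h1 : ∀ a : N, 0 < a → 1 ≤ a) (E : N → N)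
    (hE : ∀ d, ∃ n, d < E n) :
    ∃ (R : Type) (_ : Field R) (_ : LinearOrder R) (_ : IsStrictOrderedRing R) (ι : N →+* R),
      StrictMono ι ∧ (∀ r, 0 < r → ∃ n, 1 / ι (E n) < r) ∧
      ∀ x : N → R, (∀ n, ∃ p m d, 0 < d ∧ x n = (ι p - ι m) / ι d) →
        (∀ n i, |x n - x (n + i)| < 1 / ι (E n)) → ∃ r, ∀ n, |r - x n| ≤ 1 / ι (E n) := by
  obtain ⟨Q, _, _, _, ι₀, hι₀, hfrac⟩ := exists_orderedField N h0
  have : Nonempty N := ⟨0⟩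
  let U : Ultrafilter N := Ultrafilter.of atTop
  have hU : (U : Filter N) ≤ atTop := Ultrafilter.of_le atTop
  -- In the ultrapower along an ultrafilter finer than `atTop`, a rapidly converging sequence has
  -- its own germ as a limit up to infinitesimals.
  let K := Germ (U : Filter N) Q
  let j : Q →+* K :=
    { toFun := fun q => (q : K)
      map_zero' := rfl
      map_one' := rfl
      map_add' := fun _ _ => rfl
      map_mul' := fun _ _ => rfl }
  have hj : Monotone j := fun a b h => Germ.const_le h
  have hιK : Monotone (j.comp ι₀) := hj.comp hι₀.monotone
  obtain ⟨R, _, _, _, π, hπ, harch⟩ := exists_residueField (j.comp ι₀) hιK h0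
  have hpos : ∀ {a : N}, 0 < a → 0 < ι₀ a := fun h => by simpa using hι₀ h
  have hfin : ∀ q : Q, j q ∈ finiteSubring (j.comp ι₀) := by
    intro q
    obtain ⟨p, m, d, hd, rfl⟩ := hfrac q
    refine ⟨p + m, ?_⟩
    have hd1 : 1 ≤ ι₀ d := by simpa using hι₀.monotone (h1 d hd)
    have hp : 0 ≤ ι₀ p := by simpa using hι₀.monotone (h0 p)
    have hm : 0 ≤ ι₀ m := by simpa using hι₀.monotone (h0 m)
    have hle : |(ι₀ p - ι₀ m) / ι₀ d| ≤ ι₀ (p + m) := by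
      rw [abs_div, abs_of_pos (hpos hd), map_add]
      refine (div_le_self (abs_nonneg _) hd1).trans (abs_le.2 ⟨?_, ?_⟩) <;> linarith
    exact abs_le.2 ⟨by rw [RingHom.comp_apply, ← map_neg]; exact hj (abs_le.1 hle).1,
      hj (abs_le.1 hle).2⟩
  let φ : Q →+* R := π.comp (j.codRestrict _ hfin)
  have hφ : StrictMono φ := Monotone.strictMono_of_injective (fun a b h => hπ (hj h)) φ.injective
  refine ⟨R, inferInstance, inferInstance, inferInstance, φ.comp ι₀, hφ.comp hι₀, ?_, ?_⟩
  · intro r hr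
    obtain ⟨n, s, hs, rfl, hns⟩ := harch r hr
    have hn0 : 0 < n := by
      refine (h0 n).lt_of_ne' ?_
      rintro rfl
      rw [map_zero, zero_mul] at hns
      exact hns.not_gt one_pos
    obtain ⟨k, hk⟩ := hE n
    refine ⟨k, ?_⟩
    have h₁ : φ (1 / ι₀ (E k)) < φ (1 / ι₀ n) :=
      hφ (one_div_lt_one_div_of_lt (hpos hn0) (hι₀ hk))
    have h₂ : φ (1 / ι₀ n) ≤ π s := by
      refine hπ (show j (1 / ι₀ n) ≤ s from ?_)
      rw [map_div₀, map_one, div_le_iff₀', ← RingHom.comp_apply]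
      · exact hns
      · exact (hj (hpos hn0).le).lt_of_ne' fun h => (hpos hn0).ne' (j.injective (h.trans (map_zero j).symm))
    have h₃ : φ (1 / ι₀ (E k)) = 1 / φ.comp ι₀ (E k) := by
      rw [map_div₀, map_one]
      rfl
    exact h₃ ▸ h₁.trans_le h₂
  · intro x hx hxc
    choose p m d hd hxe using hx
    let q : N → Q := fun n => (ι₀ (p n) - ι₀ (m n)) / ι₀ (d n)
    have hq : ∀ n, x n = φ (q n) := fun n => by
      rw [hxe, map_div₀, map_sub]
      rfl
    have hδ : ∀ n, 1 / φ.comp ι₀ (E n) = φ (1 / ι₀ (E n)) := fun n => by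
      rw [map_div₀, map_one]
      rfl
    have hqc : ∀ n i, q n - 1 / ι₀ (E n) ≤ q (n + i) ∧ q (n + i) ≤ q n + 1 / ι₀ (E n) := by
      intro n i
      have h := abs_lt.1 (hxc n i)
      rw [hδ, hq, hq, ← map_sub, ← map_neg, hφ.lt_iff_lt, hφ.lt_iff_lt] at h
      constructor <;> linarith
    -- From index `n` on, all terms lie within `1 / E n` of `q n`, so the germ does too. Passing to
    -- the residue field keeps the weak inequalities.
    let g : K := ((q : N → Q) : Germ (U : Filter N) Q)
    have hg : ∀ n, j (q n - 1 / ι₀ (E n)) ≤ g ∧ g ≤ j (q n + 1 / ι₀ (E n)) := by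
      intro n
      have hev : ∀ᶠ k in (U : Filter N), n ≤ k := hU (eventually_ge_atTop n)
      constructor <;> refine Germ.coe_le.2 (hev.mono fun k hk => ?_) <;>
        obtain ⟨i, rfl⟩ := exists_add_of_le hk
      · exact (hqc n i).1
      · exact (hqc n i).2
    have hgf : g ∈ finiteSubring (j.comp ι₀) := by
      obtain ⟨a, ha⟩ := hfin (q 0 - 1 / ι₀ (E 0))
      obtain ⟨b, hb⟩ := hfin (q 0 + 1 / ι₀ (E 0))
      have ha0 : 0 ≤ j.comp ι₀ a := (abs_nonneg _).trans ha
      have hb0 : 0 ≤ j.comp ι₀ b := (abs_nonneg _).trans hb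
      refine ⟨a + b, abs_le.2 ⟨?_, ?_⟩⟩ <;> rw [map_add]
      · linarith [(hg 0).1, (abs_le.1 ha).1]
      · linarith [(hg 0).2, (abs_le.1 hb).2]
    refine ⟨π ⟨g, hgf⟩, fun n => ?_⟩
    have h₁ : φ (q n - 1 / ι₀ (E n)) ≤ π ⟨g, hgf⟩ := hπ (hg n).1
    have h₂ : π ⟨g, hgf⟩ ≤ φ (q n + 1 / ι₀ (E n)) := hπ (hg n).2
    rw [map_sub, ← hδ, ← hq] at h₁
    rw [map_add, ← hδ, ← hq] at h₂
    rw [abs_le]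
    constructor <;> linarith

end completion

/-! ### Exponentiation and pairing in a model -/

namespace Struct
variable (M : Struct)

/-- The sequence `n ↦ 2ⁿ`. -/
def pow2 : M.D Ty.one :=
  let I := M.app (M.app (M.con (.S .nat (.nat ⇒ .nat) .nat)) (M.con (.K .nat (.nat ⇒ .nat))))
    (M.con (.K .nat .nat))
  M.app (M.app (M.con (.R .nat)) (M.app (M.con (.K (.nat ⇒ .nat) .nat))
    (M.app (M.app (M.con (.S .nat .nat .nat)) (M.con .add)) I))) (M.con .one)

end Struct

section arithmetic
variable {M : Struct}

theorem DenT.twoPow {w : World M} {n : TmX .nat} {k : M.D .nat} (h : DenT w n k) :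
    DenT w (twoPow n) (M.pow2 k) :=
  .app (.app (.app (.con _) (.app (.con _) (.app (.app (.con _) (.con _)) (.app (.app (.con _)
    (.con _)) (.con _))))) (.con _)) h

variable [hM : IsModel M]

open Numbers

theorem pow2_zero : M.pow2 0 = 1 := app_R_zero _ _

theorem pow2_succ (n : M.D .nat) : M.pow2 (n + 1) = M.pow2 n + M.pow2 n := by
  rw [Struct.pow2, app_R_succ, app_K, app_S, app_S, app_K]
  rfl

theorem pow2_pos (n : M.D .nat) : 0 < M.pow2 n := by
  refine DefP.induction (P := fun n => 0 < M.pow2 n)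
    (.lt (.const _) (.app (.const _) .fst)) ?_ ?_ n
  · rw [pow2_zero]; exact one_pos
  · intro n h
    rw [pow2_succ]
    exact add_pos h h

theorem lt_pow2 (n : M.D .nat) : n < M.pow2 n := by
  refine DefP.induction (P := fun n => n < M.pow2 n) (.lt .fst (.app (.const _) .fst)) ?_ ?_ n
  · exact pow2_pos _
  · intro n h
    rw [pow2_succ]
    have h₁ : 1 ≤ M.pow2 n := by
      have := (lt_add_one_iff 0 (M.pow2 n)).2 (zero_le _)
      by_contra! h'
      rw [← zero_add (1 : M.D .nat), lt_add_one_iff] at h'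
      exact h'.not_gt (pow2_pos n)
    exact add_lt_add_of_lt_of_le h h₁

theorem one_le_of_pos (a : M.D .nat) (h : 0 < a) : 1 ≤ a := by
  by_contra! h'
  rw [← zero_add (1 : M.D .nat), lt_add_one_iff] at h'
  exact h'.not_gt h

theorem exists_eq_succ (a : M.D .nat) : a = 0 ∨ ∃ b, a = b + 1 := by
  refine DefP.induction (P := fun a => a = 0 ∨ ∃ b, a = b + 1) ?_ (Or.inl rfl)
    (fun n _ => Or.inr ⟨n, rfl⟩) a
  exact (DefP.eq .fst (.const 0)).or (DefP.ex (Γ := [.nat]) (Q := fun b e => e.1 = b + 1)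
    (.eq .snd (.add .fst (.const 1))))

/-- Differences are not among the semiring axioms; they come from induction on `b`, whose statement
is arithmetical and hence definable. -/
instance : ExistsAddOfLE (M.D .nat) where
  exists_add_of_le {a b} := by
    refine DefP.induction (P := fun b => a ≤ b → ∃ c, b = a + c) ?_ ?_ ?_ b
    · refine ((DefP.lt .fst (.const a)).not.congr fun _ => not_lt).imp ?_
      exact DefP.ex (Γ := [.nat]) (Q := fun c e => e.1 = a + c) (.eq .snd (.add (.const a) .fst))
    · intro h
      exact ⟨0, by rw [add_zero, le_antisymm h (zero_le _)]⟩
    · intro n ih h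
      rcases h.lt_or_eq with h | h
      · obtain ⟨c, rfl⟩ := ih ((lt_add_one_iff _ _).1 h)
        exact ⟨c + 1, add_assoc _ _ _⟩
      · exact ⟨0, by rw [add_zero, h]⟩

/-- `c` codes the pair `(a, b)`. -/
def IsPair (c a b : M.D .nat) : Prop := c + c = (a + b) * (a + b + 1) + (b + b)

theorem DenT.isPair {w : World M} {s t u : TmX .nat} {a b c : M.D .nat} (hs : DenT w s c)
    (ht : DenT w t a) (hu : DenT w u b) : Den w (isPair s t u) (IsPair c a b) :=
  (Den.eq (hs.add hs) (((ht.add hu).mul ((ht.add hu).add .one)).add (hu.add hu))).congr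
    hM.eq_iff

theorem DefP.isPair {Γ : List Ty} {F G H : Args M Γ → M.D .nat} (hF : Poly M Γ .nat F)
    (hG : Poly M Γ .nat G) (hH : Poly M Γ .nat H) :
    DefP M Γ fun e => IsPair (F e) (G e) (H e) :=
  .eq (.add hF hF) (.add (.mul (.add hG hH) (.add (.add hG hH) (.const 1))) (.add hH hH))

/-- The codes with `a + b = s` run from `s(s + 1)/2` to `s(s + 1)/2 + s`, which is less than the
first code for `s + 1`. A larger sum would therefore give `c + c < c + c`. -/
theorem isPair_left_le {c a b a' b' : M.D .nat} (h : IsPair c a b) (h' : IsPair c a' b') :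
    a + b ≤ a' + b' := by
  by_contra! hlt
  have hlt' : a' + b' + 1 ≤ a + b := by
    by_contra! h
    exact ((lt_add_one_iff _ _).1 h).not_gt hlt
  have h₁ : (a' + b' + 1) * (a' + b' + 1 + 1) ≤ (a + b) * (a + b + 1) :=
    mul_le_mul hlt' (add_le_add_left hlt' 1) (zero_le _) (zero_le _)
  have h₂ : c + c < c + c := by
    calc c + c = (a' + b') * (a' + b' + 1) + (b' + b') := h'
      _ ≤ (a' + b') * (a' + b' + 1) + ((a' + b') + (a' + b')) := by
        have : b' ≤ a' + b' := le_add_of_nonneg_left (zero_le _)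
        exact add_le_add_right (add_le_add this this) _
      _ < (a' + b') * (a' + b' + 1) + ((a' + b') + (a' + b')) + (1 + 1) :=
        lt_add_of_pos_right _ (add_pos one_pos one_pos)
      _ = (a' + b' + 1) * (a' + b' + 1 + 1) := by ring
      _ ≤ (a + b) * (a + b + 1) := h₁
      _ ≤ (a + b) * (a + b + 1) + (b + b) :=
        le_add_of_nonneg_right (add_nonneg (zero_le _) (zero_le _))
      _ = c + c := h.symm
  exact lt_irrefl _ h₂

theorem double_injective {a b : M.D .nat} (h : a + a = b + b) : a = b := by
  rcases lt_trichotomy a b with h' | h' | h'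
  · exact ((add_lt_add h' h').ne h).elim
  · exact h'
  · exact ((add_lt_add h' h').ne' h).elim

theorem isPair_unique {c a b a' b' : M.D .nat} (h : IsPair c a b) (h' : IsPair c a' b') :
    a = a' ∧ b = b' := by
  have hs := le_antisymm (isPair_left_le h h') (isPair_left_le h' h)
  have hb : b + b = b' + b' := by
    have : c + c = (a' + b') * (a' + b' + 1) + (b + b) := by rw [← hs]; exact h
    exact add_left_cancel (this.symm.trans h')
  have hb := double_injective hb
  subst hb
  exact ⟨add_right_cancel hs, rfl⟩

/-- The successor of a code moves along the diagonal from `(a + 1, b)` to `(a, b + 1)`, and at its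
end from `(0, b)` to the start `(b + 1, 0)` of the next diagonal. -/
theorem exists_isPair (c : M.D .nat) : ∃ a b, IsPair c a b := by
  refine DefP.induction (P := fun c => ∃ a b, IsPair c a b) ?_ ?_ ?_ c
  · exact DefP.ex (Γ := [.nat]) (Q := fun a e => ∃ b, IsPair e.1 a b)
      (DefP.ex (Γ := [.nat, .nat]) (Q := fun b e => IsPair e.2.1 e.1 b) (.isPair .third .snd .fst))
  · exact ⟨0, 0, by simp [IsPair]⟩
  · rintro c ⟨a, b, h⟩
    rcases exists_eq_succ a with rfl | ⟨a, rfl⟩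
    · refine ⟨b + 1, 0, ?_⟩
      unfold IsPair at h ⊢
      calc c + 1 + (c + 1) = c + c + (1 + 1) := by ring
        _ = _ := by rw [h]; ring
    · refine ⟨a, b + 1, ?_⟩
      unfold IsPair at h ⊢
      calc c + 1 + (c + 1) = c + c + (1 + 1) := by ring
        _ = _ := by rw [h]; ring

theorem exists_isPair_code (a b : M.D .nat) : ∃ c, IsPair c a b := by
  have even : ∀ s : M.D .nat, ∃ t, s * (s + 1) = t + t := by
    refine DefP.induction (P := fun s => ∃ t, s * (s + 1) = t + t) ?_ ⟨0, by simp⟩ ?_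
    · exact DefP.ex (Γ := [.nat]) (Q := fun t e => e.1 * (e.1 + 1) = t + t)
        (.eq (.mul .snd (.add .snd (.const 1))) (.add .fst .fst))
    · rintro s ⟨t, h⟩
      refine ⟨t + (s + 1), ?_⟩
      calc (s + 1) * (s + 1 + 1) = s * (s + 1) + (s + 1) + (s + 1) := by ring
        _ = _ := by rw [h]; ring
  obtain ⟨t, ht⟩ := even (a + b)
  refine ⟨t + b, ?_⟩
  rw [IsPair, ht]
  ring

/-! ### The field of real numbers over a model -/

theorem Struct.exists_reals (M : Struct) [hM : IsModel M] :
    ∃ (R : Type) (_ : Field R) (_ : LinearOrder R) (_ : IsStrictOrderedRing R)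
      (ι : M.D .nat →+* R),
      StrictMono ι ∧ (∀ r, 0 < r → ∃ n, 1 / ι (M.pow2 n) < r) ∧
      ∀ x : M.D .nat → R, (∀ n, ∃ p m d, 0 < d ∧ x n = (ι p - ι m) / ι d) →
        (∀ n i, |x n - x (n + i)| < 1 / ι (M.pow2 n)) →
        ∃ r, ∀ n, |r - x n| ≤ 1 / ι (M.pow2 n) :=
  exists_completeField Numbers.zero_le one_le_of_pos M.pow2 fun d => ⟨d, lt_pow2 d⟩

/-- An ordered field containing the real numbers of a model. -/
def Struct.Re (M : Struct) [hM : IsModel M] : Type := M.exists_reals.choose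

noncomputable instance : Field M.Re := M.exists_reals.choose_spec.choose
noncomputable instance : LinearOrder M.Re := M.exists_reals.choose_spec.choose_spec.choose
instance : IsStrictOrderedRing M.Re := M.exists_reals.choose_spec.choose_spec.choose_spec.choose

noncomputable def ofNum : M.D .nat →+* M.Re :=
  M.exists_reals.choose_spec.choose_spec.choose_spec.choose_spec.choose

theorem ofNum_strictMono : StrictMono (ofNum (M := M)) :=
  M.exists_reals.choose_spec.choose_spec.choose_spec.choose_spec.choose_spec.1

/-- `2⁻ⁿ` -/
noncomputable def δ (n : M.D .nat) : M.Re := 1 / ofNum (M.pow2 n)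

theorem exists_δ_lt {r : M.Re} (h : 0 < r) : ∃ n, δ n < r :=
  M.exists_reals.choose_spec.choose_spec.choose_spec.choose_spec.choose_spec.2.1 r h

theorem exists_limit (x : M.D .nat → M.Re)
    (hx : ∀ n, ∃ p m d, 0 < d ∧ x n = (ofNum p - ofNum m) / ofNum d)
    (hx' : ∀ n i, |x n - x (n + i)| < δ n) : ∃ r, ∀ n, |r - x n| ≤ δ n :=
  M.exists_reals.choose_spec.choose_spec.choose_spec.choose_spec.choose_spec.2.2 x hx hx'

theorem ofNum_pos {a : M.D .nat} (h : 0 < a) : 0 < ofNum a := by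
  simpa using ofNum_strictMono h

theorem δ_pos (n : M.D .nat) : 0 < δ n := one_div_pos.2 (ofNum_pos (pow2_pos n))

theorem δ_succ (n : M.D .nat) : δ (n + 1) + δ (n + 1) = δ n := by
  have := (ofNum_pos (pow2_pos n)).ne'
  rw [δ, δ, pow2_succ, map_add]
  field_simp

theorem δ_anti {m n : M.D .nat} (h : m ≤ n) : δ n ≤ δ m := by
  refine one_div_le_one_div_of_le (ofNum_pos (pow2_pos m)) (ofNum_strictMono.monotone ?_)
  revert h
  refine DefP.induction (P := fun n => m ≤ n → M.pow2 m ≤ M.pow2 n) ?_ ?_ ?_ n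
  · exact ((DefP.lt .fst (.const m)).not.congr fun _ => not_lt).imp
      ((DefP.lt (.app (.const _) .fst) (.const (M.pow2 m))).not.congr fun _ => not_lt)
  · intro h
    rw [le_antisymm h (zero_le _)]
  · intro n ih h
    rcases h.lt_or_eq with h | rfl
    · rw [pow2_succ]
      exact (ih ((lt_add_one_iff _ _).1 h)).trans (le_add_of_nonneg_left (pow2_pos n).le)
    · exact le_rfl

/-! ### Codes of rational numbers -/

/-- The number `c` codes the fraction `(p - m) / (d + 1)`. -/
def IsCode (c p m d : M.D .nat) : Prop := ∃ a, IsPair c a d ∧ IsPair a p m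

theorem exists_isCode (c : M.D .nat) : ∃ p m d, IsCode c p m d := by
  obtain ⟨a, d, h⟩ := exists_isPair c
  obtain ⟨p, m, h'⟩ := exists_isPair a
  exact ⟨p, m, d, a, h, h'⟩

theorem exists_isCode_val (c : M.D .nat) : ∃ q : M.Re, ∃ p m d, IsCode c p m d ∧
    q = (ofNum p - ofNum m) / ofNum (d + 1) := by
  obtain ⟨p, m, d, h⟩ := exists_isCode c
  exact ⟨_, p, m, d, h, rfl⟩

/-- The rational number with the given code. -/
noncomputable def val (c : M.D .nat) : M.Re := (exists_isCode_val c).choose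

theorem IsCode.val_eq {c p m d : M.D .nat} (h : IsCode c p m d) :
    val c = (ofNum p - ofNum m) / ofNum (d + 1) := by
  obtain ⟨a, h₁, h₂⟩ := h
  obtain ⟨p', m', d', ⟨a', h₁', h₂'⟩, hv⟩ := (exists_isCode_val c).choose_spec
  obtain ⟨rfl, rfl⟩ := isPair_unique h₁ h₁'
  obtain ⟨rfl, rfl⟩ := isPair_unique h₂ h₂'
  exact hv

theorem succ_pos' (d : M.D .nat) : 0 < d + 1 := add_pos_of_nonneg_of_pos (zero_le d) one_pos

theorem exists_val_eq (p m : M.D .nat) {d : M.D .nat} (hd : 0 < d) :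
    ∃ c, val c = (ofNum p - ofNum m) / ofNum d := by
  rcases exists_eq_succ d with rfl | ⟨d, rfl⟩
  · exact (lt_irrefl _ hd).elim
  obtain ⟨a, ha⟩ := exists_isPair_code p m
  obtain ⟨c, hc⟩ := exists_isPair_code a d
  exact ⟨c, IsCode.val_eq ⟨a, hc, ha⟩⟩

theorem val_frac (c : M.D .nat) : ∃ p m d, 0 < d ∧ val c = (ofNum p - ofNum m) / ofNum d := by
  obtain ⟨p, m, d, h⟩ := exists_isCode c
  exact ⟨p, m, d + 1, succ_pos' d, h.val_eq⟩

theorem exists_val_add (a b : M.D .nat) : ∃ c, val c = val a + val b := by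
  obtain ⟨p, m, d, hd, h⟩ := val_frac a
  obtain ⟨p', m', d', hd', h'⟩ := val_frac b
  obtain ⟨c, hc⟩ := exists_val_eq (p * d' + d * p') (m * d' + d * m') (mul_pos hd hd')
  refine ⟨c, ?_⟩
  have := (ofNum_pos hd).ne'
  have := (ofNum_pos hd').ne'
  rw [hc, h, h']
  simp only [map_add, map_mul]
  field_simp
  ring

theorem exists_val_neg (a : M.D .nat) : ∃ c, val c = -val a := by
  obtain ⟨p, m, d, hd, h⟩ := val_frac a
  obtain ⟨c, hc⟩ := exists_val_eq m p hd
  exact ⟨c, by rw [hc, h, ← neg_div, neg_sub]⟩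

theorem exists_val_δ (n : M.D .nat) : ∃ c, val c = δ n := by
  obtain ⟨c, hc⟩ := exists_val_eq 1 0 (pow2_pos n)
  exact ⟨c, by rw [hc, δ, map_one, map_zero, sub_zero]⟩

theorem exists_val_zero : ∃ c : M.D .nat, val c = 0 := by
  obtain ⟨c, hc⟩ := exists_val_eq (0 : M.D .nat) 0 one_pos
  exact ⟨c, by simp [hc]⟩

theorem exists_val_one : ∃ c : M.D .nat, val c = 1 := by
  obtain ⟨c, hc⟩ := exists_val_eq (1 : M.D .nat) 0 one_pos
  exact ⟨c, by simp [hc]⟩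

/-- An expression for a fraction denotes the rational number `q`. -/
def DenF (w : World M) (F : Frac) (q : M.Re) : Prop :=
  ∃ p m d, DenT w F.pos p ∧ DenT w F.neg m ∧ DenT w F.den d ∧ 0 < d ∧
    q = (ofNum p - ofNum m) / ofNum d

namespace DenF
variable {w w' : World M} {F G : Frac} {q r : M.Re}

theorem mono (h : DenF w F q) (hw : w ≤ w') : DenF w' F q := by
  obtain ⟨p, m, d, h₁, h₂, h₃, h⟩ := h
  exact ⟨p, m, d, h₁.mono hw, h₂.mono hw, h₃.mono hw, h⟩

theorem add (hF : DenF w F q) (hG : DenF w G r) : DenF w (F.add G) (q + r) := by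
  obtain ⟨p, m, d, h₁, h₂, h₃, hd, rfl⟩ := hF
  obtain ⟨p', m', d', h₁', h₂', h₃', hd', rfl⟩ := hG
  refine ⟨_, _, _, (h₁.mul h₃').add (h₁'.mul h₃), (h₂.mul h₃').add (h₂'.mul h₃), h₃.mul h₃',
    mul_pos hd hd', ?_⟩
  have := (ofNum_pos hd).ne'
  have := (ofNum_pos hd').ne'
  rw [show M.add (M.mul p d') (M.mul p' d) = p * d' + p' * d from rfl,
    show M.add (M.mul m d') (M.mul m' d) = m * d' + m' * d from rfl,
    show M.mul d d' = d * d' from rfl]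
  simp only [map_add, map_mul]
  field_simp
  ring

theorem opp (hF : DenF w F q) : DenF w F.opp (-q) := by
  obtain ⟨p, m, d, h₁, h₂, h₃, hd, rfl⟩ := hF
  exact ⟨m, p, d, h₂, h₁, h₃, hd, by rw [← neg_div, neg_sub]⟩

theorem lt (hF : DenF w F q) (hG : DenF w G r) : Den w (F.lt G) (q < r) := by
  obtain ⟨p, m, d, h₁, h₂, h₃, hd, rfl⟩ := hF
  obtain ⟨p', m', d', h₁', h₂', h₃', hd', rfl⟩ := hG
  refine (Den.lt ((h₁.mul h₃').add (h₂'.mul h₃)) ((h₁'.mul h₃).add (h₂.mul h₃'))).congr ?_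
  rw [div_lt_div_iff₀ (ofNum_pos hd) (ofNum_pos hd')]
  show p * d' + m' * d < p' * d + m * d' ↔ _
  rw [← ofNum_strictMono.lt_iff_lt]
  simp only [map_add, map_mul]
  constructor <;> intro h <;> linarith

theorem dyadic {m n : TmX .nat} {a k : M.D .nat} (hm : DenT w m a) (hn : DenT w n k) :
    DenF w (.dyadic m n) (ofNum a * δ k) :=
  ⟨a, 0, M.pow2 k, hm, .zero, .twoPow hn, pow2_pos k, by rw [map_zero, sub_zero, δ, mul_one_div]⟩

theorem twoInv {n : TmX .nat} {k : M.D .nat} (hn : DenT w n k) :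
    DenF w (.dyadic oneX n) (δ k) := by
  have := dyadic .one hn
  rwa [show M.con .one = (1 : M.D .nat) from rfl, map_one, one_mul] at this

theorem two_dyadic {n : TmX .nat} {k : M.D .nat} (hn : DenT w n k) :
    DenF w (.dyadic (oneX +ₙ oneX) n) (2 * δ k) := by
  have := dyadic (DenT.add (.one (w := w)) .one) hn
  rwa [show M.add (M.con .one) (M.con .one) = (1 : M.D .nat) + 1 from rfl, map_add, map_one,
    one_add_one_eq_two] at this

theorem ofNat {m : TmX .nat} {a : M.D .nat} (hm : DenT w m a) : DenF w (.ofNat m) (ofNum a) :=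
  ⟨a, 0, 1, hm, .zero, .one, one_pos, by simp⟩

end DenF

/-- Decoding is an existential quantification over the components of a code. They exist and are
unique, so what is said depends only on the value. -/
theorem Den.decode {w : World M} {t : TmX .nat} {c : M.D .nat} (ht : DenT w t c)
    {φ : Frac → FmlX} {P : M.Re → Prop}
    (h : ∀ w' F q, w ≤ w' → DenF w' F q → Den w' (φ F) (P q)) :
    Den w (decode t φ) (P (val c)) := by
  have key : Den w (HOA.decode t φ) (∃ p m d : M.D .nat, IsCode c p m d ∧
      P ((ofNum p - ofNum m) / ofNum (d + 1))) := by
    refine Den.ex fun p w₁ t₁ l₁ hp => Den.ex fun m w₂ t₂ l₂ hm => Den.ex fun d w₃ t₃ l₃ hd => ?_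
    have hp := (hp.mono l₂).mono l₃
    have hm := hm.mono l₃
    have ht := ((ht.mono l₁).mono l₂).mono l₃
    refine Den.and (Den.ex fun a w₄ t₄ l₄ ha => ?_) (h w₃ _ _ ((l₁.trans l₂).trans l₃)
      ⟨p, m, d + 1, hp, hm, hd.add .one, succ_pos' d, rfl⟩)
    exact ((ht.mono l₄).isPair ha (hd.mono l₄)).and (ha.isPair (hp.mono l₄) (hm.mono l₄))
  refine key.congr ⟨?_, fun h => ?_⟩
  · rintro ⟨p, m, d, hc, hP⟩
    rwa [hc.val_eq]
  · obtain ⟨p, m, d, hc⟩ := exists_isCode c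
    exact ⟨p, m, d, hc, hc.val_eq ▸ h⟩

end arithmetic

/-! ### Real numbers of a model -/

section reals
variable {M : Struct} [hM : IsModel M]

open Numbers

theorem lt_of_approx {x y : M.D .nat → M.Re} {r s : M.Re} (hx : ∀ n, |r - x n| ≤ δ n)
    (hy : ∀ n, |s - y n| ≤ δ n) : (∃ n, x n + 2 * δ n < y n) ↔ r < s := by
  constructor
  · rintro ⟨n, h⟩
    linarith [(abs_le.1 (hx n)).2, (abs_le.1 (hy n)).1]
  · intro h
    -- Two approximation errors `δ n` and the required gap `2 * δ n` together must stay below `s -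
    -- r`.
    obtain ⟨n, hn⟩ := exists_δ_lt (show 0 < (s - r) / 4 by linarith)
    exact ⟨n, by linarith [(abs_le.1 (hx n)).1, (abs_le.1 (hy n)).2]⟩

/-- The sequence `a` represents a real. -/
def IsRe (a : M.D Ty.one) : Prop := ∀ n i, |val (a n) - val (a (n + i))| < δ n

theorem IsRe.exists_limit {a : M.D Ty.one} (ha : IsRe a) :
    ∃ r : M.Re, ∀ n, |r - val (a n)| ≤ δ n :=
  HOA.exists_limit (fun n => val (a n)) (fun _ => val_frac _) ha

open Classical in
/-- The real represented by a sequence. -/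
noncomputable def re (a : M.D Ty.one) : M.Re :=
  -- The value `0` for sequences that represent no real is a mere default.
  if h : IsRe a then h.exists_limit.choose else 0

theorem IsRe.abs_re_sub_le {a : M.D Ty.one} (ha : IsRe a) (n : M.D .nat) :
    |re a - val (a n)| ≤ δ n := by
  rw [re, dif_pos ha]
  exact ha.exists_limit.choose_spec n

/-- The points of the unit interval. -/
def InU (a : M.D Ty.one) : Prop := IsRe a ∧ 0 ≤ re a ∧ re a ≤ 1

/-- The expression `X` denotes the sequence `x` of rationals. -/
def DenR (w : World M) (X : RealX) (x : M.D .nat → M.Re) : Prop :=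
  ∀ w' n k, w ≤ w' → DenT w' n k → ∀ (φ : Frac → FmlX) (P : M.Re → Prop),
    (∀ w'' F q, w' ≤ w'' → DenF w'' F q → Den w'' (φ F) (P q)) → Den w' (X n φ) (P (x k))

/-- The expression `X` denotes the real number `r`. -/
def DenV (w : World M) (X : RealX) (r : M.Re) : Prop :=
  ∃ x, DenR w X x ∧ ∀ n, |r - x n| ≤ δ n

variable {w w' : World M} {X Y Z : RealX} {r s t : M.Re}

theorem DenR.mono {x : M.D .nat → M.Re} (h : DenR w X x) (hw : w ≤ w') : DenR w' X x :=
  fun w'' n k hw' => h w'' n k (hw.trans hw')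

theorem DenV.mono (h : DenV w X r) (hw : w ≤ w') : DenV w' X r := by
  obtain ⟨x, hx, hr⟩ := h
  exact ⟨x, hx.mono hw, hr⟩

theorem DenR.ofSeq {u : TmX Ty.one} {a : M.D Ty.one} (h : DenT w u a) :
    DenR w (.ofSeq u) fun n => val (a n) :=
  fun _ _ _ hw hn _ _ hP => Den.decode ((h.mono hw).app hn) hP

theorem DenV.ofSeq {u : TmX Ty.one} {a : M.D Ty.one} (h : DenT w u a) (ha : IsRe a) :
    DenV w (.ofSeq u) (re a) := ⟨_, DenR.ofSeq h, ha.abs_re_sub_le⟩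

theorem DenV.ofFrac {F : Frac} {q : M.Re} (h : DenF w F q) : DenV w (.ofFrac F) q :=
  ⟨fun _ => q, fun _ _ _ hw _ _ _ hP => hP _ _ _ le_rfl (h.mono hw), fun n => by
    simpa using (δ_pos n).le⟩

theorem DenV.zero : DenV w RealX.zero 0 := .ofFrac (by
  have := DenF.ofNat (.zero (w := w))
  rwa [show M.con .zero = (0 : M.D .nat) from rfl, map_zero] at this)

theorem DenV.one : DenV w RealX.one 1 := .ofFrac (by
  have := DenF.ofNat (.one (w := w))
  rwa [show M.con .one = (1 : M.D .nat) from rfl, map_one] at this)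

theorem DenV.twoInv {n : TmX .nat} {k : M.D .nat} (h : DenT w n k) :
    DenV w (.twoInv n) (δ k) := .ofFrac (.twoInv h)

theorem DenV.valX {f : TmX Ty.fn} {u : TmX Ty.one} {F : M.D Ty.fn} {a : M.D Ty.one}
    (hf : DenT w f F) (h : DenT w u a) (ha : IsRe (F a)) : DenV w (valX f u) (re (F a)) :=
  .ofSeq (hf.app h) ha

theorem DenV.add (hX : DenV w X r) (hY : DenV w Y s) : DenV w (X.add Y) (r + s) := by
  obtain ⟨x, hX, hx⟩ := hX
  obtain ⟨y, hY, hy⟩ := hY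
  refine ⟨fun n => x (n + 1) + y (n + 1), fun w' n k hw hn φ P hP => ?_, fun n => ?_⟩
  · refine hX w' _ _ hw (hn.add .one) _ (fun q => P (q + y (k + 1))) fun w'' F q hw' hF => ?_
    refine hY w'' _ _ (hw.trans hw') ((hn.mono hw').add .one) _ (fun q' => P (q + q')) ?_
    intro w₃ G q' hw₃ hG
    exact hP _ _ _ (hw'.trans hw₃) ((hF.mono hw₃).add hG)
  -- Two errors `δ (n + 1)` add up to `δ n`; this is why sums read their arguments one index further
  -- on.
  · have h₁ := abs_le.1 (hx (n + 1))
    have h₂ := abs_le.1 (hy (n + 1))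
    have := δ_succ n
    exact abs_le.2 ⟨by linarith, by linarith⟩

theorem DenV.sub (hX : DenV w X r) (hY : DenV w Y s) : DenV w (X.sub Y) (r - s) := by
  obtain ⟨x, hX, hx⟩ := hX
  obtain ⟨y, hY, hy⟩ := hY
  refine ⟨fun n => x (n + 1) - y (n + 1), fun w' n k hw hn φ P hP => ?_, fun n => ?_⟩
  · refine hX w' _ _ hw (hn.add .one) _ (fun q => P (q - y (k + 1))) fun w'' F q hw' hF => ?_
    refine hY w'' _ _ (hw.trans hw') ((hn.mono hw').add .one) _ (fun q' => P (q - q')) ?_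
    intro w₃ G q' hw₃ hG
    rw [sub_eq_add_neg]
    exact hP _ _ _ (hw'.trans hw₃) ((hF.mono hw₃).add hG.opp)
  · have h₁ := abs_le.1 (hx (n + 1))
    have h₂ := abs_le.1 (hy (n + 1))
    have := δ_succ n
    exact abs_le.2 ⟨by linarith, by linarith⟩

theorem Den.realLt (hX : DenV w X r) (hY : DenV w Y s) : Den w (X.lt Y) (r < s) := by
  obtain ⟨x, hX, hx⟩ := hX
  obtain ⟨y, hY, hy⟩ := hY
  refine Den.congr (Den.ex fun n w₁ u h₁ hn => ?_) (lt_of_approx hx hy)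
  refine hX w₁ _ _ h₁ hn _ (fun q => q + 2 * δ n < y n) fun w₂ F q h₂ hF => ?_
  refine hY w₂ _ _ (h₁.trans h₂) (hn.mono h₂) _ (fun q' => q + 2 * δ n < q') ?_
  intro w₃ G q' h₃ hG
  exact ((hF.mono h₃).add (.two_dyadic ((hn.mono h₂).mono h₃))).lt hG

theorem Den.realLe (hX : DenV w X r) (hY : DenV w Y s) : Den w (X.le Y) (r ≤ s) :=
  (Den.neg (Den.realLt hY hX)).congr not_lt

theorem Den.distLt (hX : DenV w X r) (hY : DenV w Y s) (hZ : DenV w Z t) :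
    Den w (X.distLt Y Z) (|r - s| < t) :=
  ((Den.realLt (hX.sub hY) hZ).and (Den.realLt (hY.sub hX) hZ)).congr (by
    rw [abs_sub_lt_iff])

theorem Den.realEq (hX : DenV w X r) (hY : DenV w Y s) : Den w (X.eq Y) (r = s) := by
  obtain ⟨x, hX, hx⟩ := hX
  obtain ⟨y, hY, hy⟩ := hY
  have key : Den w (X.eq Y) (∀ n, ¬ (x n + 2 * δ n < y n) ∧ ¬ (y n + 2 * δ n < x n)) := by
    refine Den.all fun n w₁ u h₁ hn => ?_
    refine hX w₁ _ _ h₁ hn _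
      (fun q => ¬ (q + 2 * δ n < y n) ∧ ¬ (y n + 2 * δ n < q)) fun w₂ F q h₂ hF => ?_
    refine hY w₂ _ _ (h₁.trans h₂) (hn.mono h₂) _
      (fun q' => ¬ (q + 2 * δ n < q') ∧ ¬ (q' + 2 * δ n < q)) ?_
    intro w₃ G q' h₃ hG
    have hF := hF.mono h₃
    have hd := DenF.two_dyadic ((hn.mono h₂).mono h₃)
    exact ((hF.add hd).lt hG).neg.and ((hG.add hd).lt hF).neg
  refine key.congr ?_
  rw [forall_and, ← not_exists, ← not_exists, lt_of_approx hx hy, lt_of_approx hy hx, not_lt,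
    not_lt]
  exact ⟨fun h => le_antisymm h.2 h.1, fun h => ⟨h.ge, h.le⟩⟩

theorem Den.isReal {u : TmX Ty.one} {a : M.D Ty.one} (h : DenT w u a) :
    Den w (isReal u) (IsRe a) := by
  refine Den.all fun n w₁ t₁ h₁ hn => Den.all fun i w₂ t₂ h₂ hi => ?_
  have h := (h.mono h₁).mono h₂
  have hn := hn.mono h₂
  refine Den.decode (h.app hn) (P := fun q => |q - val (a (n + i))| < δ n) fun w₃ F q h₃ hF => ?_
  refine Den.decode ((h.app (hn.add hi)).mono h₃) (P := fun q' => |q - q'| < δ n) ?_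
  intro w₄ G q' h₄ hG
  have hF := hF.mono h₄
  have hd := DenF.twoInv ((hn.mono h₃).mono h₄)
  refine (((hF.add hG.opp).lt hd).and ((hG.add hF.opp).lt hd)).congr ?_
  rw [abs_sub_lt_iff, sub_eq_add_neg, sub_eq_add_neg]

theorem Den.inUnit {u : TmX Ty.one} {a : M.D Ty.one} (h : DenT w u a) :
    Den w (inUnit u) (InU a) :=
  (Den.isReal h).and_of fun ha => (Den.realLe .zero (.ofSeq h ha)).and
    (Den.realLe (.ofSeq h ha) .one)

variable {φ : TmX Ty.one → FmlX} {P : M.D Ty.one → Prop}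

theorem Den.allUnit
    (h : ∀ a w' u, w ≤ w' → DenT w' u a → InU a → Den w' (φ u) (P a)) :
    Den w (allUnit φ) (∀ a, InU a → P a) :=
  Den.all fun a w' u hw hu => (Den.inUnit hu).imp_of fun ha => h a w' u hw hu ha

theorem Den.exUnit
    (h : ∀ a w' u, w ≤ w' → DenT w' u a → InU a → Den w' (φ u) (P a)) :
    Den w (exUnit φ) (∃ a, InU a ∧ P a) :=
  Den.ex fun a w' u hw hu => (Den.inUnit hu).and_of fun ha => h a w' u hw hu ha

theorem Den.allPos
    (h : ∀ a w' u, w ≤ w' → DenT w' u a → IsRe a → Den w' (φ u) (P a)) :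
    Den w (allPos φ) (∀ a, IsRe a → 0 < re a → P a) :=
  Den.all fun a w' u hw hu => (Den.isReal hu).imp_of fun ha =>
    (Den.realLt .zero (.ofSeq hu ha)).imp (h a w' u hw hu ha)

theorem Den.exPos
    (h : ∀ a w' u, w ≤ w' → DenT w' u a → IsRe a → Den w' (φ u) (P a)) :
    Den w (exPos φ) (∃ a, IsRe a ∧ 0 < re a ∧ P a) :=
  Den.ex fun a w' u hw hu => (Den.isReal hu).and_of fun ha =>
    (Den.realLt .zero (.ofSeq hu ha)).and (h a w' u hw hu ha)

theorem Den.inBall {u v : TmX Ty.one} {n : TmX .nat} {a b : M.D Ty.one} {k : M.D .nat}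
    (hu : DenT w u a) (hn : DenT w n k) (hv : DenT w v b) (ha : IsRe a) (hb : IsRe b) :
    Den w (inBall u n v) (|re a - re b| < δ k) :=
  Den.distLt (.ofSeq hu ha) (.ofSeq hv hb) (.twoInv hn)

/-- Equations between numbers. -/
theorem Den.numEq {s t : TmX Ty.nat} {a b : M.D Ty.nat} (hs : DenT w s a) (ht : DenT w t b) :
    Den w (s =ₙ t) (a = b) := (Den.eq hs ht).congr hM.eq_iff

theorem Den.mem {u : TmX Ty.one} {S : TmX Ty.set} {a : M.D Ty.one} {A : M.D Ty.set}
    (hu : DenT w u a) (hS : DenT w S A) : Den w (mem u S) (A a = 1) :=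
  Den.numEq (hS.app hu) .one

/-! ### The notions of real analysis in a model -/

def SubsetU (A : M.D Ty.set) : Prop :=
  (∀ x, IsRe x → A x = 0 ∨ A x = 1) ∧
  (∀ x y, IsRe x → IsRe y → re x = re y → A x = A y) ∧ ∀ x, IsRe x → A x = 1 → InU x

def OpenU (A : M.D Ty.set) : Prop :=
  SubsetU A ∧ ∀ x, InU x → A x = 1 → ∃ k, ∀ y, InU y → |re x - re y| < δ k → A y = 1

def DenseU (A : M.D Ty.set) : Prop :=
  ∀ k b, InU b → ∃ a, InU a ∧ A a = 1 ∧ |re b - re a| < δ k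

variable (M) in
def BaireU : Prop := ∀ O : M.D (.nat ⇒ Ty.set), (∀ n, OpenU (O n) ∧ DenseU (O n)) →
  (∀ n x, InU x → O (n + 1) x = 1 → O n x = 1) → ∃ x, InU x ∧ ∀ n, O n x = 1

def IsFn (f : M.D Ty.fn) : Prop :=
  (∀ x, InU x → IsRe (f x)) ∧ ∀ x, InU x → ∀ y, InU y → re x = re y → re (f x) = re (f y)

def ContAtU (f : M.D Ty.fn) (x : M.D Ty.one) : Prop :=
  ∀ e, IsRe e → 0 < re e → ∃ d, IsRe d ∧ 0 < re d ∧
    ∀ y, InU y → |re x - re y| < re d → |re (f x) - re (f y)| < re e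

def NearOpen (x₀ : M.D Ty.one) (P : M.D Ty.one → M.D Ty.set → Prop) : Prop :=
  ∀ e, IsRe e → 0 < re e → ∀ U, OpenU U → U x₀ = 1 →
    ∃ G, OpenU G ∧ (∃ x, InU x ∧ G x = 1) ∧ (∀ x, InU x → G x = 1 → U x = 1) ∧ P e G

def CliquishU (f : M.D Ty.fn) : Prop := ∀ x, InU x → NearOpen x fun e G =>
  ∀ x, InU x → ∀ y, InU y → G x = 1 → G y = 1 → |re (f x) - re (f y)| < re e

def UqcoAtU (f : M.D Ty.fn) (x₀ : M.D Ty.one) : Prop := NearOpen x₀ fun e G =>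
  ∀ x, InU x → G x = 1 → re (f x) < re (f x₀) + re e

def LqcoAtU (f : M.D Ty.fn) (x₀ : M.D Ty.one) : Prop := NearOpen x₀ fun e G =>
  ∀ x, InU x → G x = 1 → re (f x₀) - re e < re (f x)

def OscBallGt (f : M.D Ty.fn) (x : M.D Ty.one) (k : M.D .nat) (c : M.Re) : Prop :=
  ∃ y, InU y ∧ ∃ z, InU z ∧ |re x - re y| < δ k ∧ |re x - re z| < δ k ∧
    c < re (f y) - re (f z)

def IsOscU (f g : M.D Ty.fn) : Prop :=
  IsFn g ∧ ∀ x, InU x → ∀ e, IsRe e → 0 < re e → ∃ K, ∀ k, ¬ k < K →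
    OscBallGt f x k (re (g x) - re e) ∧ ¬ OscBallGt f x k (re (g x) + re e)

theorem Den.isSubset {S : TmX Ty.set} {A : M.D Ty.set} (hS : DenT w S A) :
    Den w (isSubset S) (SubsetU A) := by
  refine Den.and ?_ (Den.and ?_ ?_)
  · refine Den.all fun x w₁ u h₁ hu => (Den.isReal hu).imp (Den.or ?_ ?_)
    · exact Den.numEq ((hS.mono h₁).app hu) .zero
    · exact Den.numEq ((hS.mono h₁).app hu) .one
  · refine Den.all fun x w₁ u h₁ hu => Den.all fun y w₂ v h₂ hv => ?_
    have hu := hu.mono h₂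
    have hS := (hS.mono h₁).mono h₂
    refine (Den.isReal hu).imp_of fun hx => (Den.isReal hv).imp_of fun hy => ?_
    exact (Den.realEq (.ofSeq hu hx) (.ofSeq hv hy)).imp (Den.numEq (hS.app hu) (hS.app hv))
  · exact Den.all fun x w₁ u h₁ hu => (Den.isReal hu).imp
      ((Den.mem hu (hS.mono h₁)).imp (Den.inUnit hu))

theorem Den.isOpen {S : TmX Ty.set} {A : M.D Ty.set} (hS : DenT w S A) :
    Den w (isOpen S) (OpenU A) := by
  refine (Den.isSubset hS).and (Den.allUnit fun x w₁ u h₁ hu hx => ?_)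
  have hS := hS.mono h₁
  refine (Den.mem hu hS).imp (Den.ex fun k w₂ n h₂ hn => Den.allUnit fun y w₃ v h₃ hv hy => ?_)
  exact (Den.inBall ((hu.mono h₂).mono h₃) (hn.mono h₃) hv hx.1 hy.1).imp
    (Den.mem hv ((hS.mono h₂).mono h₃))

theorem Den.isDense {S : TmX Ty.set} {A : M.D Ty.set} (hS : DenT w S A) :
    Den w (isDense S) (DenseU A) := by
  refine Den.all fun k w₁ n h₁ hn => Den.allUnit fun b w₂ v h₂ hv hb =>
    Den.exUnit fun a w₃ u h₃ hu ha => ?_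
  exact (Den.mem hu (((hS.mono h₁).mono h₂).mono h₃)).and
    (Den.inBall (hv.mono h₃) ((hn.mono h₂).mono h₃) hu hb.1 ha.1)

theorem Den.BCT : Den w BCT (BaireU M) := by
  refine Den.all fun O w₁ t₁ h₁ hO => Den.imp ?_ (Den.imp ?_ ?_)
  · refine Den.all fun n w₂ t₂ h₂ hn => ?_
    have hO := (hO.mono h₂).app hn
    exact (Den.isOpen hO).and (Den.isDense hO)
  · refine Den.all fun n w₂ t₂ h₂ hn => Den.allUnit fun x w₃ t₃ h₃ hx _ => ?_
    have hO := (hO.mono h₂).mono h₃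
    have hn := hn.mono h₃
    exact (Den.mem hx (hO.app (hn.add .one))).imp (Den.mem hx (hO.app hn))
  · exact Den.exUnit fun x w₂ t₂ h₂ hx _ => Den.all fun n w₃ t₃ h₃ hn =>
      Den.mem (hx.mono h₃) (((hO.mono h₂).mono h₃).app hn)

theorem Den.isFun {t : TmX Ty.fn} {f : M.D Ty.fn} (ht : DenT w t f) :
    Den w (isFun t) (IsFn f) := by
  refine Den.and_of (Den.allUnit fun x w₁ u h₁ hu _ => Den.isReal ((ht.mono h₁).app hu))
    fun hf => Den.allUnit fun x w₁ u h₁ hu hx => Den.allUnit fun y w₂ v h₂ hv hy => ?_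
  have hu := hu.mono h₂
  have ht := (ht.mono h₁).mono h₂
  exact (Den.realEq (.ofSeq hu hx.1) (.ofSeq hv hy.1)).imp
    (Den.realEq (.valX ht hu (hf x hx)) (.valX ht hv (hf y hy)))

section functions
variable {u : TmX Ty.one} {x : M.D Ty.one} {t : TmX Ty.fn} {f : M.D Ty.fn}

theorem Den.contAt (ht : DenT w t f) (hu : DenT w u x) (hf : IsFn f) (hx : InU x) :
    Den w (contAt t u) (ContAtU f x) := by
  refine Den.allPos fun e w₁ t₁ h₁ he he' => Den.exPos fun d w₂ t₂ h₂ hd hd' =>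
    Den.allUnit fun y w₃ v h₃ hv hy => ?_
  have hu := ((hu.mono h₁).mono h₂).mono h₃
  have ht := ((ht.mono h₁).mono h₂).mono h₃
  exact (Den.distLt (.ofSeq hu hx.1) (.ofSeq hv hy.1) (.ofSeq (hd.mono h₃) hd')).imp
    (Den.distLt (.valX ht hu (hf.1 x hx)) (.valX ht hv (hf.1 y hy))
      (.ofSeq ((he.mono h₂).mono h₃) he'))

theorem Den.nearOpen {φ : TmX Ty.one → TmX Ty.set → FmlX} {P : M.D Ty.one → M.D Ty.set → Prop}
    (hu : DenT w u x) (h : ∀ e G w' t₁ t₂, w ≤ w' → DenT w' t₁ e → DenT w' t₂ G → IsRe e →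
      Den w' (φ t₁ t₂) (P e G)) : Den w (nearOpen u φ) (NearOpen x P) := by
  refine Den.allPos fun e w₁ t₁ h₁ he he' => Den.all fun U w₂ t₂ h₂ hU => ?_
  refine (Den.isOpen hU).imp ((Den.mem ((hu.mono h₁).mono h₂) hU).imp
    (Den.ex fun G w₃ t₃ h₃ hG => (Den.isOpen hG).and (Den.and ?_ (Den.and ?_ ?_))))
  · exact Den.exUnit fun x w₄ t₄ h₄ hx _ => Den.mem hx (hG.mono h₄)
  · exact Den.allUnit fun x w₄ t₄ h₄ hx _ => (Den.mem hx (hG.mono h₄)).imp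
      (Den.mem hx ((hU.mono h₃).mono h₄))
  · exact h e G w₃ _ _ ((h₁.trans h₂).trans h₃) ((he.mono h₂).mono h₃) hG he'

theorem Den.cliquish (ht : DenT w t f) (hf : IsFn f) : Den w (cliquish t) (CliquishU f) := by
  refine Den.allUnit fun x w₁ u h₁ hu _ => Den.nearOpen hu fun e G w₂ t₁ t₂ h₂ he hG he' => ?_
  refine Den.allUnit fun y w₃ t₃ h₃ hy hy' => Den.allUnit fun z w₄ t₄ h₄ hz hz' => ?_
  have hG := (hG.mono h₃).mono h₄
  have ht := (((ht.mono h₁).mono h₂).mono h₃).mono h₄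
  have hy := hy.mono h₄
  exact (Den.mem hy hG).imp ((Den.mem hz hG).imp (Den.distLt (.valX ht hy (hf.1 y hy'))
    (.valX ht hz (hf.1 z hz')) (.ofSeq ((he.mono h₃).mono h₄) he')))

theorem Den.uqcoAt (ht : DenT w t f) (hu : DenT w u x) (hf : IsFn f) (hx : InU x) :
    Den w (uqcoAt t u) (UqcoAtU f x) := by
  refine Den.nearOpen hu fun e G w₁ t₁ t₂ h₁ he hG he' => Den.allUnit fun y w₂ t₃ h₂ hy hy' => ?_
  have ht := (ht.mono h₁).mono h₂
  exact (Den.mem hy (hG.mono h₂)).imp (Den.realLt (.valX ht hy (hf.1 y hy'))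
    (.add (.valX ht ((hu.mono h₁).mono h₂) (hf.1 x hx)) (.ofSeq (he.mono h₂) he')))

theorem Den.lqcoAt (ht : DenT w t f) (hu : DenT w u x) (hf : IsFn f) (hx : InU x) :
    Den w (lqcoAt t u) (LqcoAtU f x) := by
  refine Den.nearOpen hu fun e G w₁ t₁ t₂ h₁ he hG he' => Den.allUnit fun y w₂ t₃ h₂ hy hy' => ?_
  have ht := (ht.mono h₁).mono h₂
  exact (Den.mem hy (hG.mono h₂)).imp (Den.realLt
    (.sub (.valX ht ((hu.mono h₁).mono h₂) (hf.1 x hx)) (.ofSeq (he.mono h₂) he'))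
    (.valX ht hy (hf.1 y hy')))

theorem Den.uqco (ht : DenT w t f) (hf : IsFn f) :
    Den w (uqco t) (∀ x, InU x → UqcoAtU f x) :=
  Den.allUnit fun _ _ _ h₁ hu hx => Den.uqcoAt (ht.mono h₁) hu hf hx

theorem Den.totallyDiscontinuous (ht : DenT w t f) (hf : IsFn f) :
    Den w (totallyDiscontinuous t) (∀ x, InU x → ¬ ContAtU f x) :=
  Den.allUnit fun _ _ _ h₁ hu hx => (Den.contAt (ht.mono h₁) hu hf hx).neg

theorem Den.oscBallGt {n : TmX .nat} {k : M.D .nat} {X : RealX} {c : M.Re} (ht : DenT w t f)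
    (hu : DenT w u x) (hn : DenT w n k) (hX : DenV w X c) (hf : IsFn f) (hx : InU x) :
    Den w (oscBallGt t u n X) (OscBallGt f x k c) := by
  refine Den.exUnit fun y w₁ t₁ h₁ hy hy' => Den.exUnit fun z w₂ t₂ h₂ hz hz' => ?_
  have ht := (ht.mono h₁).mono h₂
  have hu := (hu.mono h₁).mono h₂
  have hn := (hn.mono h₁).mono h₂
  have hX := (hX.mono h₁).mono h₂
  have hy := hy.mono h₂
  exact (Den.inBall hu hn hy hx.1 hy'.1).and ((Den.inBall hu hn hz hx.1 hz'.1).and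
    (Den.realLt hX (.sub (.valX ht hy (hf.1 y hy')) (.valX ht hz (hf.1 z hz')))))

theorem Den.isOsc {s : TmX Ty.fn} {g : M.D Ty.fn} (ht : DenT w t f) (hs : DenT w s g)
    (hf : IsFn f) : Den w (isOsc t s) (IsOscU f g) := by
  refine (Den.isFun hs).and_of fun hg => Den.allUnit fun x w₁ u h₁ hu hx =>
    Den.allPos fun e w₂ t₂ h₂ he he' => Den.ex fun K w₃ t₃ h₃ hK =>
      Den.all fun k w₄ t₄ h₄ hk => ?_
  have ht := (((ht.mono h₁).mono h₂).mono h₃).mono h₄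
  have hs := (((hs.mono h₁).mono h₂).mono h₃).mono h₄
  have hu := ((hu.mono h₂).mono h₃).mono h₄
  have he := (he.mono h₃).mono h₄
  have hgx := DenV.valX hs hu (hg.1 x hx)
  exact (Den.lt hk (hK.mono h₄)).neg.imp
    ((Den.oscBallGt ht hu hk (hgx.sub (.ofSeq he he')) hf hx).and
      (Den.oscBallGt ht hu hk (hgx.add (.ofSeq he he')) hf hx).neg)

end functions

/-! ### The five statements in a model -/

variable (M) in
def CliquishContU : Prop := ∀ f : M.D Ty.fn, IsFn f → CliquishU f → (∃ g, IsOscU f g) →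
  ∃ x, InU x ∧ ContAtU f x

variable (M) in
def CliquishLqcoU : Prop := ∀ f : M.D Ty.fn, IsFn f → CliquishU f → (∃ g, IsOscU f g) →
  ∃ x, InU x ∧ LqcoAtU f x

variable (M) in
def CliquishUqcoContU : Prop := ∀ f : M.D Ty.fn, IsFn f → CliquishU f →
  (∀ x, InU x → UqcoAtU f x) → (∃ g, IsOscU f g) → ∃ x, InU x ∧ ContAtU f x

variable (M) in
def TotDiscOscU : Prop := ∀ f g : M.D Ty.fn, IsFn f → (∀ x, InU x → ¬ ContAtU f x) →
  IsOscU f g → ∃ N c, InU c ∧ ∃ d, InU d ∧ re c < re d ∧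
    ∀ x, InU x → re c < re x → re x < re d → δ N ≤ re (g x)

theorem Den.cliquishCont : Den w cliquishCont (CliquishContU M) := by
  refine Den.all fun f w₁ t h₁ ht => (Den.isFun ht).imp_of fun hf => (Den.cliquish ht hf).imp
    (Den.imp (Den.ex fun g w₂ s h₂ hs => Den.isOsc (ht.mono h₂) hs hf) ?_)
  exact Den.exUnit fun x w₂ u h₂ hu hx => Den.contAt (ht.mono h₂) hu hf hx

theorem Den.cliquishLqco : Den w cliquishLqco (CliquishLqcoU M) := by
  refine Den.all fun f w₁ t h₁ ht => (Den.isFun ht).imp_of fun hf => (Den.cliquish ht hf).imp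
    (Den.imp (Den.ex fun g w₂ s h₂ hs => Den.isOsc (ht.mono h₂) hs hf) ?_)
  exact Den.exUnit fun x w₂ u h₂ hu hx => Den.lqcoAt (ht.mono h₂) hu hf hx

theorem Den.cliquishUqcoCont : Den w cliquishUqcoCont (CliquishUqcoContU M) := by
  refine Den.all fun f w₁ t h₁ ht => (Den.isFun ht).imp_of fun hf => (Den.cliquish ht hf).imp
    ((Den.uqco ht hf).imp
      (Den.imp (Den.ex fun g w₂ s h₂ hs => Den.isOsc (ht.mono h₂) hs hf) ?_))
  exact Den.exUnit fun x w₂ u h₂ hu hx => Den.contAt (ht.mono h₂) hu hf hx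

theorem Den.totDiscOsc : Den w totDiscOsc (TotDiscOscU M) := by
  refine Den.all fun f w₁ t h₁ ht => Den.all fun g w₂ s h₂ hs => ?_
  have ht := ht.mono h₂
  refine (Den.isFun ht).imp_of fun hf => (Den.totallyDiscontinuous ht hf).imp
    ((Den.isOsc ht hs hf).imp_of fun hg => ?_)
  refine Den.ex fun N w₃ t₃ h₃ hN => Den.exUnit fun c w₄ t₄ h₄ hc hc' =>
    Den.exUnit fun d w₅ t₅ h₅ hd hd' => ?_
  have hc := hc.mono h₅
  refine (Den.realLt (.ofSeq hc hc'.1) (.ofSeq hd hd'.1)).and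
    (Den.allUnit fun x w₆ t₆ h₆ hx hx' => ?_)
  have hs := ((hs.mono h₃).mono h₄).mono h₅
  exact (Den.realLt (.ofSeq (hc.mono h₆) hc'.1) (.ofSeq hx hx'.1)).imp
    ((Den.realLt (.ofSeq hx hx'.1) (.ofSeq (hd.mono h₆) hd'.1)).imp
      (Den.realLe (.twoInv (((hN.mono h₄).mono h₅).mono h₆))
        (.valX (hs.mono h₆) hx (hg.1.1 x hx'))))

end reals

section definability
variable {M : Struct} [hM : IsModel M]

open Numbers

/-! ### Definability of relations between rational and real numbers -/

/-- Constant sequences. -/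
def cst (c : M.D .nat) : M.D Ty.one := M.app (M.con (.K .nat .nat)) c

theorem cst_apply (c n : M.D .nat) : cst c n = c := app_K _ _

/-- Choice is available only for arguments of type `1`, so a number `c` is passed as the constant
sequence `cst c` and read off at `0`. -/
theorem exists_decoding (P : M.D .nat → M.D .nat → Prop)
    (hP : DefP M [.nat, Ty.one] fun e => P (e.2.1 0) e.1) (h : ∀ c, ∃ y, P c y) :
    ∃ f : M.D Ty.one, ∀ c, P c (f c) := by
  obtain ⟨Y, hY⟩ := DefP.choice (P := fun x y => P (x 0) y) hP fun x => h _
  obtain ⟨f, hf⟩ := Poly.exists_fun (F := fun c => Y (cst c))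
    (.app (.const Y) (.app (.const _) .fst))
  refine ⟨f, fun c => ?_⟩
  have := hY (cst c)
  rwa [cst_apply, ← hf] at this

theorem DefP.isCode {Γ : List Ty} {F G H I : Args M Γ → M.D .nat} (hF : Poly M Γ .nat F)
    (hG : Poly M Γ .nat G) (hH : Poly M Γ .nat H) (hI : Poly M Γ .nat I) :
    DefP M Γ fun e => IsCode (F e) (G e) (H e) (I e) :=
  DefP.ex (Q := fun a e => IsPair (F e) a (I e) ∧ IsPair a (G e) (H e))
    (.and (.isPair hF.weak .fst hI.weak) (.isPair .fst hG.weak hH.weak))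

/-- With the components of a code given by functions of the model, comparing coded rationals becomes
comparing applicative expressions. -/
theorem exists_components : ∃ p m d : M.D Ty.one, ∀ c, IsCode c (p c) (m c) (d c) := by
  obtain ⟨p, hp⟩ := exists_decoding (M := M) (fun c y => ∃ m d, IsCode c y m d)
    (DefP.ex (Γ := [.nat, Ty.one]) (Q := fun m e => ∃ d, IsCode (e.2.1 0) e.1 m d)
      (DefP.ex (Γ := [.nat, .nat, Ty.one]) (Q := fun d e => IsCode (e.2.2.1 0) e.2.1 e.1 d)
        (.isCode (.app .fourth (.const _)) .third .snd .fst))) exists_isCode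
  obtain ⟨m, hm⟩ := exists_decoding (M := M) (fun c y => ∃ d, IsCode c (p c) y d)
    (DefP.ex (Γ := [.nat, Ty.one]) (Q := fun d e => IsCode (e.2.1 0) (p (e.2.1 0)) e.1 d)
      (.isCode (.app .third (.const _)) (.app (.const p) (.app .third (.const _))) .snd .fst)) hp
  obtain ⟨d, hd⟩ := exists_decoding (M := M) (fun c y => IsCode c (p c) (m c) y)
    (.isCode (.app .snd (.const _)) (.app (.const p) (.app .snd (.const _)))
      (.app (.const m) (.app .snd (.const _))) .fst) hm
  exact ⟨p, m, d, hd⟩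

/-- The rational numbers given by applicative expressions. -/
def DefQ (M : Struct) [IsModel M] (Γ : List Ty) (q : Args M Γ → M.Re) : Prop :=
  ∃ A B C, Poly M Γ .nat A ∧ Poly M Γ .nat B ∧ Poly M Γ .nat C ∧ (∀ e, 0 < C e) ∧
    ∀ e, q e = (ofNum (A e) - ofNum (B e)) / ofNum (C e)

namespace DefQ
variable {Γ : List Ty} {q r : Args M Γ → M.Re} {F : Args M Γ → M.D .nat}

theorem val (hF : Poly M Γ .nat F) : DefQ M Γ fun e => val (F e) := by
  obtain ⟨p, m, d, h⟩ := exists_components (M := M)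
  exact ⟨_, _, _, .app (.const p) hF, .app (.const m) hF, .add (.app (.const d) hF) (.const 1),
    fun _ => succ_pos' _, fun e => (h _).val_eq⟩

theorem δ (hF : Poly M Γ .nat F) : DefQ M Γ fun e => δ (F e) :=
  ⟨_, _, _, .const 1, .const 0, .app (.const M.pow2) hF, fun _ => pow2_pos _, fun e => by
    rw [map_one, map_zero, sub_zero]; rfl⟩

theorem zero : DefQ M Γ fun _ => 0 :=
  ⟨_, _, _, .const 0, .const 0, .const 1, fun _ => one_pos, fun e => by simp⟩

theorem one : DefQ M Γ fun _ => 1 :=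
  ⟨_, _, _, .const 1, .const 0, .const 1, fun _ => one_pos, fun e => by simp⟩

theorem add (hq : DefQ M Γ q) (hr : DefQ M Γ r) : DefQ M Γ fun e => q e + r e := by
  obtain ⟨A, B, C, hA, hB, hC, h0, h⟩ := hq
  obtain ⟨A', B', C', hA', hB', hC', h0', h'⟩ := hr
  refine ⟨_, _, _, (hA.mul hC').add (hA'.mul hC), (hB.mul hC').add (hB'.mul hC), hC.mul hC',
    fun e => mul_pos (h0 e) (h0' e), fun e => ?_⟩
  have := (ofNum_pos (h0 e)).ne'
  have := (ofNum_pos (h0' e)).ne'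
  beta_reduce
  rw [h, h']
  simp only [map_add, map_mul]
  field_simp
  ring

theorem sub (hq : DefQ M Γ q) (hr : DefQ M Γ r) : DefQ M Γ fun e => q e - r e := by
  obtain ⟨A, B, C, hA, hB, hC, h0, h⟩ := hr
  have hn : DefQ M Γ fun e => -r e :=
    ⟨B, A, C, hB, hA, hC, h0, fun e => by beta_reduce; rw [h, ← neg_div, neg_sub]⟩
  simpa only [sub_eq_add_neg] using hq.add hn

theorem lt (hq : DefQ M Γ q) (hr : DefQ M Γ r) : DefP M Γ fun e => q e < r e := by
  obtain ⟨A, B, C, hA, hB, hC, h0, h⟩ := hq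
  obtain ⟨A', B', C', hA', hB', hC', h0', h'⟩ := hr
  refine (DefP.lt ((hA.mul hC').add (hB'.mul hC)) ((hA'.mul hC).add (hB.mul hC'))).congr
    fun e => ?_
  rw [h, h', div_lt_div_iff₀ (ofNum_pos (h0 e)) (ofNum_pos (h0' e)),
    ← ofNum_strictMono.lt_iff_lt]
  simp only [map_add, map_mul]
  constructor <;> intro h <;> linarith

theorem le (hq : DefQ M Γ q) (hr : DefQ M Γ r) : DefP M Γ fun e => q e ≤ r e :=
  (hr.lt hq).not.congr fun _ => not_lt

theorem eq (hq : DefQ M Γ q) (hr : DefQ M Γ r) : DefP M Γ fun e => q e = r e :=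
  ((hq.le hr).and (hr.le hq)).congr fun _ => antisymm_iff

theorem abs_sub_lt {s : Args M Γ → M.Re} (hq : DefQ M Γ q) (hr : DefQ M Γ r)
    (hs : DefQ M Γ s) : DefP M Γ fun e => |q e - r e| < s e :=
  (((hq.sub hr).lt hs).and ((hr.sub hq).lt hs)).congr fun _ => abs_sub_lt_iff.symm

end DefQ

theorem DefP.isRe {Γ : List Ty} {F : Args M Γ → M.D Ty.one} (hF : Poly M Γ Ty.one F) :
    DefP M Γ fun e => IsRe (F e) :=
  DefP.all (Q := fun n e => ∀ i, |val (F e n) - val (F e (n + i))| < HOA.δ n)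
    (DefP.all (Γ := .nat :: Γ)
      (Q := fun i e => |val (F e.2 e.1) - val (F e.2 (e.1 + i))| < HOA.δ e.1)
      (DefQ.abs_sub_lt (.val (.app hF.weak.weak .snd)) (.val (.app hF.weak.weak (.add .snd .fst)))
        (.δ .snd)))

theorem eq_of_forall_le_δ {r s : M.Re} (h : ∀ n, |r - s| ≤ δ n) : r = s := by
  by_contra hne
  obtain ⟨n, hn⟩ := exists_δ_lt (abs_pos.2 (sub_ne_zero.2 hne))
  exact (h n).not_gt hn

theorem isRe_cst (c : M.D .nat) : IsRe (cst c) := fun n i => by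
  rw [cst_apply, cst_apply, sub_self, abs_zero]
  exact δ_pos n

theorem re_cst (c : M.D .nat) : re (cst c) = val c := eq_of_forall_le_δ fun n => by
  simpa only [cst_apply] using (isRe_cst c).abs_re_sub_le n

theorem exists_re_δ (n : M.D .nat) : ∃ e : M.D Ty.one, IsRe e ∧ re e = δ n := by
  obtain ⟨c, hc⟩ := exists_val_δ n
  exact ⟨cst c, isRe_cst c, (re_cst c).trans hc⟩

/-- This and the next criteria express comparisons of values in the external field by one numerical
quantifier over rational approximations, which makes them definable in the model. -/
theorem IsRe.nonneg_iff {a : M.D Ty.one} (ha : IsRe a) :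
    0 ≤ re a ↔ ∀ n, 0 ≤ val (a n) + δ n := by
  constructor
  · intro h n
    linarith [(abs_le.1 (ha.abs_re_sub_le n)).2]
  · intro h
    by_contra! h'
    obtain ⟨n, hn⟩ := exists_δ_lt (show 0 < -re a / 2 by linarith)
    linarith [(abs_le.1 (ha.abs_re_sub_le n)).1, h n]

theorem IsRe.le_one_iff {a : M.D Ty.one} (ha : IsRe a) :
    re a ≤ 1 ↔ ∀ n, val (a n) ≤ 1 + δ n := by
  constructor
  · intro h n
    linarith [(abs_le.1 (ha.abs_re_sub_le n)).1]
  · intro h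
    by_contra! h'
    obtain ⟨n, hn⟩ := exists_δ_lt (show 0 < (re a - 1) / 2 by linarith)
    linarith [(abs_le.1 (ha.abs_re_sub_le n)).2, h n]

theorem IsRe.lt_δ_iff {a : M.D Ty.one} (ha : IsRe a) (n : M.D .nat) :
    re a < δ n ↔ ∃ m, val (a m) + δ m < δ n := by
  constructor
  · intro h
    obtain ⟨m, hm⟩ := exists_δ_lt (show 0 < (δ n - re a) / 2 by linarith)
    exact ⟨m, by linarith [(abs_le.1 (ha.abs_re_sub_le m)).1]⟩
  · rintro ⟨m, hm⟩
    linarith [(abs_le.1 (ha.abs_re_sub_le m)).2]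

theorem IsRe.abs_sub_lt_δ_iff {a b : M.D Ty.one} (ha : IsRe a) (hb : IsRe b) (k : M.D .nat) :
    |re a - re b| < δ k ↔ ∃ n, |val (a n) - val (b n)| < δ k - (δ n + δ n) := by
  constructor
  · intro h
    obtain ⟨n, hn⟩ := exists_δ_lt (show 0 < (δ k - |re a - re b|) / 4 by linarith)
    refine ⟨n, ?_⟩
    have h₁ := abs_le.1 (ha.abs_re_sub_le n)
    have h₂ := abs_le.1 (hb.abs_re_sub_le n)
    have h₃ := abs_le.1 (le_refl |re a - re b|)
    exact abs_lt.2 ⟨by linarith, by linarith⟩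
  · rintro ⟨n, hn⟩
    have h₁ := abs_le.1 (ha.abs_re_sub_le n)
    have h₂ := abs_le.1 (hb.abs_re_sub_le n)
    have h₃ := abs_lt.1 hn
    exact abs_lt.2 ⟨by linarith, by linarith⟩

/-- The approximation criteria hold only for sequences representing reals. The guard `P` is
therefore kept as part of the definable predicate. -/
theorem DefP.and_congr {Γ : List Ty} {P Q R : Args M Γ → Prop} (hP : DefP M Γ P)
    (hQ : DefP M Γ Q) (h : ∀ e, P e → (Q e ↔ R e)) : DefP M Γ fun e => P e ∧ R e :=
  (hP.and hQ).congr fun e => and_congr_right (h e)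

theorem DefP.inU {Γ : List Ty} {F : Args M Γ → M.D Ty.one} (hF : Poly M Γ Ty.one F) :
    DefP M Γ fun e => InU (F e) := by
  refine DefP.and_congr (.isRe hF) (Q := fun e => (∀ n, 0 ≤ val (F e n) + HOA.δ n) ∧
    ∀ n, val (F e n) ≤ 1 + HOA.δ n) (.and (.all ?_) (.all ?_)) fun e he => ?_
  · exact DefQ.le .zero (.add (.val (.app hF.weak .fst)) (.δ .fst))
  · exact DefQ.le (.val (.app hF.weak .fst)) (.add .one (.δ .fst))
  · rw [he.nonneg_iff, he.le_one_iff]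

theorem DefP.inU_and_lt_δ {Γ : List Ty} {F G : Args M Γ → M.D Ty.one} {n : Args M Γ → M.D .nat}
    (hF : Poly M Γ Ty.one F) (hG : Poly M Γ Ty.one G) (hn : Poly M Γ .nat n)
    (h : ∀ e, InU (F e) → IsRe (G e)) :
    DefP M Γ fun e => InU (F e) ∧ re (G e) < HOA.δ (n e) := by
  refine DefP.and_congr (.inU hF) (Q := fun e => ∃ m, val (G e m) + HOA.δ m < HOA.δ (n e))
    (.ex ?_) fun e he => ?_
  · exact DefQ.lt (.add (.val (.app hG.weak .fst)) (.δ .fst)) (.δ hn.weak)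
  · rw [(h e he).lt_δ_iff]

theorem DefP.inU_and_inBall {Γ : List Ty} {F : Args M Γ → M.D Ty.one} (hF : Poly M Γ Ty.one F)
    {b : M.D Ty.one} (hb : IsRe b) (k : M.D .nat) :
    DefP M Γ fun e => InU (F e) ∧ |re b - re (F e)| < HOA.δ k := by
  refine DefP.and_congr (.inU hF)
    (Q := fun e => ∃ n, |val (b n) - val (F e n)| < HOA.δ k - (HOA.δ n + HOA.δ n))
    (.ex ?_) fun e he => ?_
  · exact DefQ.abs_sub_lt (.val (.app (.const b) .fst)) (.val (.app hF.weak .fst))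
      (.sub (.δ (.const k)) (.add (.δ .fst) (.δ .fst)))
  · rw [hb.abs_sub_lt_δ_iff he.1]

end definability

section analysis
variable {M : Struct} [hM : IsModel M]

open Numbers

/-! ### Open subsets of the unit interval -/

/-- That the set respects equality of reals follows from openness: a sequence with the same value as
`x` lies in every ball around `x`. -/
theorem openU_of_char {P : M.D Ty.one → Prop} {A : M.D Ty.set}
    (hA : ∀ x, (P x → A x = 1) ∧ (¬ P x → A x = 0)) (hU : ∀ x, IsRe x → P x → InU x)
    (hP : ∀ x, InU x → P x → ∃ k, ∀ y, InU y → |re x - re y| < δ k → P y) :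
    OpenU A ∧ ∀ x, A x = 1 ↔ P x := by
  have key : ∀ x, A x = 1 ↔ P x := fun x =>
    ⟨fun h => by_contra fun h' => one_ne_zero (h.symm.trans ((hA x).2 h')), (hA x).1⟩
  have hext : ∀ x y, IsRe x → IsRe y → re x = re y → P x → P y := fun x y hx hy h hPx => by
    obtain ⟨k, hk⟩ := hP x (hU x hx hPx) hPx
    refine hk y ⟨hy, h ▸ (hU x hx hPx).2⟩ ?_
    rw [h, sub_self, abs_zero]
    exact δ_pos k
  refine ⟨⟨⟨fun x _ => ?_, fun x y hx hy h => ?_, fun x hx h => hU x hx ((key x).1 h)⟩,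
    fun x hx h => ?_⟩, key⟩
  · exact (em (P x)).symm.imp (hA x).2 (hA x).1
  · by_cases hPx : P x
    · rw [(hA x).1 hPx, (hA y).1 (hext x y hx hy h hPx)]
    · rw [(hA x).2 hPx, (hA y).2 fun h' => hPx (hext y x hy hx h.symm h')]
  · simpa only [key] using hP x hx ((key x).1 h)

/-- The sum of two indices serves as a common upper bound. -/
theorem ball_inter {x z : M.D Ty.one} {A B : M.D .nat} :
    |re x - re z| < δ (A + B) → |re x - re z| < δ A ∧ |re x - re z| < δ B := fun h =>
  ⟨h.trans_le (δ_anti (le_add_of_nonneg_right (zero_le _))),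
    h.trans_le (δ_anti (le_add_of_nonneg_left (zero_le _)))⟩

theorem OpenU.exists_inter {U V : M.D Ty.set} (hU : OpenU U) (hV : OpenU V) :
    ∃ G, OpenU G ∧ ∀ x, G x = 1 ↔ U x = 1 ∧ V x = 1 := by
  obtain ⟨A, hA⟩ := DefP.exists_char (P := fun x => U x = 1 ∧ V x = 1)
    ((DefP.eq (.app (.const U) .fst) (.const 1)).and (.eq (.app (.const V) .fst) (.const 1)))
  refine ⟨A, openU_of_char hA (fun x hx h => hU.1.2.2 x hx h.1) fun x hx h => ?_⟩
  obtain ⟨k, hk⟩ := hU.2 x hx h.1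
  obtain ⟨l, hl⟩ := hV.2 x hx h.2
  exact ⟨k + l, fun y hy hxy => ⟨hk y hy (ball_inter hxy).1, hl y hy (ball_inter hxy).2⟩⟩

theorem exists_openU_ball {b : M.D Ty.one} (hb : IsRe b) (k : M.D .nat) :
    ∃ G, OpenU G ∧ ∀ x, G x = 1 ↔ InU x ∧ |re b - re x| < δ k := by
  obtain ⟨A, hA⟩ := DefP.exists_char (P := fun x => InU x ∧ |re b - re x| < δ k)
    (DefP.inU_and_inBall (Γ := [Ty.one]) .fst hb k)
  refine ⟨A, openU_of_char hA (fun x _ h => h.1) fun x _ h => ?_⟩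
  obtain ⟨n, hn⟩ := exists_δ_lt (show 0 < δ k - |re b - re x| by linarith [h.2])
  refine ⟨n, fun y hy hxy => ⟨hy, ?_⟩⟩
  linarith [abs_sub_le (re b) (re x) (re y)]

variable (M) in
theorem exists_openU_univ : ∃ G : M.D Ty.set, OpenU G ∧ ∀ x, G x = 1 ↔ InU x := by
  obtain ⟨A, hA⟩ := DefP.exists_char (DefP.inU (M := M) (Γ := [Ty.one]) .fst)
  exact ⟨A, openU_of_char hA (fun x _ h => h) fun x _ _ => ⟨0, fun y hy _ => hy⟩⟩

/-! ### Oscillation and continuity -/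

section oscillation
variable {f g : M.D Ty.fn}

theorem IsOscU.exists_le (hg : IsOscU f g) {x : M.D Ty.one} (hx : InU x) (m : M.D .nat) :
    ∃ K, ∀ y, InU y → ∀ z, InU z → |re x - re y| < δ K → |re x - re z| < δ K →
      re (f y) - re (f z) ≤ re (g x) + δ m := by
  obtain ⟨e, he, hem⟩ := exists_re_δ m
  obtain ⟨K, hK⟩ := hg.2 x hx e he (hem ▸ δ_pos m)
  refine ⟨K, fun y hy z hz hxy hxz => ?_⟩
  by_contra! h
  exact (hK K (lt_irrefl K)).2 ⟨y, hy, z, hz, hxy, hxz, hem ▸ h⟩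

theorem IsOscU.exists_lt (hg : IsOscU f g) {x : M.D Ty.one} (hx : InU x) (m k : M.D .nat) :
    ∃ y, InU y ∧ ∃ z, InU z ∧ |re x - re y| < δ k ∧ |re x - re z| < δ k ∧
      re (g x) - δ m < re (f y) - re (f z) := by
  obtain ⟨e, he, hem⟩ := exists_re_δ m
  obtain ⟨K, hK⟩ := hg.2 x hx e he (hem ▸ δ_pos m)
  -- The index `K + k` is past the threshold `K`, and its ball lies inside the ball of radius `δ k`.
  obtain ⟨y, hy, z, hz, hxy, hxz, h⟩ := (hK (K + k) (le_add_of_nonneg_right (zero_le k)).not_gt).1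
  exact ⟨y, hy, z, hz, (ball_inter hxy).2, (ball_inter hxz).2, hem ▸ h⟩

/-- Upper semicontinuity of the oscillation: a ball around `x` on which `f` varies little contains a
ball around each point close to `x`. The whole sequence of sets is one object of the model because
the defining predicate is arithmetical. -/
theorem IsOscU.exists_openU (hg : IsOscU f g) : ∃ O : M.D (.nat ⇒ Ty.set),
    ∀ n, OpenU (O n) ∧ ∀ x, O n x = 1 ↔ InU x ∧ re (g x) < δ n := by
  obtain ⟨O, hO⟩ := DefP.exists_char₂ (P := fun n x => InU x ∧ re (g x) < δ n)
    (DefP.inU_and_lt_δ (Γ := [Ty.one, .nat]) .fst (.app (.const g) .fst) .snd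
      fun e he => hg.1.1 e.1 he)
  refine ⟨O, fun n => openU_of_char (hO n) (fun x _ h => h.1) fun x hx h => ?_⟩
  obtain ⟨m, hm⟩ := exists_δ_lt (show 0 < (δ n - re (g x)) / 2 by linarith [h.2])
  obtain ⟨K, hK⟩ := hg.exists_le hx m
  -- For `y` within `δ (K + 1)` of `x`, the ball of radius `δ (K + 1)` around `y` lies in that of
  -- radius `δ K` around `x`. The error `δ m` occurs once at `x` and once at `y`, hence the factor
  -- `1 / 2` above.
  refine ⟨K + 1, fun y hy hxy => ⟨hy, ?_⟩⟩
  obtain ⟨u, hu, v, hv, hyu, hyv, huv⟩ := hg.exists_lt hy m (K + 1)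
  have := δ_succ K
  have := hK u hu v hv (by linarith [abs_sub_le (re x) (re y) (re u)])
    (by linarith [abs_sub_le (re x) (re y) (re v)])
  linarith

theorem IsOscU.contAtU (hg : IsOscU f g) {x : M.D Ty.one} (hx : InU x)
    (h : ∀ n, re (g x) < δ n) : ContAtU f x := by
  intro e _ he
  -- One half bounds the oscillation at `x`, the other the error in approximating it on a ball.
  obtain ⟨n, hn⟩ := exists_δ_lt (half_pos he)
  obtain ⟨K, hK⟩ := hg.exists_le hx n
  obtain ⟨d, hd, hdK⟩ := exists_re_δ K
  refine ⟨d, hd, hdK ▸ δ_pos K, fun y hy hxy => ?_⟩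
  rw [hdK] at hxy
  have hxx : |re x - re x| < δ K := by rw [sub_self, abs_zero]; exact δ_pos K
  have h₁ := hK x hx y hy hxx hxy
  have h₂ := hK y hy x hx hxy hxx
  have h₃ := h n
  exact abs_sub_lt_iff.2 ⟨by linarith, by linarith⟩

/-- The hypothesis is the density of the open sets where `g < δ n`. A point common to all of them
has oscillation below every `δ n`. -/
theorem BaireU.exists_contAtU (hB : BaireU M) (hg : IsOscU f g)
    (h : ∀ n k b, InU b → ∃ a, InU a ∧ |re b - re a| < δ k ∧ re (g a) < δ n) :
    ∃ x, InU x ∧ ContAtU f x := by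
  obtain ⟨O, hO⟩ := hg.exists_openU
  have hdense : ∀ n, OpenU (O n) ∧ DenseU (O n) := fun n => ⟨(hO n).1, fun k b hb => by
    obtain ⟨a, ha, hab, hga⟩ := h n k b hb
    exact ⟨a, ha, ((hO n).2 a).2 ⟨ha, hga⟩, hab⟩⟩
  obtain ⟨x, hx, hxO⟩ := hB O hdense fun n x hx h => ((hO n).2 x).2
    ⟨hx, (((hO (n + 1)).2 x).1 h).2.trans_le (δ_anti (le_add_of_nonneg_right (zero_le 1)))⟩
  exact ⟨x, hx, hg.contAtU hx fun n => (((hO n).2 x).1 (hxO n)).2⟩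

/-- Cliquishness at `b` gives a nonempty open set inside the ball on which `f` varies little, and
the oscillation is small at each point of that set. -/
theorem CliquishU.exists_osc_lt (hf : CliquishU f) (hg : IsOscU f g) (n k : M.D .nat)
    (b : M.D Ty.one) (hb : InU b) : ∃ a, InU a ∧ |re b - re a| < δ k ∧ re (g a) < δ n := by
  obtain ⟨U, hU, hUb⟩ := exists_openU_ball hb.1 k
  -- One `δ (n + 1)` bounds the variation on `G`, the other the error in approximating `g a`;
  -- together they make `δ n`.
  obtain ⟨e, he, hen⟩ := exists_re_δ (n + 1)
  have hbb : |re b - re b| < δ k := by rw [sub_self, abs_zero]; exact δ_pos k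
  obtain ⟨G, hG, ⟨a, ha, hGa⟩, hGU, hosc⟩ :=
    hf b hb e he (hen ▸ δ_pos _) U hU ((hUb b).2 ⟨hb, hbb⟩)
  refine ⟨a, ha, ((hUb a).1 (hGU a ha hGa)).2, ?_⟩
  obtain ⟨l, hl⟩ := hG.2 a ha hGa
  obtain ⟨y, hy, z, hz, hay, haz, h⟩ := hg.exists_lt ha (n + 1) l
  have h' := hosc y hy z hz (hl y hy hay) (hl z hz haz)
  have := δ_succ n
  rw [hen] at h'
  linarith [le_abs_self (re (f y) - re (f z))]

theorem ContAtU.lqcoAtU {x : M.D Ty.one} (hx : InU x) (h : ContAtU f x) : LqcoAtU f x := by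
  intro e he he' U hU hUx
  obtain ⟨d, -, hd, h⟩ := h e he he'
  obtain ⟨n, hn⟩ := exists_δ_lt hd
  obtain ⟨V, hV, hVx⟩ := exists_openU_ball hx.1 n
  obtain ⟨G, hG, hGx⟩ := hU.exists_inter hV
  have hxx : |re x - re x| < δ n := by rw [sub_self, abs_zero]; exact δ_pos n
  refine ⟨G, hG, ⟨x, hx, (hGx x).2 ⟨hUx, (hVx x).2 ⟨hx, hxx⟩⟩⟩, fun y _ hy =>
    ((hGx y).1 hy).1, fun y hy hGy => ?_⟩
  have := h y hy ((((hVx y).1 ((hGx y).1 hGy).2).2).trans hn)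
  linarith [le_abs_self (re (f x) - re (f y))]

end oscillation

/-! ### Rational points -/

theorem exists_point {c : M.D .nat} (h0 : 0 ≤ val c) (h1 : val c ≤ 1) :
    ∃ a, InU a ∧ re a = val c :=
  ⟨cst c, ⟨isRe_cst c, by rwa [re_cst], by rwa [re_cst]⟩, re_cst c⟩

theorem exists_clip (c : M.D .nat) : ∃ a, InU a ∧ re a = max 0 (min 1 (val c)) := by
  obtain ⟨z, hz⟩ := exists_val_zero (M := M)
  obtain ⟨o, ho⟩ := exists_val_one (M := M)
  rcases le_total (val c) 0 with h | h
  · rw [max_eq_left (min_le_of_right_le h), ← hz]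
    exact exists_point hz.ge (hz.le.trans zero_le_one)
  rcases le_total (val c) 1 with h' | h'
  · rw [min_eq_right h', max_eq_right h]
    exact exists_point h h'
  · rw [min_eq_left h', max_eq_right zero_le_one, ← ho]
    exact exists_point (zero_le_one.trans ho.ge) ho.le

theorem exists_val_add_two_mul_δ (c j : M.D .nat) : ∃ c', val c' = val c + 2 * δ j := by
  obtain ⟨e, he⟩ := exists_val_δ j
  obtain ⟨e₂, he₂⟩ := exists_val_add e e
  obtain ⟨c', hc'⟩ := exists_val_add c e₂
  exact ⟨c', by rw [hc', he₂, he, two_mul]⟩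

/-- Around a rational approximation `q` of `b`, the endpoints `q - 2δ j` and `q + 2δ j` are clipped
to `[0,1]`. The interval stays nondegenerate even for `b = 0` or `b = 1`, since `b` lies strictly
between the unclipped endpoints. -/
theorem exists_interval {b : M.D Ty.one} (hb : InU b) (k : M.D .nat) :
    ∃ c, InU c ∧ ∃ d, InU d ∧ re c < re d ∧
      ∀ x, InU x → re c < re x → re x < re d → |re b - re x| < δ k := by
  -- Here `4 * δ j = δ k`. A point of the interval is within `2 * δ j` of the approximation, which
  -- is within `δ j` of `b`.
  have hj₁ := δ_succ k
  have hj₂ := δ_succ (k + 1)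
  have hj := δ_pos (k + 1 + 1)
  set j := k + 1 + 1
  have hr := abs_le.1 (hb.1.abs_re_sub_le j)
  obtain ⟨p, hp⟩ := exists_val_add_two_mul_δ (b j) j
  obtain ⟨l, hl⟩ := exists_val_neg (b j)
  obtain ⟨l', hl'⟩ := exists_val_add_two_mul_δ l j
  obtain ⟨m, hm⟩ := exists_val_neg l'
  obtain ⟨c, hc, hcm⟩ := exists_clip m
  obtain ⟨d, hd, hdp⟩ := exists_clip p
  obtain ⟨hb0, hb1⟩ := hb.2
  refine ⟨c, hc, d, hd, ?_, fun x hx hcx hxd => abs_sub_lt_iff.2 ?_⟩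
  · rw [hcm, hdp]
    refine max_lt_iff.2 ⟨lt_max_of_lt_right (lt_min one_pos (by linarith)),
      lt_max_of_lt_right (lt_min (min_lt_of_right_lt (by linarith)) ?_)⟩
    exact min_lt_of_right_lt (by linarith)
  · rw [hcm, max_lt_iff, min_lt_iff] at hcx
    rw [hdp, lt_max_iff, lt_min_iff] at hxd
    have h₁ := hcx.2.resolve_left hx.2.2.not_gt
    have h₂ := (hxd.resolve_left hx.2.1.not_gt).2
    constructor <;> linarith

theorem exists_ball {c d : M.D Ty.one} (hc : InU c) (hd : InU d) (h : re c < re d) :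
    ∃ p, InU p ∧ ∃ k, ∀ x, |re p - re x| < δ k → re c < re x ∧ re x < re d := by
  -- The centre is two steps `δ n` above an approximation of `c`, so it lies between `c + δ n` and
  -- `c + 3 * δ n`. The ball of radius `δ n` around it thus fits between `c` and `d`.
  obtain ⟨n, hn⟩ := exists_δ_lt (show 0 < (re d - re c) / 4 by linarith)
  obtain ⟨q, hq⟩ := exists_val_add_two_mul_δ (c n) n
  have hr := abs_le.1 (hc.1.abs_re_sub_le n)
  have hn' := δ_pos n
  obtain ⟨hc0, hc1⟩ := hc.2
  obtain ⟨hd0, hd1⟩ := hd.2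
  obtain ⟨p, hp, hpq⟩ := exists_point (c := q) (by linarith) (by linarith)
  refine ⟨p, hp, n, fun x hx => ?_⟩
  have := abs_lt.1 hx
  constructor <;> linarith

/-! ### A function without points of lower quasi-continuity -/

/-- Small values of `f` occur everywhere. -/
def DenseSmall (f : M.D Ty.fn) : Prop :=
  ∀ n k b, InU b → ∃ a, InU a ∧ |re b - re a| < δ k ∧ re (f a) < δ n

/-- Choice picks, for each sequence `x`, a code of `2⁻ⁿ` with `n` the least exit index. The chosen
code may depend on the presentation of `x`; only its value is determined. -/
theorem exists_exit_value {O : M.D (.nat ⇒ Ty.set)}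
    (h : ∀ x, InU x → ∃ n, O n x ≠ 1) : ∃ f : M.D Ty.fn, ∀ x, InU x → IsRe (f x) ∧
      ∃ n, O n x ≠ 1 ∧ (∀ i, i < n → O i x = 1) ∧ re (f x) = δ n := by
  obtain ⟨Y, hY⟩ := DefP.choice (P := fun x c => InU x →
      ∃ n, O n x ≠ 1 ∧ (∀ i, i < n → O i x = 1) ∧ val c = δ n) (by
    refine (DefP.inU .snd).imp (DefP.ex (Γ := [.nat, Ty.one])
      (Q := fun n e => O n e.2.1 ≠ 1 ∧ (∀ i, i < n → O i e.2.1 = 1) ∧ val e.1 = δ n) ?_)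
    refine DefP.and (DefP.eq (.app (.app (.const O) .fst) .third) (.const 1)).not
      (DefP.and (DefP.all (Γ := [.nat, .nat, Ty.one])
        (Q := fun i e => i < e.1 → O i e.2.2.1 = 1) ?_) (DefQ.eq (.val .snd) (.δ .fst)))
    exact (DefP.lt .fst .snd).imp (.eq (.app (.app (.const O) .fst) .fourth) (.const 1)))
    fun x => by
      by_cases hx : InU x
      · obtain ⟨n, hn, hlt⟩ := DefP.exists_least (P := fun n => O n x ≠ 1)
          (DefP.eq (.app (.app (.const O) .fst) (.const x)) (.const 1)).not (h x hx)
        obtain ⟨c, hc⟩ := exists_val_δ n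
        exact ⟨c, fun _ => ⟨n, hn, fun i hi => not_not.1 (hlt i hi), hc⟩⟩
      -- Choice asks for a value at every sequence; outside the unit interval any number will do.
      · exact ⟨0, fun hx' => (hx hx').elim⟩
  obtain ⟨f, hf⟩ := Poly.exists_fun (F := fun x => cst (Y x))
    (.app (.const _) (.app (.const Y) .fst))
  refine ⟨f, fun x hx => ?_⟩
  rw [hf, re_cst]
  exact ⟨isRe_cst _, hY x hx⟩

theorem mem_of_mem_of_le {O : M.D (.nat ⇒ Ty.set)} {x : M.D Ty.one}
    (h : ∀ n, O (n + 1) x = 1 → O n x = 1) {m n : M.D .nat} (hmn : m ≤ n) (hn : O n x = 1) :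
    O m x = 1 := by
  obtain ⟨k, rfl⟩ := exists_add_of_le hmn
  refine DefP.induction (P := fun k => O (m + k) x = 1 → O m x = 1) ?_ ?_ ?_ k hn
  · exact (DefP.eq (.app (.app (.const O) (.add (.const m) .fst)) (.const x)) (.const 1)).imp
      (.eq (.const (O m x)) (.const 1))
  · rw [add_zero]
    exact id
  · intro k ih hk
    rw [← add_assoc] at hk
    exact ih (h _ hk)

/-- Near `x` the supremum is `f x`, attained at `x` by `husc`, and the infimum is `0`, since `f` is
positive and arbitrarily small in every ball. -/
theorem DenseSmall.isOscU {f : M.D Ty.fn} (hf : IsFn f) (hd : DenseSmall f)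
    (h0 : ∀ x, InU x → 0 < re (f x))
    (husc : ∀ x, InU x → ∃ k, ∀ y, InU y → |re x - re y| < δ k → re (f y) ≤ re (f x)) :
    IsOscU f f := by
  refine ⟨hf, fun x hx e _ he => ?_⟩
  obtain ⟨K, hK⟩ := husc x hx
  refine ⟨K, fun k hk => ⟨?_, ?_⟩⟩
  · obtain ⟨n, hn⟩ := exists_δ_lt he
    obtain ⟨z, hz, hxz, hfz⟩ := hd n k x hx
    refine ⟨x, hx, z, hz, ?_, hxz, by linarith⟩
    rw [sub_self, abs_zero]
    exact δ_pos k
  · rintro ⟨y, hy, z, hz, hxy, -, h⟩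
    linarith [hK y hy (hxy.trans_le (δ_anti (not_lt.1 hk))), h0 z hz]

/-- Every nonempty open set contains points where `f` is below half of the positive value `f x`. -/
theorem DenseSmall.not_lqcoAtU {f : M.D Ty.fn} (hd : DenseSmall f) {x : M.D Ty.one} (hx : InU x)
    (h0 : 0 < re (f x)) : ¬ LqcoAtU f x := by
  intro h
  obtain ⟨n, hn⟩ := exists_δ_lt (half_pos h0)
  obtain ⟨e, he, hen⟩ := exists_re_δ n
  obtain ⟨U, hU, hUx⟩ := exists_openU_univ M
  obtain ⟨G, hG, ⟨a, ha, hGa⟩, -, hGf⟩ := h e he (hen ▸ δ_pos n) U hU ((hUx x).2 hx)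
  obtain ⟨k, hk⟩ := hG.2 a ha hGa
  obtain ⟨y, hy, hay, hfy⟩ := hd n k a ha
  have := hGf y hy (hk y hy hay)
  rw [hen] at this
  linarith

/-- A failure of Baire yields one counterexample to everything: `f(x) = 2⁻ⁿ` for the first `n` with
`x ∉ O n`. -/
theorem exists_pathological (h : ¬ BaireU M) : ∃ f : M.D Ty.fn, IsFn f ∧ CliquishU f ∧
    (∀ x, InU x → UqcoAtU f x) ∧ IsOscU f f ∧ DenseSmall f ∧ ∀ x, InU x → ¬ LqcoAtU f x := by
  unfold BaireU at h
  push Not at h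
  obtain ⟨O, hO, hdec, hemp⟩ := h
  obtain ⟨f, hf⟩ := exists_exit_value hemp
  have h0 : ∀ x, InU x → 0 < re (f x) := fun x hx => by
    obtain ⟨-, n, -, -, h⟩ := hf x hx
    exact h ▸ δ_pos n
  -- The sets decrease, so a point of `O n` has an exit index of at least `n + 1`. The index gained
  -- gives upper semicontinuity, and also the strict bound `hlt`.
  have hle : ∀ n x, InU x → O n x = 1 → re (f x) ≤ δ (n + 1) := fun n x hx hn => by
    obtain ⟨-, m, hm, -, h⟩ := hf x hx
    rw [h]
    refine δ_anti (not_lt.1 fun hmn => hm ?_)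
    exact mem_of_mem_of_le (fun i => hdec i x hx) ((lt_add_one_iff m n).1 hmn) hn
  have hlt : ∀ n x, InU x → O n x = 1 → re (f x) < δ n := fun n x hx hn => by
    linarith [hle n x hx hn, δ_succ n, δ_pos (n + 1)]
  have hd : DenseSmall f := fun n k b hb => by
    obtain ⟨a, ha, hOa, hab⟩ := (hO n).2 k b hb
    exact ⟨a, ha, hab, hlt n a ha hOa⟩
  -- Exit index `0` gives the largest possible value. For exit index `m + 1`, the point lies in the
  -- open set `O m`, on which `f` is at most `δ (m + 1)`.
  have husc : ∀ x, InU x → ∃ k, ∀ y, InU y → |re x - re y| < δ k → re (f y) ≤ re (f x) := by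
    intro x hx
    obtain ⟨-, n, -, hn, h⟩ := hf x hx
    rw [h]
    rcases exists_eq_succ n with rfl | ⟨m, rfl⟩
    · refine ⟨0, fun y hy _ => ?_⟩
      obtain ⟨-, m, -, -, h⟩ := hf y hy
      exact h ▸ δ_anti (zero_le m)
    · obtain ⟨k, hk⟩ := (hO m).1.2 x hx (hn m ((lt_add_one_iff m m).2 le_rfl))
      exact ⟨k, fun y hy hxy => hle m y hy (hk y hy hxy)⟩
  -- Sequences representing the same real lie in each other's balls, so upper semicontinuity, used
  -- in both directions, shows that `f` respects equality of reals.
  have hext : ∀ x, InU x → ∀ y, InU y → re x = re y → re (f y) ≤ re (f x) := by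
    intro x hx y hy hxy
    obtain ⟨k, hk⟩ := husc x hx
    refine hk y hy ?_
    rw [hxy, sub_self, abs_zero]
    exact δ_pos k
  have hfn : IsFn f := ⟨fun x hx => (hf x hx).1, fun x hx y hy hxy =>
    (hext y hy x hx hxy.symm).antisymm (hext x hx y hy hxy)⟩
  -- The set `U ∩ O n` is nonempty by density and `f < δ n` on it. As `f` is positive, this yields
  -- both cliquishness and upper quasi-continuity.
  have hnear : ∀ x, InU x → NearOpen x fun e G => ∀ y, InU y → G y = 1 → re (f y) < re e := by
    intro x hx e _ he U hU hUx
    obtain ⟨n, hn⟩ := exists_δ_lt he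
    obtain ⟨k, hk⟩ := hU.2 x hx hUx
    obtain ⟨a, ha, hOa, hxa⟩ := (hO n).2 k x hx
    obtain ⟨G, hG, hGx⟩ := hU.exists_inter (hO n).1
    exact ⟨G, hG, ⟨a, ha, (hGx a).2 ⟨hk a ha hxa, hOa⟩⟩, fun y _ hy => ((hGx y).1 hy).1,
      fun y hy hGy => (hlt n y hy ((hGx y).1 hGy).2).trans hn⟩
  refine ⟨f, hfn, fun x hx e he he' U hU hUx => ?_, fun x hx e he he' U hU hUx => ?_,
    hd.isOscU hfn h0 husc, hd, fun x hx => hd.not_lqcoAtU hx (h0 x hx)⟩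
  · obtain ⟨G, hG, hne, hGU, h⟩ := hnear x hx e he he' U hU hUx
    refine ⟨G, hG, hne, hGU, fun y hy z hz hGy hGz => abs_sub_lt_iff.2 ?_⟩
    constructor <;> linarith [h y hy hGy, h z hz hGz, h0 y hy, h0 z hz]
  · obtain ⟨G, hG, hne, hGU, h⟩ := hnear x hx e he he' U hU hUx
    exact ⟨G, hG, hne, hGU, fun y hy hGy => by linarith [h y hy hGy, h0 x hx]⟩

/-! ### The equivalences -/

variable (M)

theorem cliquishContU_iff : CliquishContU M ↔ BaireU M := by
  refine ⟨fun h => by_contra fun hB => ?_, fun hB f _ hcl ⟨g, hg⟩ =>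
    hB.exists_contAtU hg (hcl.exists_osc_lt hg)⟩
  obtain ⟨f, hf, hcl, -, hosc, -, hl⟩ := exists_pathological hB
  obtain ⟨x, hx, hc⟩ := h f hf hcl ⟨f, hosc⟩
  exact hl x hx (hc.lqcoAtU hx)

theorem cliquishLqcoU_iff : CliquishLqcoU M ↔ BaireU M := by
  refine ⟨fun h => by_contra fun hB => ?_, fun hB f hf hcl hg => ?_⟩
  · obtain ⟨f, hf, hcl, -, hosc, -, hl⟩ := exists_pathological hB
    obtain ⟨x, hx, hc⟩ := h f hf hcl ⟨f, hosc⟩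
    exact hl x hx hc
  · obtain ⟨x, hx, hc⟩ := (cliquishContU_iff M).2 hB f hf hcl hg
    exact ⟨x, hx, hc.lqcoAtU hx⟩

theorem cliquishUqcoContU_iff : CliquishUqcoContU M ↔ BaireU M := by
  refine ⟨fun h => by_contra fun hB => ?_, fun hB f hf hcl _ hg =>
    (cliquishContU_iff M).2 hB f hf hcl hg⟩
  obtain ⟨f, hf, hcl, hu, hosc, -, hl⟩ := exists_pathological hB
  obtain ⟨x, hx, hc⟩ := h f hf hcl hu ⟨f, hosc⟩
  exact hl x hx (hc.lqcoAtU hx)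

/-- If the conclusion fails, every interval contains points of arbitrarily small oscillation, which
is the density needed for Baire. Conversely, a lower bound on an interval contradicts the density of
small values of the pathological `f`, which is its own oscillation function. -/
theorem totDiscOscU_iff : TotDiscOscU M ↔ BaireU M := by
  refine ⟨fun h => by_contra fun hB => ?_, fun hB f g _ hdisc hg => by_contra fun h => ?_⟩
  · obtain ⟨f, hf, -, -, hosc, hd, hl⟩ := exists_pathological hB
    obtain ⟨N, c, hc, d, hd', hcd, hge⟩ :=
      h f f hf (fun x hx hcont => hl x hx (hcont.lqcoAtU hx)) hosc
    obtain ⟨p, hp, k, hk⟩ := exists_ball hc hd' hcd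
    obtain ⟨a, ha, hpa, hfa⟩ := hd N k p hp
    exact (hge a ha (hk a hpa).1 (hk a hpa).2).not_gt hfa
  · push Not at h
    obtain ⟨x, hx, hc⟩ := hB.exists_contAtU hg fun n k b hb => by
      obtain ⟨c, hc, d, hd, hcd, hk⟩ := exists_interval hb k
      obtain ⟨a, ha, hca, had, hga⟩ := h n c hc d hd hcd
      exact ⟨a, ha, hk a ha hca had, hga⟩
    exact hdisc x hx hc

end analysis

/-! ### From the models back to derivations -/

theorem Den.of_mem {M : Struct} [IsModel M] (w : World M) {φ : FmlX}
    (h : φ ∈ [HOA.BCT, HOA.cliquishCont, HOA.cliquishLqco, HOA.cliquishUqcoCont,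
      HOA.totDiscOsc]) : Den w φ (BaireU M) := by
  simp only [List.mem_cons, List.not_mem_nil, or_false] at h
  rcases h with rfl | rfl | rfl | rfl | rfl
  · exact Den.BCT
  · exact Den.cliquishCont.congr (cliquishContU_iff M)
  · exact Den.cliquishLqco.congr (cliquishLqcoU_iff M)
  · exact Den.cliquishUqcoCont.congr (cliquishUqcoContU_iff M)
  · exact Den.totDiscOsc.congr (totDiscOscU_iff M)

end HOA

/-- In every model both formulas denote the same proposition `BaireU M`. Their equivalence is thus
true in all models, hence derivable by completeness. -/
theorem theorem2p13 (φ ψ : HOA.FmlX)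
    (hφ : φ ∈ [HOA.BCT, HOA.cliquishCont, HOA.cliquishLqco, HOA.cliquishUqcoCont, HOA.totDiscOsc])
    (hψ : ψ ∈ [HOA.BCT, HOA.cliquishCont, HOA.cliquishLqco, HOA.cliquishUqcoCont, HOA.totDiscOsc]) :
    HOA.Proves HOA.ACA0omega (HOA.iffX φ ψ).close :=
  HOA.proves_of_isModel _ fun _ _ _ =>
    (HOA.Den.sat_close ((HOA.Den.of_mem _ hφ).iff (HOA.Den.of_mem _ hψ))).2 Iff.rfl
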